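/- Let $G$ be the directed graph with two vertices $v_1,v_2$, a loop $e_1$ at $v_1$, a loop $e_2$ at $v_2$, and one further edge $e$ with source $s(e)=v_2$ and range $r(e)=v_1$. Let $\mathbb F_G^+$ be the set of all finite directed paths in $G$ (vertices being the paths of length $0$), where $pq$ denotes "first $q$, then $p$", and let $\mathcal H_G=\ell^2(\mathbb F_G^+)$ with orthonormal basis $(\xi_p)_{p\in\mathbb F_G^+}$. For a vertex $x$ and an edge $f$ define bounded operators on $\mathcal H_G$ by $L_x\xi_p=\xi_p$ if $r(p)=x$ and $L_x\xi_p=0$ otherwise, and $L_f\xi_p=\xi_{fp}$ if $r(p)=s(f)$ and $L_f\xi_p=0$ otherwise. Let $\mathcal A_G$ and $\mathfrak L_G$ be the closures, in the norm topology and in the weak operator topology respectively, of the algebra generated by all the $L_x$ and $L_f$. Let $H^1(\mathcal A_G,\mathfrak L_G)=\mathrm{Der}(\mathcal A_G,\mathfrak L_G)/\mathrm{Inn}(\mathcal A_G,\mathfrak L_G)$, where $\mathrm{Der}$ is the complex vector space of bounded linear maps $\delta:\mathcal A_G\to\mathfrak L_G$ with $\delta(AB)=\delta(A)B+A\delta(B)$,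 and $\mathrm{Inn}$ is the subspace of the derivations $\delta_T(A)=AT-TA$ with $T\in\mathfrak L_G$. Let $H^\infty(\mathbb D)$ and $H^\infty(\mathbb D^2)$ be the spaces of bounded holomorphic functions on the open unit disc and on the open bidisc, and let $H^\infty(\mathbb D)\otimes 1+1\otimes H^\infty(\mathbb D)$ be the space of the functions $(z,w)\mapsto f(z)+h(w)$ with $f,h\in H^\infty(\mathbb D)$. Then, as complex vector spaces, $$H^1(\mathcal A_G,\mathfrak L_G)\;\cong\;\frac{H^\infty(\mathbb D^2)}{H^\infty(\mathbb D)\otimes 1+1\otimes H^\infty(\mathbb D)} .$$ More precisely, there is a linear isomorphism from the left-hand side to the right-hand side such that for every $g\in H^\infty(\mathbb D^2)$ the class of $g$ is the image of the class of a bounded derivation $\delta$ with $\delta(L_{v_1})=\delta(L_{v_2})=\delta(L_{e_1})=\delta(L_{e_2})=0$ and $$g(z,w)=\sum_{m,n\ge 0}\langle \delta(L_e)\xi_{v_2},\,\xi_{e_1^m e e_2^n}\rangle\, z^n w^m\qquad (z,w\in\mathbb D)$$ (inner product linear in the first variable). In particular, $H^1(\mathcal A_G,\mathfrak L_G)\neq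 0$. -/

import Mathlib

noncomputable section

/-! ### Path spaces of directed graphs

A directed graph is a Mathlib quiver: an edge `e` with `s(e) = x` and `r(e) = y` is an
`e : x ⟶ y`. A path runs from its source to its range; `Quiver.Path.nil` at `x` is the path of
length zero given by the vertex `x`, and `p.cons e` is the path `p` followed by `e`, i.e. the
product `e p` of the free semigroupoid (where products are composed from right to left). -/

/-- The free semigroupoid (path space) of a directed graph: all finite directed paths. -/
structure FreeSemigroupoid (V : Type*) [Quiver V] where
  src : V
  rng : V
  path : Quiver.Path src rng

namespace FreeSemigroupoid

variable {V : Type*} [Quiver V]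

/-- The paths with range `x`. -/
abbrev PathsTo (x : V) := Σ s : V, Quiver.Path s x

/-- A path with range `x` as an element of the path space. -/
def ofPathsTo (x : V) (w : PathsTo x) : FreeSemigroupoid V := ⟨w.1, x, w.2⟩

/-- `w ↦ e w`, defined for the paths `w` with `r(w) = s(e)`. -/
def edgeMul {x y : V} (e : x ⟶ y) (w : PathsTo x) : FreeSemigroupoid V := ⟨w.1, y, w.2.cons e⟩

theorem ofPathsTo_injective (x : V) : Function.Injective (ofPathsTo x) := by
  rintro ⟨s, p⟩ ⟨t, q⟩ h
  simp only [ofPathsTo, FreeSemigroupoid.mk.injEq] at h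
  obtain ⟨rfl, -, h⟩ := h
  simpa using h

theorem edgeMul_injective {x y : V} (e : x ⟶ y) : Function.Injective (edgeMul e) := by
  rintro ⟨s, p⟩ ⟨t, q⟩ h
  simp only [edgeMul, FreeSemigroupoid.mk.injEq] at h
  obtain ⟨rfl, -, h⟩ := h
  simpa using h

end FreeSemigroupoid

/-! ### The operators `L_x` and `L_e` on `ℓ²` of the path space -/

/-- The complex Hilbert space `ℓ²(P)`. -/
abbrev EllTwo (P : Type*) := lp (fun _ : P => ℂ) 2

open Classical in
/-- The standard orthonormal basis `ξ_p` of `ℓ²(P)`. -/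
def EllTwo.ξ {P : Type*} (p : P) : EllTwo P := lp.single 2 p (1 : ℂ)

theorem EllTwo.orthonormal_ξ (P : Type*) : Orthonormal ℂ (EllTwo.ξ : P → EllTwo P) := by
  classical
  rw [orthonormal_iff_ite]
  intro i j
  rw [EllTwo.ξ, EllTwo.ξ, lp.inner_single_left, lp.single_apply]
  by_cases h : i = j
  · subst h; simp
  · simp [h]

/-- For an injective map `f : ι → P`, the isometry `ℓ²(ι) → ℓ²(P)` with `ξ_i ↦ ξ_{f i}`. -/
def EllTwo.mapIsometry {ι P : Type*} (f : ι → P) (hf : Function.Injective f) :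
    EllTwo ι →ₗᵢ[ℂ] EllTwo P :=
  ((EllTwo.orthonormal_ξ P).comp f hf).orthogonalFamily.linearIsometry

theorem EllTwo.mapIsometry_ξ {ι P : Type*} (f : ι → P) (hf : Function.Injective f) (i : ι) :
    EllTwo.mapIsometry f hf (EllTwo.ξ i) = EllTwo.ξ (f i) := by
  classical
  rw [EllTwo.mapIsometry, EllTwo.ξ]
  erw [OrthogonalFamily.linearIsometry_apply_single]
  simp

/-- For injective maps `f, g : ι → P`, the partial isometry of `ℓ²(P)` with
`ξ_{g i} ↦ ξ_{f i}` for all `i` and `ξ_p ↦ 0` for `p` outside the range of `g`. -/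
def EllTwo.partialIsometry {ι P : Type*} (f g : ι → P) (hf : Function.Injective f)
    (hg : Function.Injective g) : EllTwo P →L[ℂ] EllTwo P :=
  (EllTwo.mapIsometry f hf).toContinuousLinearMap ∘L
    ContinuousLinearMap.adjoint (EllTwo.mapIsometry g hg).toContinuousLinearMap

theorem EllTwo.partialIsometry_ξ {ι P : Type*} (f g : ι → P) (hf : Function.Injective f)
    (hg : Function.Injective g) (i : ι) :
    EllTwo.partialIsometry f g hf hg (EllTwo.ξ (g i)) = EllTwo.ξ (f i) := by
  have h : ContinuousLinearMap.adjoint (EllTwo.mapIsometry g hg).toContinuousLinearMap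
      (EllTwo.ξ (g i)) = EllTwo.ξ i := by
    refine ext_inner_left ℂ fun y => ?_
    rw [ContinuousLinearMap.adjoint_inner_right, ← EllTwo.mapIsometry_ξ g hg]
    simp
  simp [EllTwo.partialIsometry, h, EllTwo.mapIsometry_ξ]

theorem EllTwo.partialIsometry_ξ_of_notMem {ι P : Type*} (f g : ι → P)
    (hf : Function.Injective f) (hg : Function.Injective g) (p : P) (hp : p ∉ Set.range g) :
    EllTwo.partialIsometry f g hf hg (EllTwo.ξ p) = 0 := by
  classical
  have h : ContinuousLinearMap.adjoint (EllTwo.mapIsometry g hg).toContinuousLinearMap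
      (EllTwo.ξ p) = 0 := by
    ext i
    have h1 : inner ℂ (EllTwo.ξ i) (ContinuousLinearMap.adjoint
        (EllTwo.mapIsometry g hg).toContinuousLinearMap (EllTwo.ξ p)) = 0 := by
      rw [ContinuousLinearMap.adjoint_inner_right]
      simp only [LinearIsometry.coe_toContinuousLinearMap]
      rw [EllTwo.mapIsometry_ξ]
      exact (EllTwo.orthonormal_ξ P).2 fun h => hp ⟨i, h⟩
    rw [EllTwo.ξ, lp.inner_single_left] at h1
    simpa using h1
  simp [EllTwo.partialIsometry, h]

section WeakOperatorClosure

variable {H : Type*} [NormedAddCommGroup H] [NormedSpace ℂ H]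

/-- A subalgebra of `B(H)`, inside the copy of `B(H)` carrying the weak operator topology. -/
def toWOTSubalgebra (S : NonUnitalSubalgebra ℂ (H →L[ℂ] H)) :
    NonUnitalSubalgebra ℂ (H →WOT[ℂ] H) where
  carrier := ContinuousLinearMapWOT.ofCLM '' (S : Set (H →L[ℂ] H))
  zero_mem' := ⟨0, zero_mem S, rfl⟩
  add_mem' := by
    rintro _ _ ⟨a, ha, rfl⟩ ⟨b, hb, rfl⟩
    exact ⟨a + b, add_mem ha hb, rfl⟩
  mul_mem' := by
    rintro _ _ ⟨a, ha, rfl⟩ ⟨b, hb, rfl⟩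
    exact ⟨a * b, mul_mem ha hb, rfl⟩
  smul_mem' := by
    rintro c _ ⟨a, ha, rfl⟩
    exact ⟨c • a, SMulMemClass.smul_mem c ha, rfl⟩

/-- The closure of a subalgebra of `B(H)` in the weak operator topology. -/
def wotClosure (S : NonUnitalSubalgebra ℂ (H →L[ℂ] H)) : NonUnitalSubalgebra ℂ (H →L[ℂ] H) where
  carrier := {A | ContinuousLinearMapWOT.ofCLM A ∈
    closure (ContinuousLinearMapWOT.ofCLM '' (S : Set (H →L[ℂ] H)) : Set (H →WOT[ℂ] H))}
  zero_mem' := zero_mem (toWOTSubalgebra S).topologicalClosure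
  add_mem' := fun {_ _} ha hb => add_mem (S := NonUnitalSubalgebra ℂ (H →WOT[ℂ] H))
    (s := (toWOTSubalgebra S).topologicalClosure) ha hb
  mul_mem' := fun {_ _} ha hb => mul_mem (S := NonUnitalSubalgebra ℂ (H →WOT[ℂ] H))
    (s := (toWOTSubalgebra S).topologicalClosure) ha hb
  smul_mem' := fun c _ ha => SMulMemClass.smul_mem (S := NonUnitalSubalgebra ℂ (H →WOT[ℂ] H))
    (s := (toWOTSubalgebra S).topologicalClosure) c ha

theorem topologicalClosure_le_wotClosure (S : NonUnitalSubalgebra ℂ (H →L[ℂ] H)) :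
    S.topologicalClosure ≤ wotClosure S := by
  refine NonUnitalSubalgebra.topologicalClosure_minimal (s := S) (t := wotClosure S) ?_ ?_
  · exact fun a ha => subset_closure ⟨a, ha, rfl⟩
  · exact isClosed_closure.preimage ContinuousLinearMapWOT.continuous_ofCLM

end WeakOperatorClosure

section Algebras

variable (V : Type*) [Quiver V]

/-- The Hilbert space `H_G = ℓ²(path space of G)`. -/
abbrev PathHilbert := EllTwo (FreeSemigroupoid V)

variable {V}

/-- `L_x ξ_w = ξ_w` if `r(w) = x`, and `L_x ξ_w = 0` otherwise. -/
def vertexOp (x : V) : PathHilbert V →L[ℂ] PathHilbert V :=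
  EllTwo.partialIsometry (FreeSemigroupoid.ofPathsTo x) (FreeSemigroupoid.ofPathsTo x)
    (FreeSemigroupoid.ofPathsTo_injective x) (FreeSemigroupoid.ofPathsTo_injective x)

/-- `L_e ξ_w = ξ_{ew}` if `r(w) = s(e)`, and `L_e ξ_w = 0` otherwise. -/
def edgeOp {x y : V} (e : x ⟶ y) : PathHilbert V →L[ℂ] PathHilbert V :=
  EllTwo.partialIsometry (FreeSemigroupoid.edgeMul e) (FreeSemigroupoid.ofPathsTo x)
    (FreeSemigroupoid.edgeMul_injective e) (FreeSemigroupoid.ofPathsTo_injective x)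

variable (V)

/-- The set `{L_e, L_x : e an edge, x a vertex}`. -/
def semigroupoidGenerators : Set (PathHilbert V →L[ℂ] PathHilbert V) :=
  {A | (∃ x : V, A = vertexOp x) ∨ ∃ (x y : V) (e : x ⟶ y), A = edgeOp e}

/-- The (algebraic) algebra generated by `{L_e, L_x}`. -/
def pathOpAlgebra : NonUnitalSubalgebra ℂ (PathHilbert V →L[ℂ] PathHilbert V) :=
  NonUnitalAlgebra.adjoin ℂ (semigroupoidGenerators V)

/-- The tensor algebra `A_G`: the norm closure of the algebra generated by `{L_e, L_x}`. -/
def tensorAlg : NonUnitalSubalgebra ℂ (PathHilbert V →L[ℂ] PathHilbert V) :=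
  (pathOpAlgebra V).topologicalClosure

/-- The free semigroupoid algebra `𝔏_G`: the closure in the weak operator topology of the
algebra generated by `{L_e, L_x}`. -/
def freeSemigroupoidAlg : NonUnitalSubalgebra ℂ (PathHilbert V →L[ℂ] PathHilbert V) :=
  wotClosure (pathOpAlgebra V)

end Algebras

/-! ### The first cohomology group

`A ⊆ X` are subalgebras of a normed algebra `B`, whose multiplication and norm make `X` a normed
`A`-bimodule. A bounded linear map from `A` into `X` is a bounded linear map from `A` into `B`
with values in `X`. -/

section Cohomology

variable {B : Type*} [NormedRing B] [NormedAlgebra ℂ B] (A X : NonUnitalSubalgebra ℂ B)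

/-- `Der(A, X)`: the bounded derivations from `A` into `X`, i.e. the bounded linear maps
`δ : A → X` with `δ(ab) = δ(a) b + a δ(b)`. -/
def boundedDerivations : Submodule ℂ (A →ₗ[ℂ] B) where
  carrier := {δ | (∀ a : A, δ a ∈ X) ∧ (∃ C : ℝ, ∀ a : A, ‖δ a‖ ≤ C * ‖(a : B)‖) ∧
    ∀ a b : A, δ (a * b) = δ a * (b : B) + (a : B) * δ b}
  zero_mem' := ⟨fun _ => zero_mem X, ⟨0, fun a => by simp⟩, fun a b => by simp⟩
  add_mem' := by
    rintro δ ε ⟨hδ, ⟨C, hC⟩, hδ'⟩ ⟨hε, ⟨D, hD⟩, hε'⟩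
    refine ⟨fun a => add_mem (hδ a) (hε a), ⟨C + D, fun a => ?_⟩, fun a b => ?_⟩
    · rw [add_mul]
      exact (norm_add_le _ _).trans (add_le_add (hC a) (hD a))
    · simp only [LinearMap.add_apply, hδ', hε', add_mul, mul_add]
      abel
  smul_mem' := by
    rintro c δ ⟨hδ, ⟨C, hC⟩, hδ'⟩
    refine ⟨fun a => SMulMemClass.smul_mem c (hδ a), ⟨‖c‖ * C, fun a => ?_⟩, fun a b => ?_⟩
    · rw [LinearMap.smul_apply, norm_smul, mul_assoc]
      exact mul_le_mul_of_nonneg_left (hC a) (norm_nonneg c)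
    · simp only [LinearMap.smul_apply, hδ', smul_add, smul_mul_assoc, mul_smul_comm]

/-- `Inn(A, X)`: the derivations of the form `δ_T : a ↦ a T - T a` with `T ∈ X`. -/
def innerDerivations : Submodule ℂ (boundedDerivations A X) where
  carrier := {δ | ∃ T ∈ X, ∀ a : A, δ.1 a = (a : B) * T - T * (a : B)}
  zero_mem' := ⟨0, zero_mem X, fun a => by simp⟩
  add_mem' := by
    rintro δ ε ⟨S, hS, hδ⟩ ⟨T, hT, hε⟩
    refine ⟨S + T, add_mem hS hT, fun a => ?_⟩
    simp only [Submodule.coe_add, LinearMap.add_apply, hδ, hε]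
    noncomm_ring
  smul_mem' := by
    rintro c δ ⟨T, hT, hδ⟩
    refine ⟨c • T, SMulMemClass.smul_mem c hT, fun a => ?_⟩
    simp [hδ, smul_sub]

/-- `H¹(A, X) = Der(A, X) / Inn(A, X)`. -/
def FirstCohomology := boundedDerivations A X ⧸ innerDerivations A X

instance : AddCommGroup (FirstCohomology A X) :=
  inferInstanceAs (AddCommGroup (boundedDerivations A X ⧸ innerDerivations A X))

instance : Module ℂ (FirstCohomology A X) :=
  inferInstanceAs (Module ℂ (boundedDerivations A X ⧸ innerDerivations A X))

/-- The class of a bounded derivation in `H¹(A, X)`. -/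
def FirstCohomology.mk : boundedDerivations A X →ₗ[ℂ] FirstCohomology A X :=
  (innerDerivations A X).mkQ

end Cohomology

section Inclusion

variable (V : Type*) [Quiver V]

theorem pathOpAlgebra_le_tensorAlg : pathOpAlgebra V ≤ tensorAlg V :=
  NonUnitalSubalgebra.le_topologicalClosure _

theorem tensorAlg_le_freeSemigroupoidAlg : tensorAlg V ≤ freeSemigroupoidAlg V :=
  topologicalClosure_le_wotClosure _

variable {V}

/-- `L_x` as an element of `A_G`. -/
def vertexElt (x : V) : tensorAlg V :=
  ⟨vertexOp x, pathOpAlgebra_le_tensorAlg V (NonUnitalAlgebra.subset_adjoin ℂ (Or.inl ⟨x, rfl⟩))⟩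

/-- `L_e` as an element of `A_G`. -/
def edgeElt {x y : V} (e : x ⟶ y) : tensorAlg V :=
  ⟨edgeOp e, pathOpAlgebra_le_tensorAlg V
    (NonUnitalAlgebra.subset_adjoin ℂ (Or.inr ⟨x, y, e, rfl⟩))⟩

end Inclusion

/-! ### Bounded holomorphic functions -/

/-- `H^∞(U)`: the bounded holomorphic functions on a set `U` (open in all uses). -/
def HInfinity {E : Type*} [NormedAddCommGroup E] [NormedSpace ℂ E] (U : Set E) :
    Submodule ℂ (U → ℂ) where
  carrier := {f | (∃ F : E → ℂ, DifferentiableOn ℂ F U ∧ ∀ z : U, F z = f z) ∧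
    ∃ C : ℝ, ∀ z : U, ‖f z‖ ≤ C}
  zero_mem' := ⟨⟨0, differentiableOn_const 0, fun _ => rfl⟩, 0, by simp⟩
  add_mem' := by
    rintro f g ⟨⟨F, hF, hf⟩, C, hC⟩ ⟨⟨G, hG, hg⟩, D, hD⟩
    exact ⟨⟨F + G, hF.add hG, fun z => by simp [hf, hg]⟩, C + D,
      fun z => (norm_add_le _ _).trans (add_le_add (hC z) (hD z))⟩
  smul_mem' := by
    rintro c f ⟨⟨F, hF, hf⟩, C, hC⟩
    exact ⟨⟨c • F, hF.const_smul c, fun z => by simp [hf]⟩, ‖c‖ * C, fun z => by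
      simpa using mul_le_mul_of_nonneg_left (hC z) (norm_nonneg c)⟩

/-- The open unit disc `𝔻`. -/
abbrev unitDisc : Set ℂ := Metric.ball 0 1

/-- The open bidisc `𝔻²`. -/
abbrev bidisc : Set (ℂ × ℂ) := unitDisc ×ˢ unitDisc

/-- `f ↦ f ⊗ 1`, where `(f ⊗ 1)(z, w) = f(z)`. -/
def HInfinity.tensorOne : HInfinity unitDisc →ₗ[ℂ] HInfinity bidisc where
  toFun f := ⟨fun p => f.1 ⟨p.1.1, p.2.1⟩, by
    obtain ⟨f, ⟨F, hF, hf⟩, C, hC⟩ := f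
    exact ⟨⟨fun p => F p.1, hF.comp differentiableOn_fst fun p hp => hp.1, fun p => hf ⟨p.1.1, p.2.1⟩⟩,
      C, fun p => hC _⟩⟩
  map_add' _ _ := rfl
  map_smul' _ _ := rfl

/-- `g ↦ 1 ⊗ g`, where `(1 ⊗ g)(z, w) = g(w)`. -/
def HInfinity.oneTensor : HInfinity unitDisc →ₗ[ℂ] HInfinity bidisc where
  toFun g := ⟨fun p => g.1 ⟨p.1.2, p.2.2⟩, by
    obtain ⟨g, ⟨G, hG, hg⟩, C, hC⟩ := g
    exact ⟨⟨fun p => G p.2, hG.comp differentiableOn_snd fun p hp => hp.2, fun p => hg ⟨p.1.2, p.2.2⟩⟩,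
      C, fun p => hC _⟩⟩
  map_add' _ _ := rfl
  map_smul' _ _ := rfl

/-- `H^∞(𝔻) ⊗ 1 + 1 ⊗ H^∞(𝔻)`, as a subspace of `H^∞(𝔻²)`. -/
def splitFunctions : Submodule ℂ (HInfinity bidisc) :=
  LinearMap.range HInfinity.tensorOne ⊔ LinearMap.range HInfinity.oneTensor

/-! ### The graph -/

namespace TwoLoopGraph

/-- The two vertices. -/
inductive Vertex : Type
  | v₁
  | v₂

/-- The three edges: a loop at each vertex, and an edge from `v₂` to `v₁`. -/
inductive Edge : Vertex → Vertex → Type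
  | e₁ : Edge .v₁ .v₁
  | e₂ : Edge .v₂ .v₂
  | e : Edge .v₂ .v₁

instance : Quiver Vertex := ⟨Edge⟩

/-- The loop at `v₁`. -/
def e₁ : Vertex.v₁ ⟶ Vertex.v₁ := Edge.e₁

/-- The loop at `v₂`. -/
def e₂ : Vertex.v₂ ⟶ Vertex.v₂ := Edge.e₂

/-- The edge with source `v₂` and range `v₁`. -/
def e : Vertex.v₂ ⟶ Vertex.v₁ := Edge.e

/-- The path `v₂` of length zero. -/
def pathV₂ : FreeSemigroupoid Vertex := ⟨.v₂, .v₂, .nil⟩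

/-- The power `l ^ n` of a loop `l`. -/
def loopPow {x : Vertex} (l : x ⟶ x) : ℕ → Quiver.Path x x
  | 0 => .nil
  | n + 1 => (loopPow l n).cons l

/-- The path `e₁ ^ m e e₂ ^ n`. -/
def pathMN (m n : ℕ) : FreeSemigroupoid Vertex :=
  ⟨.v₂, .v₁, ((loopPow e₂ n).cons e).comp (loopPow e₁ m)⟩

/-- `H¹(A_G, 𝔏_G)` of the graph. -/
abbrev H1 := FirstCohomology (tensorAlg Vertex) (freeSemigroupoidAlg Vertex)

/-- The bounded derivations from `A_G` into `𝔏_G`. -/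
abbrev Der := boundedDerivations (tensorAlg Vertex) (freeSemigroupoidAlg Vertex)

end TwoLoopGraph

end

/-! Write p and q for the operators of v₁ and v₂. Every path is e₁^m, e₂^n or e₁^m e e₂^n, and every
T in 𝔏_G satisfies q T p = 0, with diagonal corners p T p and q T q commuting with L_{e₁} and L_{e₂}
respectively. The isomorphism is induced by sending δ to its symbol, the power series g(z,w) whose
coefficients are the coordinates of δ(L_e) ξ_{v₂} along the paths e₁^m e e₂^n. Three things are
needed.

Boundedness of the symbol. Subtracting an inner derivation, without changing δ(L_e), makes δ vanish
at p and q (`exists_derivation_eq_zero_of_triangular`). It then vanishes at the loops as well: if D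
= δ(L_{e₁}), then D commutes with L_{e₁}, so δ(L_{e₁}^(n+1)) = (n+1) L_{e₁}^n D, and since L_{e₁} is
isometric on its initial space this is incompatible with boundedness unless D = 0
(`derivation_eq_zero_of_commute`). For such a δ one has δ(L_{e₁}^m L_e) = L_{e₁}^m δ(L_e). Testing δ
on sums Σ conj(w)^m L_{e₁}^m L_e, applied to Σ conj(z)^n ξ_{e₂^n} and paired with the Szegő kernel
of the bidisc, gives |g(z,w)| ≤ C for any nonnegative bound C of δ (`norm_tsum_le_of_mul_rightE₂`).

Surjectivity. A function g in H^∞(𝔻²) defines a bounded multiplier M of ℓ²(ℕ × ℕ), a weak limit of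
absolutely convergent series in the shifts (`exists_multiplier`). Let J be M acting on the span of
the paths through e. Then J need not lie in 𝔏_G, but it commutes with the vertices and loops, and
its commutator with L_e lies in 𝔏_G; hence the commutator with -J is a derivation into 𝔏_G, and its
symbol is g (`exists_derivation_of_isWeakSeries`).

Kernel modulo split functions. A function is split exactly when its mixed coefficients (m, n both
nonzero) vanish. For T in 𝔏_G, L_e T ξ_{v₂} lives on the paths e e₂^n, and T L_e ξ_{v₂} = T ξ_e on
the paths e₁^m e, because T commutes with right multiplication by e (`apply_crossPath_eq_zero`).
Conversely, if the mixed coefficients vanish, the slices g(z,0) and g(0,w) - g(0,0) are bounded,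
their multipliers give a T in 𝔏_G with the right commutator coefficients, and a derivation with zero
symbol is inner. Nontriviality is witnessed by zw. -/

section PowerSeries

open Metric Filter Topology

/-! ### Bounded holomorphic functions and power series in one and two variables. -/

theorem HasSum.congr_term {α β : Type*} [AddCommMonoid α] [TopologicalSpace α] {f g : β → α} {a : α}
    (h : HasSum f a) (e : ∀ b, g b = f b) : HasSum g a :=
  (funext e : g = f) ▸ h

/-- Cauchy's estimate on the circle of radius r < 1 gives ‖a n‖ r^n ≤ C; letting r tend to 1 removes
the radius. -/
theorem exists_hasSum_pow_of_bounded {f : ℂ → ℂ} {C : ℝ}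
    (hf : DifferentiableOn ℂ f (ball 0 1)) (hC : ∀ z ∈ ball (0 : ℂ) 1, ‖f z‖ ≤ C) :
    ∃ a : ℕ → ℂ, (∀ n, ‖a n‖ ≤ C) ∧
      ∀ z ∈ ball (0 : ℂ) 1, HasSum (fun n => a n * z ^ n) (f z) := by
  refine ⟨fun n => (n.factorial : ℂ)⁻¹ * iteratedDeriv n f 0, fun n => ?_, fun z hz => ?_⟩
  · have key : ∀ r ∈ Set.Ioo (0 : ℝ) 1,
        ‖(n.factorial : ℂ)⁻¹ * iteratedDeriv n f 0‖ * r ^ n ≤ C := by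
      rintro r ⟨hr0, hr1⟩
      have h := Complex.norm_iteratedDeriv_le_of_forall_mem_sphere_norm_le (f := f) (c := 0)
        (C := C) n hr0 ((hf.mono (closure_ball_subset_closedBall.trans
          (closedBall_subset_ball hr1))).diffContOnCl)
        (fun z hz => hC z (sphere_subset_closedBall.trans (closedBall_subset_ball hr1) hz))
      rw [norm_mul, norm_inv, Complex.norm_natCast]
      have h1 : (0 : ℝ) < n.factorial := by positivity
      rw [le_div_iff₀ (by positivity)] at h
      rw [mul_assoc, inv_mul_le_iff₀ h1]
      exact h
    have ht : Tendsto (fun r : ℝ => ‖(n.factorial : ℂ)⁻¹ * iteratedDeriv n f 0‖ * r ^ n)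
        (𝓝[<] 1) (𝓝 (‖(n.factorial : ℂ)⁻¹ * iteratedDeriv n f 0‖ * 1 ^ n)) :=
      ((continuous_const.mul (continuous_pow n)).tendsto 1).mono_left nhdsWithin_le_nhds
    rw [one_pow, mul_one] at ht
    refine le_of_tendsto ht ?_
    filter_upwards [Ioo_mem_nhdsLT (show (0 : ℝ) < 1 by norm_num)] with r hr using key r hr
  · have h := Complex.hasSum_taylorSeries_on_ball hf hz
    simp only [sub_zero, smul_eq_mul] at h
    refine h.congr_term fun n => ?_
    ring

theorem eq_zero_of_hasSum_pow {a : ℕ → ℂ}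
    (h : ∀ z ∈ ball (0 : ℂ) 1, HasSum (fun n => a n * z ^ n) 0) : a = 0 := by
  set p : FormalMultilinearSeries ℂ ℂ ℂ :=
    fun n => ContinuousMultilinearMap.mkPiRing ℂ (Fin n) (a n) with hp
  have hpc : ∀ n, p.coeff n = a n := fun n => by simp [hp, FormalMultilinearSeries.coeff]
  have h1 : HasFPowerSeriesAt (0 : ℂ → ℂ) p 0 := by
    rw [hasFPowerSeriesAt_iff]
    filter_upwards [ball_mem_nhds (0 : ℂ) one_pos] with z hz
    refine (h z hz).congr_term fun n => ?_
    rw [hpc, smul_eq_mul, mul_comm]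
  have h2 := h1.eq_zero
  funext n
  rw [← hpc, h2]
  rfl

/-- By strong induction: once the lower coefficients are holomorphic in w, `a n` is the uniform
limit, as t → 0, of the holomorphic functions (g(t,w) - Σ_{k<n} a_k(w) t^k) / t^n. -/
theorem differentiableOn_coeff_of_hasSum_pow {g : ℂ × ℂ → ℂ} {C : ℝ} {a : ℕ → ℂ → ℂ}
    (hg : DifferentiableOn ℂ g bidisc)
    (ha : ∀ n, ∀ w ∈ ball (0 : ℂ) 1, ‖a n w‖ ≤ C)
    (hs : ∀ w ∈ ball (0 : ℂ) 1, ∀ z ∈ ball (0 : ℂ) 1,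
      HasSum (fun n => a n w * z ^ n) (g (z, w))) (n : ℕ) :
    DifferentiableOn ℂ (a n) (ball 0 1) := by
  induction n using Nat.strong_induction_on with
  | _ n ih =>
  -- Points of (0,1) tending to 0, chosen so that the tail bound C t/(1-t) becomes C/(j+1).
  set t : ℕ → ℝ := fun j => 1 / ((j : ℝ) + 2) with ht
  have ht0 : ∀ j, 0 < t j := fun j => by positivity
  have ht1 : ∀ j, t j < 1 := fun j => by
    rw [ht]; simp only; rw [div_lt_one (by positivity)]
    have : (0 : ℝ) ≤ j := by positivity
    linarith
  have htb : ∀ j, ((t j : ℝ) : ℂ) ∈ ball (0 : ℂ) 1 := fun j => by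
    simp [abs_of_pos (ht0 j), ht1 j]
  set F : ℕ → ℂ → ℂ := fun j w =>
    (g ((t j : ℂ), w) - ∑ k ∈ Finset.range n, a k w * (t j : ℂ) ^ k) / (t j : ℂ) ^ n with hF
  have hest : ∀ j, ∀ w ∈ ball (0 : ℂ) 1, ‖a n w - F j w‖ ≤ C / ((j : ℝ) + 1) := by
    intro j w hw
    have hne : (t j : ℂ) ≠ 0 := by exact_mod_cast (ht0 j).ne'
    have h1 := (hasSum_nat_add_iff' n).2 (hs w hw _ (htb j))
    have h2 := h1.div_const ((t j : ℂ) ^ n)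
    -- The first n terms are already removed and t^n divided out; removing one more term isolates `a
    -- n w` and leaves a tail of order t.
    have h3 := (hasSum_nat_add_iff' 1).2 h2
    have h4 : HasSum (fun k => C * t j * t j ^ k) (C * t j * (1 - t j)⁻¹) :=
      (hasSum_geometric_of_lt_one (ht0 j).le (ht1 j)).mul_left _
    have h5 := h3.norm_le_of_bounded h4 (fun k => by
      have : a (k + 1 + n) w * (t j : ℂ) ^ (k + 1 + n) / (t j : ℂ) ^ n
          = a (k + 1 + n) w * (t j : ℂ) ^ (k + 1) := by
        rw [pow_add _ (k + 1) n]; field_simp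
      rw [this, norm_mul, norm_pow, Complex.norm_real, Real.norm_of_nonneg (ht0 j).le, pow_succ]
      have := mul_le_mul_of_nonneg_right (ha (k + 1 + n) w hw)
        (mul_nonneg (pow_nonneg (ht0 j).le k) (ht0 j).le)
      linarith)
    rw [norm_sub_rev]
    have e1 : C * t j * (1 - t j)⁻¹ = C / ((j : ℝ) + 1) := by
      have : ((j : ℝ) + 1) ≠ 0 := by positivity
      have h2 : ((j : ℝ) + 2) ≠ 0 := by positivity
      have : 1 - t j = (j + 1) / (j + 2) := by rw [ht]; field_simp; ring
      rw [this, ht]; field_simp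
    rw [e1] at h5
    simp only [Finset.range_one, Finset.sum_singleton, zero_add] at h5
    rw [mul_div_assoc, div_self (pow_ne_zero _ hne), mul_one] at h5
    exact h5
  have hlim : Tendsto (fun j : ℕ => C / ((j : ℝ) + 1)) atTop (𝓝 0) := by
    have := (tendsto_one_div_add_atTop_nhds_zero_nat (𝕜 := ℝ)).const_mul C
    simpa [div_eq_mul_inv] using this
  have hu : TendstoUniformlyOn F (a n) atTop (ball 0 1) := by
    rw [Metric.tendstoUniformlyOn_iff]
    intro ε hε
    filter_upwards [hlim.eventually (gt_mem_nhds hε)] with j hj w hw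
    rw [dist_eq_norm]
    exact (hest j w hw).trans_lt hj
  refine hu.tendstoLocallyUniformlyOn.differentiableOn (Eventually.of_forall fun j => ?_) isOpen_ball
  refine DifferentiableOn.div_const (DifferentiableOn.sub ?_ ?_) _
  · exact hg.comp ((differentiableOn_const _).prodMk differentiableOn_id) fun w hw => ⟨htb j, hw⟩
  · exact DifferentiableOn.fun_sum fun k hk =>
      (ih k (Finset.mem_range.1 hk)).mul (differentiableOn_const _)

theorem summable_bound_pow {C : ℝ} {z w : ℂ} (hz : z ∈ ball (0 : ℂ) 1) (hw : w ∈ ball (0 : ℂ) 1) :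
    Summable fun k : ℕ × ℕ => C * ‖z‖ ^ k.2 * ‖w‖ ^ k.1 := by
  rw [mem_ball_zero_iff] at hz hw
  have h := (summable_geometric_of_lt_one (norm_nonneg w) hw).mul_of_nonneg
    (summable_geometric_of_lt_one (norm_nonneg z) hz)
    (fun n => pow_nonneg (norm_nonneg w) n) (fun n => pow_nonneg (norm_nonneg z) n)
  refine (h.mul_left C).congr fun k => by ring

theorem summable_coeff_mul_pow {C : ℝ} {c : ℕ × ℕ → ℂ} (hc : ∀ k, ‖c k‖ ≤ C) {z w : ℂ}
    (hz : z ∈ ball (0 : ℂ) 1) (hw : w ∈ ball (0 : ℂ) 1) :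
    Summable fun k : ℕ × ℕ => c k * z ^ k.2 * w ^ k.1 := by
  refine Summable.of_norm_bounded (summable_bound_pow (C := C) hz hw) fun k => ?_
  rw [norm_mul, norm_mul, norm_pow, norm_pow]
  gcongr
  exact hc k

/-- Expand in z for each fixed w, then expand each coefficient in w. The uniform bound on the double
coefficients makes the series absolutely convergent, so the iterated sum equals the double sum. -/
theorem exists_hasSum_pow_pow_of_bounded {g : ℂ × ℂ → ℂ} {C : ℝ}
    (hg : DifferentiableOn ℂ g bidisc)
    (hC : ∀ p ∈ bidisc, ‖g p‖ ≤ C) :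
    ∃ c : ℕ × ℕ → ℂ, (∀ k, ‖c k‖ ≤ C) ∧
      ∀ z ∈ ball (0 : ℂ) 1, ∀ w ∈ ball (0 : ℂ) 1,
        HasSum (fun k : ℕ × ℕ => c k * z ^ k.2 * w ^ k.1) (g (z, w)) := by
  have h1 : ∀ w : ℂ, ∃ a : ℕ → ℂ, w ∈ ball (0 : ℂ) 1 → (∀ n, ‖a n‖ ≤ C) ∧
      ∀ z ∈ ball (0 : ℂ) 1, HasSum (fun n => a n * z ^ n) (g (z, w)) := by
    intro w
    by_cases hw : w ∈ ball (0 : ℂ) 1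
    · obtain ⟨a, ha⟩ := exists_hasSum_pow_of_bounded (f := fun z => g (z, w)) (C := C)
        (hg.comp (differentiableOn_id.prodMk (differentiableOn_const _)) fun z hz => ⟨hz, hw⟩)
        (fun z hz => hC _ ⟨hz, hw⟩)
      exact ⟨a, fun _ => ha⟩
    · exact ⟨0, fun h => absurd h hw⟩
  choose a ha using h1
  have h2 : ∀ n, ∃ b : ℕ → ℂ, (∀ m, ‖b m‖ ≤ C) ∧
      ∀ w ∈ ball (0 : ℂ) 1, HasSum (fun m => b m * w ^ m) (a w n) := fun n =>
    exists_hasSum_pow_of_bounded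
      (differentiableOn_coeff_of_hasSum_pow (a := fun n w => a w n) hg
        (fun n w hw => (ha w hw).1 n) (fun w hw => (ha w hw).2) n)
      (fun w hw => (ha w hw).1 n)
  choose b hb hb' using h2
  refine ⟨fun k => b k.2 k.1, fun k => hb _ _, fun z hz w hw => ?_⟩
  have hs := summable_coeff_mul_pow (c := fun k => b k.2 k.1) (fun k => hb _ _) hz hw
  have h3 : HasSum (fun k : ℕ × ℕ => b k.1 k.2 * z ^ k.1 * w ^ k.2)
      (∑' k : ℕ × ℕ, b k.2 k.1 * z ^ k.2 * w ^ k.1) :=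
    (Equiv.prodComm ℕ ℕ).hasSum_iff.2 hs.hasSum
  have h4 := h3.prod_fiberwise fun n => by
    have := (hb' n w hw).mul_right (z ^ n)
    refine this.congr_term fun m => ?_
    ring
  rw [((ha w hw).2 z hz).unique h4]
  exact hs.hasSum

/-- One-variable uniqueness is used twice, first in w and then in z. The point w = 1/2 serves only
as a nonzero point at which summability of the double family yields summability of each row. -/
theorem eq_zero_of_hasSum_pow_pow {c : ℕ × ℕ → ℂ}
    (h : ∀ z ∈ ball (0 : ℂ) 1, ∀ w ∈ ball (0 : ℂ) 1,
      HasSum (fun k : ℕ × ℕ => c k * z ^ k.2 * w ^ k.1) 0) : c = 0 := by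
  have hhalf : (1 / 2 : ℂ) ∈ ball (0 : ℂ) 1 := by
    rw [mem_ball_zero_iff]; norm_num
  have h1 : ∀ z ∈ ball (0 : ℂ) 1, ∀ m, HasSum (fun n => c (m, n) * z ^ n) 0 := by
    intro z hz
    have hs : ∀ m, Summable (fun n => c (m, n) * z ^ n) := by
      intro m
      have := (h z hz _ hhalf).summable.prod_factor m
      refine (summable_mul_right_iff (a := (1 / 2 : ℂ) ^ m) (by simp)).1 this
    have := eq_zero_of_hasSum_pow (a := fun m => ∑' n, c (m, n) * z ^ n) fun w hw =>
      (h z hz w hw).prod_fiberwise fun m => (hs m).hasSum.mul_right (w ^ m)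
    intro m
    have h2 := (hs m).hasSum
    rwa [show ∑' n, c (m, n) * z ^ n = 0 from congrFun this m] at h2
  funext ⟨m, n⟩
  exact congrFun (eq_zero_of_hasSum_pow (a := fun n => c (m, n)) fun z hz => h1 z hz m) n

/-- The series is φ applied to the product of resolvents (1 - w u)⁻¹ (1 - z v)⁻¹, and inversion is
holomorphic on units. This yields joint holomorphy on the bidisc without a two-variable convergence
theorem. -/
theorem differentiableOn_geometric_geometric {R : Type*} [NormedRing R] [NormedAlgebra ℂ R]
    [CompleteSpace R] [NormOneClass R] {u v : R} (hu : ‖u‖ ≤ 1) (hv : ‖v‖ ≤ 1) (φ : R →L[ℂ] ℂ) :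
    DifferentiableOn ℂ (fun p : ℂ × ℂ => ∑' k : ℕ × ℕ, φ (u ^ k.1 * v ^ k.2) * p.1 ^ k.2 * p.2 ^ k.1)
      bidisc := by
  have key : ∀ z ∈ ball (0 : ℂ) 1, ∀ u : R, ‖u‖ ≤ 1 → ‖z • u‖ < 1 := fun z hz u hu => by
    rw [mem_ball_zero_iff] at hz
    rw [norm_smul]
    nlinarith [norm_nonneg z, norm_nonneg u]
  have hsum : ∀ u : R, ‖u‖ < 1 → Summable fun n => ‖u ^ n‖ := fun u hu =>
    Summable.of_nonneg_of_le (fun _ => norm_nonneg _) (fun n => norm_pow_le u n)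
      (summable_geometric_of_lt_one (norm_nonneg u) hu)
  have hinv : ∀ u : R, ‖u‖ < 1 → HasSum (fun n => u ^ n) (Ring.inverse (1 - u)) := fun u hu => by
    rw [NormedRing.inverse_one_sub u hu]
    exact (summable_geometric_of_norm_lt_one hu).hasSum
  have hdiff : ∀ u : R, ‖u‖ ≤ 1 →
      DifferentiableOn ℂ (fun z : ℂ => Ring.inverse (1 - z • u)) (ball 0 1) := by
    intro u hu z hz
    have h1 : IsUnit (1 - z • u) := isUnit_one_sub_of_norm_lt_one (key z hz u hu)
    have h2 : DifferentiableAt ℂ (fun z : ℂ => 1 - z • u) z := by fun_prop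
    exact ((differentiableAt_inverse (𝕜 := ℂ) h1).comp z h2).differentiableWithinAt
  have h : DifferentiableOn ℂ (fun p : ℂ × ℂ =>
      φ (Ring.inverse (1 - p.2 • u) * Ring.inverse (1 - p.1 • v))) bidisc := by
    refine φ.differentiable.comp_differentiableOn (DifferentiableOn.mul ?_ ?_)
    · exact (hdiff u hu).comp differentiableOn_snd fun p hp => hp.2
    · exact (hdiff v hv).comp differentiableOn_fst fun p hp => hp.1
  refine h.congr fun p hp => ?_
  have h1 := key _ hp.1 v hv
  have h2 := key _ hp.2 u hu
  have h3 := (hinv _ h2).mul (hinv _ h1) (summable_mul_of_summable_norm (hsum _ h2) (hsum _ h1))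
  have h4 := φ.hasSum h3
  rw [← h4.tsum_eq]
  refine tsum_congr fun k => ?_
  simp only [smul_pow, smul_mul_smul_comm, map_smul, smul_eq_mul]
  ring

/-- Precomposition, as an operator on the bounded functions on a discrete space. -/
noncomputable def boundedPrecomp {X : Type*} [TopologicalSpace X] [DiscreteTopology X] (s : X → X) :
    BoundedContinuousFunction X ℂ →L[ℂ] BoundedContinuousFunction X ℂ :=
  LinearMap.mkContinuous
    { toFun := fun f => f.compContinuous ⟨s, continuous_of_discreteTopology⟩
      map_add' := fun _ _ => rfl
      map_smul' := fun _ _ => rfl } 1 fun f => by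
    rw [one_mul, BoundedContinuousFunction.norm_le (norm_nonneg _)]
    exact fun x => f.norm_coe_le_norm _

theorem boundedPrecomp_pow_apply {X : Type*} [TopologicalSpace X] [DiscreteTopology X] (s : X → X)
    (n : ℕ) (f : BoundedContinuousFunction X ℂ) (x : X) :
    (boundedPrecomp s ^ n) f x = f (s^[n] x) := by
  induction n generalizing f with
  | zero => rfl
  | succ n ih =>
    rw [pow_succ, mul_apply_eq_comp, ih, Function.iterate_succ_apply']
    rfl

/-- The coefficients are matrix elements of commuting contractions: shift the bounded sequence `c`
by (m, n) and evaluate at the origin. -/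
theorem differentiableOn_tsum_pow_pow {C : ℝ} {c : ℕ × ℕ → ℂ} (hc : ∀ k, ‖c k‖ ≤ C) :
    DifferentiableOn ℂ (fun p : ℂ × ℂ => ∑' k : ℕ × ℕ, c k * p.1 ^ k.2 * p.2 ^ k.1) bidisc := by
  -- Needed for the identity operator to have norm one.
  have : Nontrivial (BoundedContinuousFunction (ℕ × ℕ) ℂ) :=
    ⟨⟨0, 1, fun h => zero_ne_one (DFunLike.congr_fun h (0, 0))⟩⟩
  set f : BoundedContinuousFunction (ℕ × ℕ) ℂ :=
    BoundedContinuousFunction.ofNormedAddCommGroup c continuous_of_discreteTopology C hc with hf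
  set φ : (BoundedContinuousFunction (ℕ × ℕ) ℂ →L[ℂ] BoundedContinuousFunction (ℕ × ℕ) ℂ) →L[ℂ] ℂ :=
    (BoundedContinuousFunction.evalCLM ℂ (0, 0)).comp (ContinuousLinearMap.apply ℂ _ f) with hφ
  set u := boundedPrecomp (fun k : ℕ × ℕ => (k.1 + 1, k.2)) with hu
  set v := boundedPrecomp (fun k : ℕ × ℕ => (k.1, k.2 + 1)) with hv
  have h := differentiableOn_geometric_geometric (u := u) (v := v)
    (LinearMap.mkContinuous_norm_le _ zero_le_one _)
    (LinearMap.mkContinuous_norm_le _ zero_le_one _) φ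
  have e : ∀ k : ℕ × ℕ, φ (u ^ k.1 * v ^ k.2) = c k := by
    rintro ⟨m, n⟩
    have h1 : ∀ m (x : ℕ × ℕ), (fun k : ℕ × ℕ => (k.1 + 1, k.2))^[m] x = (x.1 + m, x.2) := by
      intro m
      induction m with
      | zero => intro x; rfl
      | succ m ih => intro x; rw [Function.iterate_succ_apply', ih]; rfl
    have h2 : ∀ m (x : ℕ × ℕ), (fun k : ℕ × ℕ => (k.1, k.2 + 1))^[m] x = (x.1, x.2 + m) := by
      intro m
      induction m with
      | zero => intro x; rfl
      | succ m ih => intro x; rw [Function.iterate_succ_apply', ih]; rfl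
    change (u ^ m * v ^ n) f (0, 0) = _
    rw [mul_apply_eq_comp, boundedPrecomp_pow_apply, boundedPrecomp_pow_apply, h1, h2,
      zero_add, zero_add]
    rfl
  simpa only [e] using h

end PowerSeries

/-! ### Coordinates in ℓ² and partial isometries between different ℓ² spaces. -/

namespace EllTwo

variable {ι κ P Q R E : Type*} [NormedAddCommGroup E] [NormedSpace ℂ E]

theorem ξ_apply_self (p : P) : (ξ p : EllTwo P) p = 1 := by
  classical
  rw [ξ, lp.single_apply_self]

theorem ξ_apply_of_ne {p q : P} (h : q ≠ p) : (ξ p : EllTwo P) q = 0 := by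
  classical
  rw [ξ, lp.single_apply_ne _ _ _ h]

theorem inner_ξ_left (p : P) (x : EllTwo P) : inner ℂ (ξ p) x = x p := by
  classical
  rw [ξ, lp.inner_single_left]
  simp

theorem norm_ξ (p : P) : ‖(ξ p : EllTwo P)‖ = 1 := (orthonormal_ξ P).1 p

theorem hasSum_smul_ξ (x : EllTwo P) : HasSum (fun p => x p • ξ p) x := by
  classical
  refine (lp.hasSum_single ENNReal.ofNat_ne_top x).congr_term fun p => ?_
  rw [ξ, ← lp.single_smul, smul_eq_mul, mul_one]

theorem topologicalClosure_span_ξ :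
    (Submodule.span ℂ (Set.range (ξ : P → EllTwo P))).topologicalClosure = ⊤ := by
  rw [eq_top_iff]
  intro x _
  exact mem_closure_of_tendsto (hasSum_smul_ξ x) (Filter.Eventually.of_forall fun s =>
    Submodule.sum_mem _ fun p _ => Submodule.smul_mem _ _ (Submodule.subset_span ⟨p, rfl⟩))

theorem ext_ξ {A B : EllTwo P →L[ℂ] E} (h : ∀ p, A (ξ p) = B (ξ p)) : A = B := by
  ext x
  have hA := A.hasSum (hasSum_smul_ξ x)
  have hB := B.hasSum (hasSum_smul_ξ x)
  refine hA.unique (hB.congr_term fun p => ?_)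
  simp [h]

/-- For injective maps `f : ι → P`, `g : ι → Q`, the partial isometry `ℓ²(Q) → ℓ²(P)` with
`ξ_{g i} ↦ ξ_{f i}` for all `i` and `ξ_q ↦ 0` for `q` outside the range of `g`. -/
noncomputable def transfer (f : ι → P) (g : ι → Q) (hf : Function.Injective f)
    (hg : Function.Injective g) : EllTwo Q →L[ℂ] EllTwo P :=
  (mapIsometry f hf).toContinuousLinearMap ∘L
    ContinuousLinearMap.adjoint (mapIsometry g hg).toContinuousLinearMap

variable {f : ι → P} {g : ι → Q} (hf : Function.Injective f) (hg : Function.Injective g)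

theorem adjoint_mapIsometry_apply (x : EllTwo Q) (i : ι) :
    ContinuousLinearMap.adjoint (mapIsometry g hg).toContinuousLinearMap x i = x (g i) := by
  rw [← inner_ξ_left, ContinuousLinearMap.adjoint_inner_right, ← inner_ξ_left (g i),
    ← mapIsometry_ξ g hg]
  rfl

theorem adjoint_mapIsometry_ξ (i : ι) :
    ContinuousLinearMap.adjoint (mapIsometry g hg).toContinuousLinearMap (ξ (g i)) = ξ i := by
  ext k
  rw [adjoint_mapIsometry_apply]
  by_cases h : k = i
  · subst h; rw [ξ_apply_self, ξ_apply_self]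
  · rw [ξ_apply_of_ne h, ξ_apply_of_ne (hg.ne h)]

theorem transfer_ξ (i : ι) : transfer f g hf hg (ξ (g i)) = ξ (f i) := by
  rw [transfer, ContinuousLinearMap.comp_apply, adjoint_mapIsometry_ξ]
  exact mapIsometry_ξ f hf i

theorem transfer_ξ_of_notMem {q : Q} (hq : q ∉ Set.range g) :
    transfer f g hf hg (ξ q) = 0 := by
  have : ContinuousLinearMap.adjoint (mapIsometry g hg).toContinuousLinearMap (ξ q) = 0 := by
    ext k
    rw [adjoint_mapIsometry_apply, ξ_apply_of_ne fun h => hq ⟨k, h⟩]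
    rfl
  rw [transfer, ContinuousLinearMap.comp_apply, this, map_zero]

theorem mapIsometry_apply (x : EllTwo ι) (i : ι) : mapIsometry f hf x (f i) = x i := by
  rw [← adjoint_mapIsometry_apply hf]
  have : ContinuousLinearMap.adjoint (mapIsometry f hf).toContinuousLinearMap ∘L
      (mapIsometry f hf).toContinuousLinearMap = ContinuousLinearMap.id ℂ _ := by
    refine ext_ξ fun i => ?_
    simp only [ContinuousLinearMap.comp_apply, LinearIsometry.coe_toContinuousLinearMap,
      mapIsometry_ξ, ContinuousLinearMap.id_apply]
    exact adjoint_mapIsometry_ξ hf i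
  have h := DFunLike.congr_fun this x
  exact congrArg (fun y : EllTwo ι => y i) h

theorem mapIsometry_apply_of_notMem (x : EllTwo ι) {p : P} (hp : p ∉ Set.range f) :
    mapIsometry f hf x p = 0 := by
  have : (innerSL ℂ (ξ p)) ∘L (mapIsometry f hf).toContinuousLinearMap = 0 := by
    refine ext_ξ fun i => ?_
    simp only [ContinuousLinearMap.comp_apply, LinearIsometry.coe_toContinuousLinearMap,
      mapIsometry_ξ, innerSL_apply_apply, inner_ξ_left, zero_apply]
    exact ξ_apply_of_ne fun h => hp ⟨i, h.symm⟩
  have h := DFunLike.congr_fun this x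
  simpa [inner_ξ_left] using h

theorem transfer_apply (x : EllTwo Q) (i : ι) : transfer f g hf hg x (f i) = x (g i) := by
  rw [transfer, ContinuousLinearMap.comp_apply, ← adjoint_mapIsometry_apply hg]
  exact mapIsometry_apply hf _ i

theorem transfer_apply_of_notMem (x : EllTwo Q) {p : P} (hp : p ∉ Set.range f) :
    transfer f g hf hg x p = 0 :=
  mapIsometry_apply_of_notMem hf _ hp

theorem norm_transfer_le : ‖transfer f g hf hg‖ ≤ 1 := by
  refine (ContinuousLinearMap.opNorm_comp_le _ _).trans ?_
  rw [LinearIsometryEquiv.norm_map]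
  exact mul_le_one₀ (LinearIsometry.norm_toContinuousLinearMap_le _) (norm_nonneg _)
    (LinearIsometry.norm_toContinuousLinearMap_le _)

end EllTwo

/-! ### Weak operator limits of bounded families. -/

section WeakLimit

open Filter Topology

variable {H : Type*} [NormedAddCommGroup H] [InnerProductSpace ℂ H] [CompleteSpace H]

/-- Weak compactness of balls of operators: each matrix element stays in a compact disc, hence
converges along the ultrafilter; the limits form a bounded form, represented by an operator through
the Riesz theorem. -/
theorem exists_tendsto_ofCLM_of_norm_le {α : Type*} (𝒰 : Ultrafilter α) {A : α → H →L[ℂ] H} {C : ℝ}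
    (hA : ∀ n, ‖A n‖ ≤ C) :
    ∃ M : H →L[ℂ] H, Tendsto (fun n => ContinuousLinearMapWOT.ofCLM (A n)) 𝒰
      (𝓝 (ContinuousLinearMapWOT.ofCLM M)) := by
  have hb : ∀ n x y, ‖inner ℂ (A n x) y‖ ≤ C * ‖x‖ * ‖y‖ := fun n x y =>
    (norm_inner_le_norm _ _).trans (mul_le_mul_of_nonneg_right ((A n).le_of_opNorm_le (hA n) x)
      (norm_nonneg y))
  have hex : ∀ x y, ∃ b, ‖b‖ ≤ C * ‖x‖ * ‖y‖ ∧
      Tendsto (fun n => inner ℂ (A n x) y) 𝒰 (𝓝 b) := by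
    intro x y
    obtain ⟨b, hb1, hb2⟩ := (isCompact_closedBall (0 : ℂ) (C * ‖x‖ * ‖y‖)).ultrafilter_le_nhds
      (𝒰.map fun n => inner ℂ (A n x) y) (by
        rw [Ultrafilter.coe_map, le_principal_iff]
        exact mem_map.2 (univ_mem' fun n => mem_closedBall_zero_iff.2 (hb n x y)))
    exact ⟨b, mem_closedBall_zero_iff.1 hb1, hb2⟩
  choose b hb1 hb2 using hex
  let φ : H → StrongDual ℂ H := fun x => LinearMap.mkContinuous
    { toFun := b x
      map_add' := fun y z => tendsto_nhds_unique (hb2 x (y + z)) (by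
        simpa only [inner_add_right] using (hb2 x y).add (hb2 x z))
      map_smul' := fun c y => tendsto_nhds_unique (hb2 x (c • y)) (by
        simpa only [inner_smul_right, RingHom.id_apply, smul_eq_mul] using (hb2 x y).const_mul c) } (C * ‖x‖) (hb1 x)
  have hφ : ∀ x y, inner ℂ ((InnerProductSpace.toDual ℂ H).symm (φ x)) y = b x y := fun x y =>
    InnerProductSpace.toDual_symm_apply
  have hC : 0 ≤ C := by
    obtain ⟨n, -⟩ := 𝒰.nonempty_of_mem univ_mem
    exact (norm_nonneg _).trans (hA n)
  let M : H →L[ℂ] H := LinearMap.mkContinuous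
    { toFun := fun x => (InnerProductSpace.toDual ℂ H).symm (φ x)
      map_add' := fun x z => ext_inner_right ℂ fun y => by
        rw [inner_add_left, hφ, hφ, hφ]
        refine tendsto_nhds_unique (hb2 (x + z) y) ?_
        simpa only [map_add, inner_add_left] using (hb2 x y).add (hb2 z y)
      map_smul' := fun c x => ext_inner_right ℂ fun y => by
        rw [inner_smul_left, hφ, hφ]
        refine tendsto_nhds_unique (hb2 (c • x) y) ?_
        simpa only [map_smul, inner_smul_left, RingHom.id_apply] using
          (hb2 x y).const_mul (starRingEnd ℂ c) } C fun x => by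
    simp only [LinearMap.coe_mk, AddHom.coe_mk, LinearIsometryEquiv.norm_map]
    exact LinearMap.mkContinuous_norm_le _ (mul_nonneg hC (norm_nonneg x)) _
  refine ⟨M, ContinuousLinearMapWOT.tendsto_iff_forall_inner_apply_tendsto.2 fun x y => ?_⟩
  have h1 : inner ℂ y (M x) = starRingEnd ℂ (b x y) := by
    rw [← hφ, inner_conj_symm]
    rfl
  rw [ContinuousLinearMapWOT.ofCLM_apply, h1]
  refine ((Complex.continuous_conj.tendsto _).comp (hb2 x y)).congr fun n => ?_
  exact inner_conj_symm _ _

end WeakLimit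

/-! ### Analytic multipliers of ℓ²(ℕ × ℕ). -/

section Multiplier

open Filter Topology MeasureTheory UnitAddTorus

/-- The product measure on the torus. -/
noncomputable local instance : MeasureSpace UnitAddCircle := ⟨AddCircle.haarAddCircle⟩

local instance : IsProbabilityMeasure (volume : Measure UnitAddCircle) :=
  inferInstanceAs (IsProbabilityMeasure AddCircle.haarAddCircle)

/-- The isometry `ξ_{(m, n)} ↦ ξ_{(m, n) + k}` of `ℓ²(ℕ × ℕ)`. -/
noncomputable def shiftOp (k : ℕ × ℕ) : EllTwo (ℕ × ℕ) →L[ℂ] EllTwo (ℕ × ℕ) :=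
  (EllTwo.mapIsometry (fun l => l + k) (add_left_injective k)).toContinuousLinearMap

theorem shiftOp_ξ (k l : ℕ × ℕ) : shiftOp k (EllTwo.ξ l) = EllTwo.ξ (l + k) :=
  EllTwo.mapIsometry_ξ _ (add_left_injective k) l

theorem norm_shiftOp_le (k : ℕ × ℕ) : ‖shiftOp k‖ ≤ 1 :=
  LinearIsometry.norm_toContinuousLinearMap_le _

theorem summable_smul_shiftOp {c : ℕ × ℕ → ℂ} (hs : Summable fun k => ‖c k‖) :
    Summable fun k => c k • shiftOp k := by
  refine Summable.of_norm_bounded hs fun k => ?_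
  rw [norm_smul]
  exact mul_le_of_le_one_right (norm_nonneg _) (norm_shiftOp_le k)

theorem norm_toLp_mul_le (φ F : C(UnitAddTorus (Fin 2), ℂ)) :
    ‖ContinuousMap.toLp (E := ℂ) 2 volume ℂ (φ * F)‖ ≤
      ‖φ‖ * ‖ContinuousMap.toLp (E := ℂ) 2 volume ℂ F‖ := by
  refine Lp.norm_le_mul_norm_of_ae_le_mul ?_
  filter_upwards [ContinuousMap.coeFn_toLp (p := 2) (𝕜 := ℂ) volume (φ * F),
    ContinuousMap.coeFn_toLp (p := 2) (𝕜 := ℂ) volume F] with x h1 h2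
  rw [h1, h2, ContinuousMap.mul_apply, norm_mul]
  exact mul_le_mul_of_nonneg_right (φ.norm_coe_le_norm x) (norm_nonneg _)

theorem HasSum.continuousLinearMap_apply {ι E F : Type*} [NormedAddCommGroup E] [NormedSpace ℂ E]
    [NormedAddCommGroup F] [NormedSpace ℂ F] {f : ι → E →L[ℂ] F} {S : E →L[ℂ] F} (h : HasSum f S)
    (x : E) : HasSum (fun i => f i x) (S x) :=
  (ContinuousLinearMap.apply ℂ F x).hasSum h

/-- The isometry `J` turns the shift by k into multiplication by `e k`, so a series in the shifts
becomes multiplication by the continuous function φ = Σ c_k e_k, of norm at most ‖φ‖. This is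
checked on finite combinations of basis vectors and extended by density. -/
theorem norm_tsum_smul_shiftOp_le_of_isometry {X E : Type*} [TopologicalSpace X] [CompactSpace X]
    [NormedAddCommGroup E] [NormedSpace ℂ E] (J : EllTwo (ℕ × ℕ) →ₗᵢ[ℂ] E) (T : C(X, ℂ) →L[ℂ] E)
    (hT : ∀ φ F, ‖T (φ * F)‖ ≤ ‖φ‖ * ‖T F‖) {e : ℕ × ℕ → C(X, ℂ)} (he : ∀ k l, e (l + k) = e k * e l)
    (he1 : ∀ k, ‖e k‖ ≤ 1) (hJ : ∀ k, J (EllTwo.ξ k) = T (e k)) {c : ℕ × ℕ → ℂ}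
    (hs : Summable fun k => ‖c k‖) :
    ‖∑' k, c k • shiftOp k‖ ≤ ‖∑' k, c k • e k‖ := by
  have hφs : Summable fun k => c k • e k := by
    refine Summable.of_norm_bounded hs fun k => ?_
    rw [norm_smul]
    exact mul_le_of_le_one_right (norm_nonneg _) (he1 k)
  set φ : C(X, ℂ) := ∑' k, c k • e k with hφ
  have hgood : ∀ x ∈ Submodule.span ℂ (Set.range (EllTwo.ξ : ℕ × ℕ → EllTwo (ℕ × ℕ))),
      ∃ F, J x = T F ∧ ∀ k, J (shiftOp k x) = T (e k * F) := by
    intro x hx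
    induction hx using Submodule.span_induction with
    | mem x hx =>
      obtain ⟨l, rfl⟩ := hx
      exact ⟨e l, hJ l, fun k => by rw [shiftOp_ξ, hJ, he]⟩
    | zero => exact ⟨0, by simp, fun k => by simp⟩
    | add x y _ _ hx hy =>
      obtain ⟨F, hF, hF'⟩ := hx
      obtain ⟨G, hG, hG'⟩ := hy
      exact ⟨F + G, by rw [map_add, map_add, hF, hG], fun k => by
        rw [map_add, map_add, hF', hG', mul_add, map_add]⟩
    | smul a x _ hx =>
      obtain ⟨F, hF, hF'⟩ := hx
      exact ⟨a • F, by rw [map_smul, map_smul, hF], fun k => by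
        rw [map_smul, map_smul, hF', mul_smul_comm, map_smul]⟩
  have hS := summable_smul_shiftOp hs
  set S := ∑' k, c k • shiftOp k with hSdef
  have hbound : ∀ x ∈ Submodule.span ℂ (Set.range (EllTwo.ξ : ℕ × ℕ → EllTwo (ℕ × ℕ))),
      ‖S x‖ ≤ ‖φ‖ * ‖x‖ := by
    intro x hx
    obtain ⟨F, hF, hF'⟩ := hgood x hx
    have h1 : HasSum (fun k => c k • shiftOp k x) (S x) :=
      hS.hasSum.continuousLinearMap_apply x
    have h2 : HasSum (fun k => T ((c k • e k) * F)) (T (φ * F)) :=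
      T.hasSum (hφs.hasSum.mul_right F)
    have h4 : HasSum (fun k => J (c k • shiftOp k x)) (J (S x)) :=
      J.toContinuousLinearMap.hasSum h1
    have h3 : J (S x) = T (φ * F) := by
      refine h4.unique (h2.congr_term fun k => ?_)
      rw [map_smul, hF', smul_mul_assoc, map_smul]
    rw [← J.norm_map (S x), h3, ← J.norm_map x, hF]
    exact hT φ F
  refine ContinuousLinearMap.opNorm_le_bound _ (norm_nonneg _) fun x => ?_
  have hx : x ∈ closure (Submodule.span ℂ (Set.range (EllTwo.ξ : ℕ × ℕ → EllTwo (ℕ × ℕ))) :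
      Set (EllTwo (ℕ × ℕ))) := by
    rw [← Submodule.topologicalClosure_coe, EllTwo.topologicalClosure_span_ξ]
    trivial
  have hcl : IsClosed {x : EllTwo (ℕ × ℕ) | ‖S x‖ ≤ ‖φ‖ * ‖x‖} :=
    isClosed_le S.continuous.norm (continuous_const.mul continuous_norm)
  exact closure_minimal hbound hcl hx

/-- Here ℓ²(ℕ × ℕ) sits in L² of the torus as the span of the characters with nonnegative
frequencies. The first index belongs to w and the second to z. -/
theorem norm_tsum_smul_shiftOp_le {c : ℕ × ℕ → ℂ} {C : ℝ} (hs : Summable fun k => ‖c k‖)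
    (hC : ∀ z w : ℂ, ‖z‖ = 1 → ‖w‖ = 1 → ‖∑' k : ℕ × ℕ, c k * z ^ k.2 * w ^ k.1‖ ≤ C) :
    ‖∑' k, c k • shiftOp k‖ ≤ C := by
  have hC0 : 0 ≤ C := (norm_nonneg _).trans (hC 1 1 (by simp) (by simp))
  let idx : ℕ × ℕ → Fin 2 → ℤ := fun k => ![k.1, k.2]
  have hidxi : Function.Injective idx := by
    rintro ⟨a, b⟩ ⟨a', b'⟩ h
    have h0 := congrFun h 0
    have h1 := congrFun h 1
    simp [idx] at h0 h1
    simp [h0, h1]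
  have he : ∀ k l, mFourier (idx (l + k)) = mFourier (idx k) * mFourier (idx l) := by
    intro k l
    have : idx (l + k) = idx k + idx l := by
      funext i
      fin_cases i <;> simp [idx, add_comm]
    ext y
    rw [this, mFourier_add, ContinuousMap.mul_apply]
  refine (norm_tsum_smul_shiftOp_le_of_isometry
    ((orthonormal_mFourier (d := Fin 2)).comp idx hidxi).orthogonalFamily.linearIsometry
    (ContinuousMap.toLp (E := ℂ) 2 (volume : Measure (UnitAddTorus (Fin 2))) ℂ) norm_toLp_mul_le
    he (fun k => mFourier_norm.le) (fun k => ?_) hs).trans ?_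
  · classical
    rw [EllTwo.ξ]
    erw [OrthogonalFamily.linearIsometry_apply_single]
    simp
  · have hφs : Summable fun k => c k • mFourier (idx k) := by
      refine Summable.of_norm_bounded hs fun k => ?_
      rw [norm_smul, mFourier_norm, mul_one]
    refine (ContinuousMap.norm_le _ hC0).2 fun x => ?_
    have h1 := (ContinuousMap.evalCLM ℂ x).hasSum hφs.hasSum
    have h2 : ∀ k, (ContinuousMap.evalCLM ℂ x) (c k • mFourier (idx k)) =
        c k * (fourier 1 (x 1) : ℂ) ^ k.2 * (fourier 1 (x 0) : ℂ) ^ k.1 := fun k => by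
      simp [mFourier, idx, fourier_apply, AddCircle.toCircle_zsmul]
      ring
    have h3 := h1.tsum_eq
    simp only [h2] at h3
    change ‖(ContinuousMap.evalCLM ℂ x) _‖ ≤ C
    rw [← h3]
    exact hC _ _ (by rw [fourier_apply]; exact Circle.norm_coe _)
      (by rw [fourier_apply]; exact Circle.norm_coe _)

/-- The dilates g(rz, rw) give absolutely convergent series in the shifts with norms at most C, and
M is a weak limit of these as r → 1. The first conclusion says that M is in the weakly closed span
of the shifts that occur; in this form it can later be transported into 𝔏_G and into commutants. -/
theorem exists_multiplier {c : ℕ × ℕ → ℂ} {g : ℂ → ℂ → ℂ} {C : ℝ}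
    (hc : ∀ z ∈ Metric.ball (0 : ℂ) 1, ∀ w ∈ Metric.ball (0 : ℂ) 1,
      HasSum (fun k : ℕ × ℕ => c k * z ^ k.2 * w ^ k.1) (g z w))
    (hg : ∀ z ∈ Metric.ball (0 : ℂ) 1, ∀ w ∈ Metric.ball (0 : ℂ) 1, ‖g z w‖ ≤ C) :
    ∃ M : EllTwo (ℕ × ℕ) →L[ℂ] EllTwo (ℕ × ℕ),
      (∀ N : Submodule ℂ (EllTwo (ℕ × ℕ) →WOT[ℂ] EllTwo (ℕ × ℕ)),
        IsClosed (N : Set (EllTwo (ℕ × ℕ) →WOT[ℂ] EllTwo (ℕ × ℕ))) →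
        (∀ k, c k ≠ 0 → ContinuousLinearMapWOT.ofCLM (shiftOp k) ∈ N) →
        ContinuousLinearMapWOT.ofCLM M ∈ N) ∧
      ∀ k, M (EllTwo.ξ 0) k = c k := by
  set r : ℕ → ℝ := fun n => n / (n + 1) with hr
  have hr0 : ∀ n, 0 ≤ r n := fun n => by positivity
  have hr1 : ∀ n, r n < 1 := fun n => by
    rw [hr]; simp only; rw [div_lt_one (by positivity)]; linarith
  have hrt : Tendsto r atTop (𝓝 1) := tendsto_natCast_div_add_atTop (1 : ℝ)
  have hrb : ∀ n, ∀ z : ℂ, ‖z‖ = 1 → (r n : ℂ) * z ∈ Metric.ball (0 : ℂ) 1 := fun n z hz => by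
    rw [mem_ball_zero_iff, norm_mul, hz, mul_one, Complex.norm_real, Real.norm_of_nonneg (hr0 n)]
    exact hr1 n
  set d : ℕ → ℕ × ℕ → ℂ := fun n k => c k * r n ^ k.2 * r n ^ k.1 with hd
  have hds : ∀ n, Summable fun k => ‖d n k‖ := fun n => by
    have h := hrb n 1 (by simp)
    rw [mul_one] at h
    exact (hc _ h _ h).summable.norm
  have hA : ∀ n, ‖∑' k, d n k • shiftOp k‖ ≤ C := fun n => by
    refine norm_tsum_smul_shiftOp_le (hds n) fun z w hz hw => ?_
    have h := hc _ (hrb n z hz) _ (hrb n w hw)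
    rw [show ∑' k : ℕ × ℕ, d n k * z ^ k.2 * w ^ k.1 = g (r n * z) (r n * w) from by
      rw [← h.tsum_eq]
      exact tsum_congr fun k => by rw [mul_pow, mul_pow]; ring]
    exact hg _ (hrb n z hz) _ (hrb n w hw)
  obtain ⟨M, hM⟩ := exists_tendsto_ofCLM_of_norm_le (hyperfilter ℕ) hA
  refine ⟨M, fun N hN hk => ?_, fun k => ?_⟩
  -- Two closures are used: M is a weak limit of the dilated operators, and each of those is a norm
  -- limit of finite sums.
  · refine hN.mem_of_tendsto hM (Eventually.of_forall fun n => ?_)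
    refine (hN.preimage ContinuousLinearMapWOT.continuous_ofCLM).mem_of_tendsto
      (summable_smul_shiftOp (hds n)).hasSum (Eventually.of_forall fun s => ?_)
    have : ContinuousLinearMapWOT.ofCLM (∑ k ∈ s, d n k • shiftOp k)
        = ∑ k ∈ s, d n k • ContinuousLinearMapWOT.ofCLM (shiftOp k) :=
      map_sum (ContinuousLinearMap.WOTofCLM (σ := RingHom.id ℂ)
        (E := EllTwo (ℕ × ℕ)) (F := EllTwo (ℕ × ℕ))) _ _
    change ContinuousLinearMapWOT.ofCLM (∑ k ∈ s, d n k • shiftOp k) ∈ N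
    rw [this]
    refine Submodule.sum_mem _ fun k _ => ?_
    -- Only the shifts with nonzero coefficient are known to lie in `N`; the other terms vanish.
    by_cases h : c k = 0
    · rw [show d n k = 0 by simp [hd, h]]
      rw [← ContinuousLinearMapWOT.ofCLM_smul, zero_smul]
      exact N.zero_mem
    · exact Submodule.smul_mem _ _ (hk k h)
  · have h1 := (ContinuousLinearMapWOT.tendsto_iff_forall_inner_apply_tendsto.1 hM)
      (EllTwo.ξ 0) (EllTwo.ξ k)
    simp only [ContinuousLinearMapWOT.ofCLM_apply, EllTwo.inner_ξ_left] at h1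
    have h2 : ∀ n, (∑' k, d n k • shiftOp k) (EllTwo.ξ 0) k = d n k := by
      intro n
      have h3 : HasSum (fun l => d n l • EllTwo.ξ l) ((∑' k, d n k • shiftOp k) (EllTwo.ξ 0)) :=
        ((summable_smul_shiftOp (hds n)).hasSum.continuousLinearMap_apply (EllTwo.ξ 0)).congr_term
          fun l => by
            simp [shiftOp_ξ]
      have h4 := (innerSL ℂ (EllTwo.ξ k)).hasSum h3
      simp only [innerSL_apply_apply, EllTwo.inner_ξ_left, inner_smul_right] at h4
      refine h4.unique ?_
      refine (hasSum_ite_eq k (d n k)).congr_term fun l => ?_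
      by_cases h : l = k
      · subst h; simp [EllTwo.ξ_apply_self]
      · simp [h, EllTwo.ξ_apply_of_ne (Ne.symm h)]
    simp only [h2] at h1
    have h5 : Tendsto (fun n => d n k) (hyperfilter ℕ) (𝓝 (c k)) := by
      have h6 : Tendsto (fun n => (r n : ℂ)) (hyperfilter ℕ) (𝓝 1) := by
        have := (Complex.continuous_ofReal.tendsto 1).comp hrt
        rw [Complex.ofReal_one] at this
        exact this.mono_left Nat.hyperfilter_le_atTop
      have := (tendsto_const_nhds (x := c k)).mul (h6.pow k.2) |>.mul (h6.pow k.1)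
      simpa using this
    exact tendsto_nhds_unique h1 h5

end Multiplier

/-! ### The generators over an arbitrary graph: action on the basis, relations, norms. -/

section General

open EllTwo FreeSemigroupoid

variable {V : Type*} [Quiver V]

theorem edgeOp_ξ_of_rng {x y : V} (f : x ⟶ y) {s : V} (p : Quiver.Path s x) :
    edgeOp f (ξ (⟨s, x, p⟩ : FreeSemigroupoid V)) = ξ ⟨s, y, p.cons f⟩ :=
  partialIsometry_ξ _ _ (edgeMul_injective f) (ofPathsTo_injective x) ⟨s, p⟩

theorem edgeOp_ξ_of_rng_ne {x y : V} (f : x ⟶ y) {w : FreeSemigroupoid V}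
    (h : w.rng ≠ x) : edgeOp f (ξ w) = 0 :=
  partialIsometry_ξ_of_notMem _ _ _ _ w fun ⟨_, hv⟩ => h (by rw [← hv]; rfl)

theorem vertexOp_ξ_of_rng {x : V} {s : V} (p : Quiver.Path s x) :
    vertexOp x (ξ (⟨s, x, p⟩ : FreeSemigroupoid V)) = ξ ⟨s, x, p⟩ :=
  partialIsometry_ξ _ _ (ofPathsTo_injective x) (ofPathsTo_injective x) ⟨s, p⟩

theorem vertexOp_ξ_of_rng_ne {x : V} {w : FreeSemigroupoid V}
    (h : w.rng ≠ x) : vertexOp x (ξ w) = 0 :=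
  partialIsometry_ξ_of_notMem _ _ _ _ w fun ⟨_, hv⟩ => h (by rw [← hv]; rfl)

theorem ext_rng {E : Type*} [NormedAddCommGroup E] [NormedSpace ℂ E]
    {A B : PathHilbert V →L[ℂ] E} (x : V)
    (h : ∀ (s : V) (p : Quiver.Path s x), A (ξ ⟨s, x, p⟩) = B (ξ ⟨s, x, p⟩))
    (h' : ∀ w : FreeSemigroupoid V, w.rng ≠ x → A (ξ w) = B (ξ w)) : A = B := by
  refine ext_ξ fun w => ?_
  by_cases hw : w.rng = x
  · obtain ⟨s, y, p⟩ := w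
    subst hw
    exact h s p
  · exact h' w hw

theorem vertexOp_mul_self (x : V) : vertexOp x * vertexOp x = vertexOp x :=
  ext_rng x (fun s p => by simp [vertexOp_ξ_of_rng]) fun w hw => by simp [vertexOp_ξ_of_rng_ne hw]

theorem vertexOp_mul_vertexOp {x y : V} (h : y ≠ x) : vertexOp x * vertexOp y = 0 :=
  ext_rng y (fun s p => by
    rw [mul_apply_eq_comp, vertexOp_ξ_of_rng, vertexOp_ξ_of_rng_ne h, zero_apply]) fun w hw => by
    simp [vertexOp_ξ_of_rng_ne hw]

theorem vertexOp_mul_edgeOp {x y : V} (f : x ⟶ y) : vertexOp y * edgeOp f = edgeOp f :=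
  ext_rng x (fun s p => by simp [edgeOp_ξ_of_rng, vertexOp_ξ_of_rng]) fun w hw => by
    simp [edgeOp_ξ_of_rng_ne f hw]

theorem vertexOp_mul_edgeOp_of_ne {x y z : V} (f : x ⟶ y) (h : y ≠ z) :
    vertexOp z * edgeOp f = 0 := by
  rw [← vertexOp_mul_edgeOp f, ← mul_assoc, vertexOp_mul_vertexOp h, zero_mul]

theorem edgeOp_mul_vertexOp {x y : V} (f : x ⟶ y) : edgeOp f * vertexOp x = edgeOp f :=
  ext_rng x (fun s p => by simp [vertexOp_ξ_of_rng]) fun w hw => by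
    simp [edgeOp_ξ_of_rng_ne f hw, vertexOp_ξ_of_rng_ne hw]

theorem edgeOp_mul_vertexOp_of_ne {x y z : V} (f : x ⟶ y) (h : z ≠ x) :
    edgeOp f * vertexOp z = 0 := by
  rw [← edgeOp_mul_vertexOp f, mul_assoc, vertexOp_mul_vertexOp h, mul_zero]

theorem norm_partialIsometry_le {ι P : Type*} {f g : ι → P} (hf : Function.Injective f)
    (hg : Function.Injective g) : ‖partialIsometry f g hf hg‖ ≤ 1 :=
  norm_transfer_le hf hg

/-- The adjoint of `L_f` is a contractive left inverse of `L_f` on its initial space. -/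
theorem exists_mul_edgeOp_eq_vertexOp {x y : V} (f : x ⟶ y) :
    ∃ S : PathHilbert V →L[ℂ] PathHilbert V, ‖S‖ ≤ 1 ∧ S * edgeOp f = vertexOp x := by
  refine ⟨partialIsometry (ofPathsTo x) (edgeMul f) (ofPathsTo_injective x) (edgeMul_injective f),
    norm_partialIsometry_le _ _, ext_rng x (fun s p => ?_) fun w hw => ?_⟩
  · rw [mul_apply_eq_comp, edgeOp_ξ_of_rng, vertexOp_ξ_of_rng]
    exact partialIsometry_ξ _ _ (ofPathsTo_injective x) (edgeMul_injective f) ⟨s, p⟩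
  · rw [mul_apply_eq_comp, edgeOp_ξ_of_rng_ne f hw, vertexOp_ξ_of_rng_ne hw, map_zero]

theorem vertexOp_mem (x : V) : vertexOp x ∈ pathOpAlgebra V :=
  NonUnitalAlgebra.subset_adjoin ℂ (Or.inl ⟨x, rfl⟩)

theorem edgeOp_mem {x y : V} (f : x ⟶ y) : edgeOp f ∈ pathOpAlgebra V :=
  NonUnitalAlgebra.subset_adjoin ℂ (Or.inr ⟨x, y, f, rfl⟩)

theorem norm_edgeOp_le {x y : V} (f : x ⟶ y) : ‖edgeOp f‖ ≤ 1 := norm_partialIsometry_le _ _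

theorem norm_vertexOp_le (x : V) : ‖vertexOp x‖ ≤ 1 := norm_partialIsometry_le _ _

end General

namespace TwoLoopGraph

open EllTwo FreeSemigroupoid

/-! ### The paths of the graph -/

/-- The path `e₁ ^ m`. -/
def loopPath₁ (m : ℕ) : FreeSemigroupoid Vertex := ⟨.v₁, .v₁, loopPow e₁ m⟩

/-- The path `e₂ ^ n`. -/
def loopPath₂ (n : ℕ) : FreeSemigroupoid Vertex := ⟨.v₂, .v₂, loopPow e₂ n⟩

/-- The path `e₁ ^ m e e₂ ^ n`, indexed by the pair `(m, n)`. -/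
def crossPath (k : ℕ × ℕ) : FreeSemigroupoid Vertex := pathMN k.1 k.2

/-- How often an edge is `e₁` and `e₂`. -/
def loopCountEdge : ∀ {x y : Vertex}, (x ⟶ y) → ℕ × ℕ
  | _, _, Edge.e₁ => (1, 0)
  | _, _, Edge.e₂ => (0, 1)
  | _, _, Edge.e => (0, 0)

/-- How often the edges `e₁` and `e₂` occur in a path. -/
def loopCount {x : Vertex} : ∀ {y : Vertex}, Quiver.Path x y → ℕ × ℕ
  | _, .nil => (0, 0)
  | _, .cons p f => loopCount p + loopCountEdge f

theorem loopCount_loopPow_e₁ (m : ℕ) : loopCount (loopPow e₁ m) = (m, 0) := by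
  induction m with
  | zero => rfl
  | succ m ih => rw [loopPow, loopCount, ih]; rfl

theorem loopCount_loopPow_e₂ (n : ℕ) : loopCount (loopPow e₂ n) = (0, n) := by
  induction n with
  | zero => rfl
  | succ n ih => rw [loopPow, loopCount, ih]; rfl

theorem loopCount_pathMN (m n : ℕ) : loopCount (pathMN m n).path = (m, n) := by
  induction m with
  | zero =>
    change loopCount (loopPow e₂ n) + (0, 0) = (0, n)
    rw [loopCount_loopPow_e₂]; rfl
  | succ m ih =>
    change loopCount (pathMN m n).path + (1, 0) = (m + 1, n)
    rw [ih]; rfl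

theorem loopPath₁_injective : Function.Injective loopPath₁ := fun m n h => by
  have := congrArg (fun w : FreeSemigroupoid Vertex => loopCount w.path) h
  simpa [loopPath₁, loopCount_loopPow_e₁] using this

theorem loopPath₂_injective : Function.Injective loopPath₂ := fun m n h => by
  have := congrArg (fun w : FreeSemigroupoid Vertex => loopCount w.path) h
  simpa [loopPath₂, loopCount_loopPow_e₂] using this

theorem crossPath_injective : Function.Injective crossPath := fun k l h => by
  have := congrArg (fun w : FreeSemigroupoid Vertex => loopCount w.path) h
  simpa [crossPath, loopCount_pathMN] using this

/-- No edge leads from v₁ back to v₂, so a path crosses `e` at most once. The induction appends the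
last edge; edges with the wrong source are excluded by the range of the shorter path. -/
theorem path_cases (w : FreeSemigroupoid Vertex) :
    (∃ m, w = loopPath₁ m) ∨ (∃ n, w = loopPath₂ n) ∨ ∃ k, w = crossPath k := by
  obtain ⟨x, y, p⟩ := w
  induction p with
  | nil =>
    cases x
    · exact Or.inl ⟨0, rfl⟩
    · exact Or.inr (Or.inl ⟨0, rfl⟩)
  | cons p f ih =>
    rcases ih with ⟨m, h⟩ | ⟨n, h⟩ | ⟨k, h⟩
    · change Edge _ _ at f
      cases f with
      | e₁ =>
        simp only [loopPath₁, FreeSemigroupoid.mk.injEq] at h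
        obtain ⟨rfl, -, h⟩ := h
        exact Or.inl ⟨m + 1, by rw [eq_of_heq h]; rfl⟩
      | e₂ => simp [loopPath₁] at h
      | e => simp [loopPath₁] at h
    · change Edge _ _ at f
      cases f with
      | e₁ => simp [loopPath₂] at h
      | e₂ =>
        simp only [loopPath₂, FreeSemigroupoid.mk.injEq] at h
        obtain ⟨rfl, -, h⟩ := h
        exact Or.inr (Or.inl ⟨n + 1, by rw [eq_of_heq h]; rfl⟩)
      | e =>
        simp only [loopPath₂, FreeSemigroupoid.mk.injEq] at h
        obtain ⟨rfl, -, h⟩ := h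
        exact Or.inr (Or.inr ⟨(0, n), by rw [eq_of_heq h]; rfl⟩)
    · change Edge _ _ at f
      cases f with
      | e₁ =>
        simp only [crossPath, pathMN, FreeSemigroupoid.mk.injEq] at h
        obtain ⟨rfl, -, h⟩ := h
        exact Or.inr (Or.inr ⟨(k.1 + 1, k.2), by rw [eq_of_heq h]; rfl⟩)
      | e₂ => simp [crossPath, pathMN] at h
      | e => simp [crossPath, pathMN] at h

theorem loopPath₁_ne_loopPath₂ (m n : ℕ) : loopPath₁ m ≠ loopPath₂ n := fun h => by
  simpa [loopPath₁, loopPath₂] using congrArg FreeSemigroupoid.src h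

theorem loopPath₁_ne_crossPath (m : ℕ) (k : ℕ × ℕ) : loopPath₁ m ≠ crossPath k := fun h => by
  simpa [loopPath₁, crossPath, pathMN] using congrArg FreeSemigroupoid.src h

theorem loopPath₂_ne_crossPath (n : ℕ) (k : ℕ × ℕ) : loopPath₂ n ≠ crossPath k := fun h => by
  simpa [loopPath₂, crossPath, pathMN] using congrArg FreeSemigroupoid.rng h

theorem ext_paths {E : Type*} [NormedAddCommGroup E] [NormedSpace ℂ E]
    {A B : PathHilbert Vertex →L[ℂ] E} (h₁ : ∀ m, A (ξ (loopPath₁ m)) = B (ξ (loopPath₁ m)))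
    (h₂ : ∀ n, A (ξ (loopPath₂ n)) = B (ξ (loopPath₂ n)))
    (h : ∀ k, A (ξ (crossPath k)) = B (ξ (crossPath k))) : A = B := by
  refine ext_ξ fun w => ?_
  rcases path_cases w with ⟨m, rfl⟩ | ⟨n, rfl⟩ | ⟨k, rfl⟩
  exacts [h₁ m, h₂ n, h k]

/-! ### The generators on the standard basis -/

@[simp] theorem vertexOp_v₁_loopPath₁ (m : ℕ) : vertexOp .v₁ (ξ (loopPath₁ m)) = ξ (loopPath₁ m) :=
  vertexOp_ξ_of_rng _

@[simp] theorem vertexOp_v₁_loopPath₂ (n : ℕ) : vertexOp .v₁ (ξ (loopPath₂ n)) = 0 :=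
  vertexOp_ξ_of_rng_ne (by simp [loopPath₂])

@[simp] theorem vertexOp_v₁_crossPath (k : ℕ × ℕ) : vertexOp .v₁ (ξ (crossPath k)) = ξ (crossPath k) :=
  vertexOp_ξ_of_rng _

@[simp] theorem vertexOp_v₂_loopPath₁ (m : ℕ) : vertexOp .v₂ (ξ (loopPath₁ m)) = 0 :=
  vertexOp_ξ_of_rng_ne (by simp [loopPath₁])

@[simp] theorem vertexOp_v₂_loopPath₂ (n : ℕ) : vertexOp .v₂ (ξ (loopPath₂ n)) = ξ (loopPath₂ n) :=
  vertexOp_ξ_of_rng _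

@[simp] theorem vertexOp_v₂_crossPath (k : ℕ × ℕ) : vertexOp .v₂ (ξ (crossPath k)) = 0 :=
  vertexOp_ξ_of_rng_ne (by simp [crossPath, pathMN])

@[simp] theorem edgeOp_e₁_loopPath₁ (m : ℕ) : edgeOp e₁ (ξ (loopPath₁ m)) = ξ (loopPath₁ (m + 1)) :=
  edgeOp_ξ_of_rng e₁ _

@[simp] theorem edgeOp_e₁_loopPath₂ (n : ℕ) : edgeOp e₁ (ξ (loopPath₂ n)) = 0 :=
  edgeOp_ξ_of_rng_ne _ (by simp [loopPath₂])

@[simp] theorem edgeOp_e₁_crossPath (k : ℕ × ℕ) :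
    edgeOp e₁ (ξ (crossPath k)) = ξ (crossPath (k.1 + 1, k.2)) :=
  edgeOp_ξ_of_rng e₁ _

@[simp] theorem edgeOp_e₂_loopPath₁ (m : ℕ) : edgeOp e₂ (ξ (loopPath₁ m)) = 0 :=
  edgeOp_ξ_of_rng_ne _ (by simp [loopPath₁])

@[simp] theorem edgeOp_e₂_loopPath₂ (n : ℕ) : edgeOp e₂ (ξ (loopPath₂ n)) = ξ (loopPath₂ (n + 1)) :=
  edgeOp_ξ_of_rng e₂ _

@[simp] theorem edgeOp_e₂_crossPath (k : ℕ × ℕ) : edgeOp e₂ (ξ (crossPath k)) = 0 :=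
  edgeOp_ξ_of_rng_ne _ (by simp [crossPath, pathMN])

@[simp] theorem edgeOp_e_loopPath₁ (m : ℕ) : edgeOp e (ξ (loopPath₁ m)) = 0 :=
  edgeOp_ξ_of_rng_ne _ (by simp [loopPath₁])

@[simp] theorem edgeOp_e_loopPath₂ (n : ℕ) : edgeOp e (ξ (loopPath₂ n)) = ξ (crossPath (0, n)) :=
  edgeOp_ξ_of_rng e _

@[simp] theorem edgeOp_e_crossPath (k : ℕ × ℕ) : edgeOp e (ξ (crossPath k)) = 0 :=
  edgeOp_ξ_of_rng_ne _ (by simp [crossPath, pathMN])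

/-! ### Comparison with `ℓ²(ℕ × ℕ)` -/

theorem pairZero_injective : Function.Injective fun m : ℕ => (m, 0) := fun m n h => by
  simpa using h

theorem zeroPair_injective : Function.Injective fun n : ℕ => (0, n) := fun m n h => by
  simpa using h

/-- `ξ_{(m, n)} ↦ ξ_{e₁ ^ m e e₂ ^ n}`. -/
noncomputable def ofCross : EllTwo (ℕ × ℕ) →L[ℂ] PathHilbert Vertex :=
  transfer crossPath id crossPath_injective Function.injective_id

/-- The adjoint of `ofCross`. -/
noncomputable def toCross : PathHilbert Vertex →L[ℂ] EllTwo (ℕ × ℕ) :=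
  transfer id crossPath Function.injective_id crossPath_injective

/-- `ξ_{(m, 0)} ↦ ξ_{e₁ ^ m}`. -/
noncomputable def ofLoop₁ : EllTwo (ℕ × ℕ) →L[ℂ] PathHilbert Vertex :=
  transfer loopPath₁ (fun m => (m, 0)) loopPath₁_injective pairZero_injective

/-- The adjoint of `ofLoop₁`. -/
noncomputable def toLoop₁ : PathHilbert Vertex →L[ℂ] EllTwo (ℕ × ℕ) :=
  transfer (fun m => (m, 0)) loopPath₁ pairZero_injective loopPath₁_injective

/-- `ξ_{(0, n)} ↦ ξ_{e₂ ^ n}`. -/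
noncomputable def ofLoop₂ : EllTwo (ℕ × ℕ) →L[ℂ] PathHilbert Vertex :=
  transfer loopPath₂ (fun n => (0, n)) loopPath₂_injective zeroPair_injective

/-- The adjoint of `ofLoop₂`. -/
noncomputable def toLoop₂ : PathHilbert Vertex →L[ℂ] EllTwo (ℕ × ℕ) :=
  transfer (fun n => (0, n)) loopPath₂ zeroPair_injective loopPath₂_injective

@[simp] theorem ofCross_ξ (k : ℕ × ℕ) : ofCross (ξ k) = ξ (crossPath k) :=
  transfer_ξ crossPath_injective Function.injective_id k

@[simp] theorem toCross_loopPath₁ (m : ℕ) : toCross (ξ (loopPath₁ m)) = 0 :=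
  transfer_ξ_of_notMem _ _ fun ⟨k, h⟩ => loopPath₁_ne_crossPath m k h.symm

@[simp] theorem toCross_loopPath₂ (n : ℕ) : toCross (ξ (loopPath₂ n)) = 0 :=
  transfer_ξ_of_notMem _ _ fun ⟨k, h⟩ => loopPath₂_ne_crossPath n k h.symm

@[simp] theorem toCross_crossPath (k : ℕ × ℕ) : toCross (ξ (crossPath k)) = ξ k :=
  transfer_ξ Function.injective_id crossPath_injective k

@[simp] theorem ofLoop₁_ξ (m : ℕ) : ofLoop₁ (ξ (m, 0)) = ξ (loopPath₁ m) :=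
  transfer_ξ loopPath₁_injective pairZero_injective m

@[simp] theorem toLoop₁_loopPath₁ (m : ℕ) : toLoop₁ (ξ (loopPath₁ m)) = ξ (m, 0) :=
  transfer_ξ pairZero_injective loopPath₁_injective m

@[simp] theorem toLoop₁_loopPath₂ (n : ℕ) : toLoop₁ (ξ (loopPath₂ n)) = 0 :=
  transfer_ξ_of_notMem _ _ fun ⟨m, h⟩ => loopPath₁_ne_loopPath₂ m n h

@[simp] theorem toLoop₁_crossPath (k : ℕ × ℕ) : toLoop₁ (ξ (crossPath k)) = 0 :=
  transfer_ξ_of_notMem _ _ fun ⟨m, h⟩ => loopPath₁_ne_crossPath m k h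

@[simp] theorem ofLoop₂_ξ (n : ℕ) : ofLoop₂ (ξ (0, n)) = ξ (loopPath₂ n) :=
  transfer_ξ loopPath₂_injective zeroPair_injective n

@[simp] theorem toLoop₂_loopPath₁ (m : ℕ) : toLoop₂ (ξ (loopPath₁ m)) = 0 :=
  transfer_ξ_of_notMem _ _ fun ⟨n, h⟩ => loopPath₁_ne_loopPath₂ m n h.symm

@[simp] theorem toLoop₂_loopPath₂ (n : ℕ) : toLoop₂ (ξ (loopPath₂ n)) = ξ (0, n) :=
  transfer_ξ zeroPair_injective loopPath₂_injective n

@[simp] theorem toLoop₂_crossPath (k : ℕ × ℕ) : toLoop₂ (ξ (crossPath k)) = 0 :=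
  transfer_ξ_of_notMem _ _ fun ⟨n, h⟩ => loopPath₂_ne_crossPath n k h

/-! ### Right multiplication operators -/

/-- The projection onto the span of the paths with source `v₂`. -/
noncomputable def rightV₂ : PathHilbert Vertex →L[ℂ] PathHilbert Vertex :=
  transfer loopPath₂ loopPath₂ loopPath₂_injective loopPath₂_injective +
    transfer crossPath crossPath crossPath_injective crossPath_injective

theorem succ_comp_injective {α : Type*} {f : ℕ → α} (hf : Function.Injective f) :
    Function.Injective fun n => f (n + 1) :=
  hf.comp (add_left_injective 1)

theorem crossPath_succ_right_injective :
    Function.Injective fun k : ℕ × ℕ => crossPath (k.1, k.2 + 1) := fun k l h => by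
  have := crossPath_injective h
  simp only [Prod.mk.injEq, add_left_inj] at this
  exact Prod.ext this.1 this.2

/-- `ξ_w ↦ ξ_{w e₂}`. -/
noncomputable def rightE₂ : PathHilbert Vertex →L[ℂ] PathHilbert Vertex :=
  transfer (fun n => loopPath₂ (n + 1)) loopPath₂ (succ_comp_injective loopPath₂_injective)
      loopPath₂_injective +
    transfer (fun k : ℕ × ℕ => crossPath (k.1, k.2 + 1)) crossPath crossPath_succ_right_injective
      crossPath_injective

/-- `ξ_w ↦ ξ_{w e}`. -/
noncomputable def rightE : PathHilbert Vertex →L[ℂ] PathHilbert Vertex :=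
  transfer (fun m => crossPath (m, 0)) loopPath₁ (crossPath_injective.comp pairZero_injective)
    loopPath₁_injective

@[simp] theorem rightV₂_loopPath₁ (m : ℕ) : rightV₂ (ξ (loopPath₁ m)) = 0 := by
  rw [rightV₂, add_apply,
    transfer_ξ_of_notMem _ _ fun ⟨n, h⟩ => loopPath₁_ne_loopPath₂ m n h.symm,
    transfer_ξ_of_notMem _ _ fun ⟨k, h⟩ => loopPath₁_ne_crossPath m k h.symm, add_zero]

@[simp] theorem rightV₂_loopPath₂ (n : ℕ) : rightV₂ (ξ (loopPath₂ n)) = ξ (loopPath₂ n) := by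
  rw [rightV₂, add_apply, transfer_ξ,
    transfer_ξ_of_notMem _ _ fun ⟨k, h⟩ => loopPath₂_ne_crossPath n k h.symm, add_zero]

@[simp] theorem rightV₂_crossPath (k : ℕ × ℕ) : rightV₂ (ξ (crossPath k)) = ξ (crossPath k) := by
  rw [rightV₂, add_apply, transfer_ξ,
    transfer_ξ_of_notMem _ _ fun ⟨n, h⟩ => loopPath₂_ne_crossPath n k h, zero_add]

@[simp] theorem rightE₂_loopPath₁ (m : ℕ) : rightE₂ (ξ (loopPath₁ m)) = 0 := by
  rw [rightE₂, add_apply,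
    transfer_ξ_of_notMem _ _ fun ⟨n, h⟩ => loopPath₁_ne_loopPath₂ m n h.symm,
    transfer_ξ_of_notMem _ _ fun ⟨k, h⟩ => loopPath₁_ne_crossPath m k h.symm, add_zero]

@[simp] theorem rightE₂_loopPath₂ (n : ℕ) : rightE₂ (ξ (loopPath₂ n)) = ξ (loopPath₂ (n + 1)) := by
  rw [rightE₂, add_apply, transfer_ξ (succ_comp_injective loopPath₂_injective),
    transfer_ξ_of_notMem _ _ fun ⟨k, h⟩ => loopPath₂_ne_crossPath n k h.symm, add_zero]

@[simp] theorem rightE₂_crossPath (k : ℕ × ℕ) :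
    rightE₂ (ξ (crossPath k)) = ξ (crossPath (k.1, k.2 + 1)) := by
  rw [rightE₂, add_apply, transfer_ξ crossPath_succ_right_injective,
    transfer_ξ_of_notMem _ _ fun ⟨n, h⟩ => loopPath₂_ne_crossPath n k h, zero_add]

@[simp] theorem rightE_loopPath₁ (m : ℕ) : rightE (ξ (loopPath₁ m)) = ξ (crossPath (m, 0)) :=
  transfer_ξ (crossPath_injective.comp pairZero_injective) loopPath₁_injective m

@[simp] theorem rightE_loopPath₂ (n : ℕ) : rightE (ξ (loopPath₂ n)) = 0 :=
  transfer_ξ_of_notMem _ _ fun ⟨m, h⟩ => loopPath₁_ne_loopPath₂ m n h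

@[simp] theorem rightE_crossPath (k : ℕ × ℕ) : rightE (ξ (crossPath k)) = 0 :=
  transfer_ξ_of_notMem _ _ fun ⟨m, h⟩ => loopPath₁_ne_crossPath m k h

/-! ### The structure of `𝔏_G` -/

theorem mem_of_mem_generators {p : (PathHilbert Vertex →L[ℂ] PathHilbert Vertex) → Prop}
    (hv₁ : p (vertexOp .v₁)) (hv₂ : p (vertexOp .v₂)) (he₁ : p (edgeOp e₁)) (he₂ : p (edgeOp e₂))
    (he : p (edgeOp e)) {A} (hA : A ∈ semigroupoidGenerators Vertex) : p A := by
  rcases hA with ⟨x, rfl⟩ | ⟨x, y, f, rfl⟩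
  · cases x
    exacts [hv₁, hv₂]
  · change Edge x y at f
    cases f
    exacts [he₁, he₂, he]

end TwoLoopGraph

/-! ### Weakly closed conditions pass to the weak closure of an algebra. -/

section WeakClosure

open ContinuousLinearMapWOT

variable {H : Type*} [NormedAddCommGroup H] [NormedSpace ℂ H]
  {S : NonUnitalSubalgebra ℂ (H →L[ℂ] H)}

theorem ofCLM_mem_of_mem_wotClosure {N : Set (H →WOT[ℂ] H)} (hN : IsClosed N)
    (h : ∀ A ∈ S, ofCLM A ∈ N) {A : H →L[ℂ] H} (hA : A ∈ wotClosure S) : ofCLM A ∈ N := by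
  refine closure_minimal ?_ hN hA
  rintro _ ⟨B, hB, rfl⟩
  exact h B hB

theorem isClosed_wotClosure : IsClosed {X : H →WOT[ℂ] H | toCLM X ∈ wotClosure S} :=
  isClosed_closure

theorem isClosed_coe_wotClosure : IsClosed (wotClosure S : Set (H →L[ℂ] H)) :=
  isClosed_closure.preimage continuous_ofCLM

theorem le_wotClosure : S ≤ wotClosure S :=
  S.le_topologicalClosure.trans (topologicalClosure_le_wotClosure S)

/-- Multiplication by a fixed operator on either side is weakly continuous, so a commutant is weakly
closed. -/
theorem mul_comm_of_mem_wotClosure {B : H →L[ℂ] H} (h : ∀ A ∈ S, A * B = B * A) {A : H →L[ℂ] H}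
    (hA : A ∈ wotClosure S) : A * B = B * A := by
  have hN : IsClosed {X : H →WOT[ℂ] H | X * ofCLM B = ofCLM B * X} :=
    isClosed_eq (continuous_mul_const _) (continuous_const_mul _)
  have := ofCLM_mem_of_mem_wotClosure hN (fun A hA => congrArg ofCLM (h A hA)) hA
  exact ofCLM_injective this

end WeakClosure

/-! ### Commutation with right multiplications and the triangular form of 𝔏_G. -/

namespace TwoLoopGraph

open EllTwo FreeSemigroupoid

theorem pathOpAlgebra_le : pathOpAlgebra Vertex ≤ freeSemigroupoidAlg Vertex := le_wotClosure

theorem mul_comm_of_mem_pathOpAlgebra {B : PathHilbert Vertex →L[ℂ] PathHilbert Vertex}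
    (h : ∀ A ∈ semigroupoidGenerators Vertex, A * B = B * A) :
    ∀ A ∈ pathOpAlgebra Vertex, A * B = B * A := by
  intro A hA
  induction hA using NonUnitalAlgebra.adjoin_induction with
  | mem A hA => exact h A hA
  | add A A' _ _ hA hA' => rw [add_mul, mul_add, hA, hA']
  | zero => rw [zero_mul, mul_zero]
  | mul A A' _ _ hA hA' => rw [mul_assoc, hA', ← mul_assoc, hA, mul_assoc]
  | smul c A _ hA => rw [smul_mul_assoc, mul_smul_comm, hA]

section Relations

variable {A : PathHilbert Vertex →L[ℂ] PathHilbert Vertex} (hA : A ∈ freeSemigroupoidAlg Vertex)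
include hA

/-- Left and right concatenation of paths commute on the generators, and this passes to the weak
closure; the same reason gives the next two statements. -/
theorem mul_rightV₂ : A * rightV₂ = rightV₂ * A := by
  refine mul_comm_of_mem_wotClosure (mul_comm_of_mem_pathOpAlgebra fun A hA => ?_) hA
  refine mem_of_mem_generators (p := fun A => A * rightV₂ = rightV₂ * A) ?_ ?_ ?_ ?_ ?_ hA <;>
    refine ext_paths ?_ ?_ ?_ <;> intro k <;> simp

theorem mul_rightE₂ : A * rightE₂ = rightE₂ * A := by
  refine mul_comm_of_mem_wotClosure (mul_comm_of_mem_pathOpAlgebra fun A hA => ?_) hA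
  refine mem_of_mem_generators (p := fun A => A * rightE₂ = rightE₂ * A) ?_ ?_ ?_ ?_ ?_ hA <;>
    refine ext_paths ?_ ?_ ?_ <;> intro k <;> simp

theorem mul_rightE : A * rightE = rightE * A := by
  refine mul_comm_of_mem_wotClosure (mul_comm_of_mem_pathOpAlgebra fun A hA => ?_) hA
  refine mem_of_mem_generators (p := fun A => A * rightE = rightE * A) ?_ ?_ ?_ ?_ ?_ hA <;>
    refine ext_paths ?_ ?_ ?_ <;> intro k <;> simp

end Relations

theorem vertexOp_add_vertexOp :
    (vertexOp .v₁ + vertexOp .v₂ : PathHilbert Vertex →L[ℂ] PathHilbert Vertex) = 1 := by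
  refine ext_paths ?_ ?_ ?_ <;> intro k <;> simp

section Triangular

variable {R : Type*} [Ring R] {p q a b : R}

theorem compress_mul (hp : p * p = p) (hq : q * q = q) (h : p + q = 1) (r s : R) :
    r * (a * b) * s = r * a * p * (p * b * s) + r * a * q * (q * b * s) := by
  have h1 : a * b = a * (p * p) * b + a * (q * q) * b := by
    rw [hp, hq, ← add_mul, ← mul_add, h, mul_one]
  rw [h1]
  noncomm_ring

end Triangular

/-- There is no path from v₁ to v₂, and the corner at each vertex is generated by its loop. In the
induction, a product is split along p + q = 1; the vanishing lower corner leaves only products of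
diagonal corners. -/
theorem triangular_of_mem_pathOpAlgebra {A : PathHilbert Vertex →L[ℂ] PathHilbert Vertex}
    (hA : A ∈ pathOpAlgebra Vertex) :
    vertexOp .v₂ * A * vertexOp .v₁ = 0 ∧
      vertexOp .v₁ * A * vertexOp .v₁ * edgeOp e₁ = edgeOp e₁ * (vertexOp .v₁ * A * vertexOp .v₁) ∧
      vertexOp .v₂ * A * vertexOp .v₂ * edgeOp e₂ =
        edgeOp e₂ * (vertexOp .v₂ * A * vertexOp .v₂) := by
  induction hA using NonUnitalAlgebra.adjoin_induction with
  | mem A hA =>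
    refine mem_of_mem_generators (p := fun A => vertexOp .v₂ * A * vertexOp .v₁ = 0 ∧
      vertexOp .v₁ * A * vertexOp .v₁ * edgeOp e₁ = edgeOp e₁ * (vertexOp .v₁ * A * vertexOp .v₁) ∧
      vertexOp .v₂ * A * vertexOp .v₂ * edgeOp e₂ =
        edgeOp e₂ * (vertexOp .v₂ * A * vertexOp .v₂)) ?_ ?_ ?_ ?_ ?_ hA <;>
    refine ⟨?_, ?_, ?_⟩ <;> refine ext_paths ?_ ?_ ?_ <;> intro k <;> simp
  | add A B _ _ hA hB =>
    simp only [mul_add, add_mul, hA, hB, add_zero, true_and]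
  | zero => simp
  | mul A B _ _ hA hB =>
    have hp := vertexOp_mul_self Vertex.v₁
    have hq := vertexOp_mul_self Vertex.v₂
    have h := vertexOp_add_vertexOp
    refine ⟨?_, ?_, ?_⟩
    · rw [compress_mul hp hq h, hA.1, hB.1, zero_mul, mul_zero, add_zero]
    · rw [compress_mul hp hq h, hB.1, mul_zero, add_zero, mul_assoc _ _ (edgeOp e₁), hB.2.1,
        ← mul_assoc, hA.2.1, mul_assoc]
    · rw [compress_mul hp hq h, hA.1, zero_mul, zero_add, mul_assoc _ _ (edgeOp e₂), hB.2.2,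
        ← mul_assoc, hA.2.2, mul_assoc]
  | smul c A _ hA => simp only [mul_smul_comm, smul_mul_assoc, hA, smul_zero, and_self]

theorem triangular_of_mem {A : PathHilbert Vertex →L[ℂ] PathHilbert Vertex}
    (hA : A ∈ freeSemigroupoidAlg Vertex) :
    vertexOp .v₂ * A * vertexOp .v₁ = 0 ∧
      vertexOp .v₁ * A * vertexOp .v₁ * edgeOp e₁ = edgeOp e₁ * (vertexOp .v₁ * A * vertexOp .v₁) ∧
      vertexOp .v₂ * A * vertexOp .v₂ * edgeOp e₂ =
        edgeOp e₂ * (vertexOp .v₂ * A * vertexOp .v₂) := by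
  let w : (PathHilbert Vertex →L[ℂ] PathHilbert Vertex) →
    (PathHilbert Vertex →WOT[ℂ] PathHilbert Vertex) := ContinuousLinearMapWOT.ofCLM
  have hc : ∀ B C D : PathHilbert Vertex →WOT[ℂ] PathHilbert Vertex,
      Continuous fun X : PathHilbert Vertex →WOT[ℂ] PathHilbert Vertex => B * (C * X * D) :=
    fun B C D => (continuous_const_mul B).comp
      ((continuous_mul_const D).comp (continuous_const_mul C))
  -- The harmless factors `w 1` give both sides of the equations in X the shape B (C X D), so that
  -- `hc` covers all of them.
  have hN : IsClosed ({X | w 1 * (w (vertexOp .v₂) * X * w (vertexOp .v₁)) = 0} ∩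
      ({X | w 1 * (w (vertexOp .v₁) * X * w (vertexOp .v₁ * edgeOp e₁)) =
        w (edgeOp e₁) * (w (vertexOp .v₁) * X * w (vertexOp .v₁))} ∩
      {X | w 1 * (w (vertexOp .v₂) * X * w (vertexOp .v₂ * edgeOp e₂)) =
        w (edgeOp e₂) * (w (vertexOp .v₂) * X * w (vertexOp .v₂))})) :=
    (isClosed_eq (hc _ _ _) continuous_const).inter
      ((isClosed_eq (hc _ _ _) (hc _ _ _)).inter (isClosed_eq (hc _ _ _) (hc _ _ _)))
  have h := ofCLM_mem_of_mem_wotClosure hN (S := pathOpAlgebra Vertex) (fun B hB => ?_) hA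
  · obtain ⟨h1, h2, h3⟩ := h
    replace h1 : 1 * (vertexOp .v₂ * A * vertexOp .v₁) = 0 :=
      ContinuousLinearMapWOT.ofCLM_injective h1
    replace h2 : 1 * (vertexOp .v₁ * A * (vertexOp .v₁ * edgeOp e₁)) =
        edgeOp e₁ * (vertexOp .v₁ * A * vertexOp .v₁) := ContinuousLinearMapWOT.ofCLM_injective h2
    replace h3 : 1 * (vertexOp .v₂ * A * (vertexOp .v₂ * edgeOp e₂)) =
        edgeOp e₂ * (vertexOp .v₂ * A * vertexOp .v₂) := ContinuousLinearMapWOT.ofCLM_injective h3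
    rw [one_mul] at h1 h2 h3
    exact ⟨h1, by rw [← h2, ← mul_assoc], by rw [← h3, ← mul_assoc]⟩
  · obtain ⟨h1, h2, h3⟩ := triangular_of_mem_pathOpAlgebra hB
    refine ⟨congrArg w ?_, congrArg w ?_, congrArg w ?_⟩
    · change 1 * (vertexOp .v₂ * B * vertexOp .v₁) = 0
      rw [one_mul, h1]
    · change 1 * (vertexOp .v₁ * B * (vertexOp .v₁ * edgeOp e₁)) = edgeOp e₁ * (vertexOp .v₁ * B * vertexOp .v₁)
      rw [one_mul, ← mul_assoc, h2]
    · change 1 * (vertexOp .v₂ * B * (vertexOp .v₂ * edgeOp e₂)) = edgeOp e₂ * (vertexOp .v₂ * B * vertexOp .v₂)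
      rw [one_mul, ← mul_assoc, h3]

/-! ### Elements of `𝔏_G` from multipliers -/

/-- The operator is L_{e₁}^m L_e L_{e₂}^n, built up one factor at a time. -/
theorem cross_shiftOp_mem (k : ℕ × ℕ) :
    ofCross ∘L shiftOp k ∘L toLoop₂ ∈ pathOpAlgebra Vertex := by
  obtain ⟨m, n⟩ := k
  induction m with
  | zero =>
    induction n with
    | zero =>
      convert edgeOp_mem e using 1
      refine ext_paths ?_ ?_ ?_ <;> intro k <;> simp [shiftOp_ξ]
    | succ n ih =>
      convert mul_mem ih (edgeOp_mem e₂) using 1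
      refine ext_paths ?_ ?_ ?_ <;> intro k <;> simp [shiftOp_ξ]
      ring_nf
  | succ m ih =>
    convert mul_mem (edgeOp_mem e₁) ih using 1
    refine ext_paths ?_ ?_ ?_ <;> intro k <;> simp [shiftOp_ξ]

theorem loop₂_shiftOp_mem (n : ℕ) :
    ofLoop₂ ∘L shiftOp (0, n) ∘L toLoop₂ ∈ pathOpAlgebra Vertex := by
  induction n with
  | zero =>
    convert vertexOp_mem Vertex.v₂ using 1
    refine ext_paths ?_ ?_ ?_ <;> intro k <;> simp [shiftOp_ξ]
  | succ n ih =>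
    convert mul_mem (edgeOp_mem e₂) ih using 1
    refine ext_paths ?_ ?_ ?_ <;> intro k <;> simp [shiftOp_ξ]
    ring_nf

/-- The operator is the m-th power of L_{e₁}, read as the v₁ projection for m = 0. It acts on all
paths ending at v₁, both those through `e` and the powers of `e₁`, hence the two summands. -/
theorem loop₁_shiftOp_mem (m : ℕ) :
    ofCross ∘L shiftOp (m, 0) ∘L toCross + ofLoop₁ ∘L shiftOp (m, 0) ∘L toLoop₁ ∈
      pathOpAlgebra Vertex := by
  induction m with
  | zero =>
    convert vertexOp_mem Vertex.v₁ using 1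
    refine ext_paths ?_ ?_ ?_
    on_goal 3 => rintro ⟨i, j⟩
    all_goals simp [shiftOp_ξ]
  | succ n ih =>
    convert mul_mem (edgeOp_mem e₁) ih using 1
    refine ext_paths ?_ ?_ ?_
    on_goal 3 => rintro ⟨i, j⟩
    all_goals simp [shiftOp_ξ, ← add_assoc]

end TwoLoopGraph

namespace TwoLoopGraph

open EllTwo FreeSemigroupoid

/-- `𝔏_G` as a subspace of the copy of `B(H_G)` with the weak operator topology. -/
def weakSubmodule : Submodule ℂ (PathHilbert Vertex →WOT[ℂ] PathHilbert Vertex) where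
  carrier := {X | ContinuousLinearMapWOT.toCLM X ∈ freeSemigroupoidAlg Vertex}
  zero_mem' := zero_mem (freeSemigroupoidAlg Vertex)
  add_mem' := fun ha hb => add_mem (s := freeSemigroupoidAlg Vertex) ha hb
  smul_mem' := fun c _ ha => SMulMemClass.smul_mem (s := freeSemigroupoidAlg Vertex) c ha

/-- `X ↦ A X B`, continuous in the weak operator topologies. -/
noncomputable def sandwich (A : EllTwo (ℕ × ℕ) →L[ℂ] PathHilbert Vertex)
    (B : PathHilbert Vertex →L[ℂ] EllTwo (ℕ × ℕ)) :
    (EllTwo (ℕ × ℕ) →WOT[ℂ] EllTwo (ℕ × ℕ)) →L[ℂ]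
      (PathHilbert Vertex →WOT[ℂ] PathHilbert Vertex) :=
  (ContinuousLinearMapWOT.postcompCLM (ContinuousLinearMapWOT.ofCLM A)).comp
    (ContinuousLinearMapWOT.precompCLM (ContinuousLinearMapWOT.ofCLM B))

/-- `M` lies in the weakly closed span of the shifts `S_k` with `c k ≠ 0`. -/
def IsWeakSeries (c : ℕ × ℕ → ℂ) (M : EllTwo (ℕ × ℕ) →L[ℂ] EllTwo (ℕ × ℕ)) : Prop :=
  ∀ N : Submodule ℂ (EllTwo (ℕ × ℕ) →WOT[ℂ] EllTwo (ℕ × ℕ)),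
    IsClosed (N : Set (EllTwo (ℕ × ℕ) →WOT[ℂ] EllTwo (ℕ × ℕ))) →
    (∀ k, c k ≠ 0 → ContinuousLinearMapWOT.ofCLM (shiftOp k) ∈ N) →
    ContinuousLinearMapWOT.ofCLM M ∈ N

section

variable {c : ℕ × ℕ → ℂ} {M : EllTwo (ℕ × ℕ) →L[ℂ] EllTwo (ℕ × ℕ)} (hM : IsWeakSeries c M)
include hM

/-- The preimage of 𝔏_G under a weakly continuous linear map is a weakly closed subspace, so
membership only has to be checked on shifts. -/
theorem mem_of_isWeakSeries
    (Θ : (EllTwo (ℕ × ℕ) →WOT[ℂ] EllTwo (ℕ × ℕ)) →L[ℂ]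
      (PathHilbert Vertex →WOT[ℂ] PathHilbert Vertex))
    (h : ∀ k, c k ≠ 0 → Θ (ContinuousLinearMapWOT.ofCLM (shiftOp k)) ∈ weakSubmodule) :
    Θ (ContinuousLinearMapWOT.ofCLM M) ∈ weakSubmodule :=
  hM (weakSubmodule.comap Θ.toLinearMap) (isClosed_wotClosure.preimage Θ.continuous) h

theorem mul_shiftOp_comm_of_isWeakSeries (l : ℕ × ℕ) : M * shiftOp l = shiftOp l * M := by
  have hN : IsClosed {X : EllTwo (ℕ × ℕ) →WOT[ℂ] EllTwo (ℕ × ℕ) |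
      X * ContinuousLinearMapWOT.ofCLM (shiftOp l) =
        ContinuousLinearMapWOT.ofCLM (shiftOp l) * X} :=
    isClosed_eq (continuous_mul_const _) (continuous_const_mul _)
  have h := hM
    { carrier := {X | X * ContinuousLinearMapWOT.ofCLM (shiftOp l) =
        ContinuousLinearMapWOT.ofCLM (shiftOp l) * X}
      zero_mem' := by simp
      add_mem' := fun {X Y} hX hY => by
        rw [Set.mem_ofPred_eq] at hX hY ⊢
        rw [add_mul, mul_add, hX, hY]
      smul_mem' := fun a X hX => by
        have h : X.toCLM * shiftOp l = shiftOp l * X.toCLM := congrArg ContinuousLinearMapWOT.toCLM hX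
        exact congrArg ContinuousLinearMapWOT.ofCLM (show a • X.toCLM * shiftOp l = shiftOp l * a • X.toCLM by
          rw [smul_mul_assoc, mul_smul_comm, h]) } hN fun k _ => congrArg ContinuousLinearMapWOT.ofCLM
          (show shiftOp k * shiftOp l = shiftOp l * shiftOp k from ext_ξ fun p => by
            simp [shiftOp_ξ, add_right_comm])
  exact ContinuousLinearMapWOT.ofCLM_injective h

theorem cross_mem_of_isWeakSeries : ofCross ∘L M ∘L toLoop₂ ∈ freeSemigroupoidAlg Vertex :=
  mem_of_isWeakSeries hM (sandwich ofCross toLoop₂) fun k _ => pathOpAlgebra_le (cross_shiftOp_mem k)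

theorem loop₂_mem_of_isWeakSeries (hc : ∀ k, k.1 ≠ 0 → c k = 0) :
    ofLoop₂ ∘L M ∘L toLoop₂ ∈ freeSemigroupoidAlg Vertex :=
  mem_of_isWeakSeries hM (sandwich ofLoop₂ toLoop₂) fun k hk => pathOpAlgebra_le (by
    obtain ⟨m, n⟩ := k
    obtain rfl : m = 0 := by_contra fun h => hk (hc _ h)
    exact loop₂_shiftOp_mem n)

theorem loop₁_mem_of_isWeakSeries (hc : ∀ k, k.2 ≠ 0 → c k = 0) :
    ofCross ∘L M ∘L toCross + ofLoop₁ ∘L M ∘L toLoop₁ ∈ freeSemigroupoidAlg Vertex :=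
  mem_of_isWeakSeries hM (sandwich ofCross toCross + sandwich ofLoop₁ toLoop₁)
    fun k hk => pathOpAlgebra_le (by
      obtain ⟨m, n⟩ := k
      obtain rfl : n = 0 := by_contra fun h => hk (hc _ h)
      exact loop₁_shiftOp_mem m)

end

end TwoLoopGraph

/-! ### Bounded derivations between subalgebras of a normed algebra. -/

section Derivations

variable {B : Type*} [NormedRing B] [NormedAlgebra ℂ B] {A X : NonUnitalSubalgebra ℂ B}

theorem derivation_mul (δ : boundedDerivations A X) (a b : A) :
    δ.1 (a * b) = δ.1 a * (b : B) + (a : B) * δ.1 b :=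
  δ.2.2.2 a b

/-- The derivation `a ↦ a T - T a`, for an element `T` whose commutators with `A` lie in `X`. -/
noncomputable def commutatorDerivation (T : B) (hT : ∀ a ∈ A, a * T - T * a ∈ X) :
    boundedDerivations A X :=
  ⟨{  toFun := fun a => a * T - T * a
      map_add' := fun a b => by push_cast; noncomm_ring
      map_smul' := fun c a => by
        simp only [NonUnitalSubalgebra.coe_smul, smul_mul_assoc, mul_smul_comm, smul_sub,
          RingHom.id_apply] },
    fun a => hT a a.2, ⟨2 * ‖T‖, fun a => by
      refine (norm_sub_le _ _).trans ?_
      have h1 := norm_mul_le (a : B) T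
      have h2 := norm_mul_le T (a : B)
      linarith⟩, fun a b => by
    simp only [LinearMap.coe_mk, AddHom.coe_mk, NonUnitalSubalgebra.coe_mul]
    noncomm_ring⟩

theorem commutator_mem (hAX : A ≤ X) {T : B} (hT : T ∈ X) (a : B) (ha : a ∈ A) :
    a * T - T * a ∈ X :=
  sub_mem (mul_mem (hAX ha) hT) (mul_mem hT (hAX ha))

theorem commutatorDerivation_mem_innerDerivations (hAX : A ≤ X) {T : B} (hT : T ∈ X) :
    commutatorDerivation T (commutator_mem hAX hT) ∈ innerDerivations A X :=
  ⟨T, hT, fun _ => rfl⟩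

/-- By the Leibniz rule for the commutator, the condition passes from generators to products; it is
closed in norm. `T` itself may lie outside `X`, and this is what produces outer derivations. -/
theorem commutator_mem_of_mem_topologicalClosure {s : Set B} (hX : IsClosed (X : Set B))
    (hs : NonUnitalAlgebra.adjoin ℂ s ≤ X) {T : B} (hT : ∀ a ∈ s, a * T - T * a ∈ X) {a : B}
    (ha : a ∈ (NonUnitalAlgebra.adjoin ℂ s).topologicalClosure) : a * T - T * a ∈ X := by
  have h : ∀ a ∈ NonUnitalAlgebra.adjoin ℂ s, a * T - T * a ∈ X := by
    intro a ha
    induction ha using NonUnitalAlgebra.adjoin_induction with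
    | mem a ha => exact hT a ha
    | add a b _ _ ha hb =>
      convert add_mem ha hb using 1
      noncomm_ring
    | zero => simp
    | mul a b ha' hb' ha hb =>
      convert add_mem (mul_mem ha (hs hb')) (mul_mem (hs ha') hb) using 1
      noncomm_ring
    | smul c a _ ha =>
      convert SMulMemClass.smul_mem (s := X) c ha using 1
      rw [smul_sub, smul_mul_assoc, mul_smul_comm]
  have hc : IsClosed {a : B | a * T - T * a ∈ (X : Set B)} :=
    hX.preimage ((continuous_mul_const T).sub (continuous_const_mul T))
  exact closure_minimal h hc ha

theorem derivation_eq_zero {s : Set B} (hA : A = (NonUnitalAlgebra.adjoin ℂ s).topologicalClosure)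
    {δ : boundedDerivations A X} (hδ : ∀ a (ha : a ∈ A), a ∈ s → δ.1 ⟨a, ha⟩ = 0) : δ = 0 := by
  have hle : NonUnitalAlgebra.adjoin ℂ s ≤ A := hA ▸ NonUnitalSubalgebra.le_topologicalClosure _
  have h : ∀ a (ha : a ∈ NonUnitalAlgebra.adjoin ℂ s), δ.1 ⟨a, hle ha⟩ = 0 := by
    intro a ha
    induction ha using NonUnitalAlgebra.adjoin_induction with
    | mem a ha => exact hδ a _ ha
    | add a b ha' hb' ha hb =>
      have := δ.1.map_add ⟨a, hle ha'⟩ ⟨b, hle hb'⟩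
      rw [ha, hb, add_zero] at this
      exact this
    | zero => exact δ.1.map_zero
    | mul a b ha' hb' ha hb =>
      have := derivation_mul δ ⟨a, hle ha'⟩ ⟨b, hle hb'⟩
      rw [ha, hb, zero_mul, mul_zero, add_zero] at this
      exact this
    | smul c a ha' ha =>
      have := δ.1.map_smul c ⟨a, hle ha'⟩
      rw [ha, smul_zero] at this
      exact this
  obtain ⟨C, hC⟩ := δ.2.2.1
  refine Subtype.ext (LinearMap.ext fun a => ?_)
  have hle' : A ≤ (NonUnitalAlgebra.adjoin ℂ s).topologicalClosure := hA.le
  have hcl : (a : B) ∈ closure (NonUnitalAlgebra.adjoin ℂ s : Set B) := hle' a.2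
  have hb : ∀ ε > 0, ‖δ.1 a‖ ≤ |C| * ε := by
    intro ε hε
    obtain ⟨b, hb, hab⟩ := Metric.mem_closure_iff.1 hcl ε hε
    have h1 := hC (a - ⟨b, hle hb⟩)
    rw [map_sub, h b hb, sub_zero] at h1
    refine h1.trans ?_
    rw [dist_eq_norm] at hab
    exact mul_le_mul (le_abs_self C) hab.le (norm_nonneg _) (abs_nonneg C)
  have h0 : ‖δ.1 a‖ ≤ 0 := by
    by_contra hne
    rw [not_le] at hne
    -- For this ε one has |C| ε < ‖δ a‖, contradicting `hb`.
    have := hb (‖δ.1 a‖ / (2 * (|C| + 1))) (by positivity)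
    rw [mul_div_assoc', le_div_iff₀ (by positivity)] at this
    nlinarith [abs_nonneg C]
  simpa using h0

/-- The powers of `l`, starting with `p` in degree zero. -/
noncomputable def powFrom (p l : A) : ℕ → A
  | 0 => p
  | n + 1 => l * powFrom p l n

theorem coe_powFrom (p l : A) (n : ℕ) : (powFrom p l n : B) = (l : B) ^ n * p := by
  induction n with
  | zero => simp [powFrom]
  | succ n ih => rw [powFrom, NonUnitalSubalgebra.coe_mul, ih, pow_succ', mul_assoc]

theorem norm_powFrom_le {p l : A} (hp : ‖(p : B)‖ ≤ 1) (hl : ‖(l : B)‖ ≤ 1) (n : ℕ) :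
    ‖(powFrom p l n : B)‖ ≤ 1 := by
  induction n with
  | zero => exact hp
  | succ n ih =>
    rw [powFrom, NonUnitalSubalgebra.coe_mul]
    exact (norm_mul_le _ _).trans (mul_le_one₀ hl (norm_nonneg _) ih)

variable {δ : boundedDerivations A X}

theorem mul_derivation_of_eq_zero {p a : A} (hp : δ.1 p = 0) (h : p * a = a) :
    (p : B) * δ.1 a = δ.1 a := by
  have h' := derivation_mul δ p a
  rw [hp, zero_mul, zero_add, h] at h'
  exact h'.symm

theorem derivation_mul_of_eq_zero {p a : A} (hp : δ.1 p = 0) (h : a * p = a) :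
    δ.1 a * (p : B) = δ.1 a := by
  have h' := derivation_mul δ a p
  rw [hp, mul_zero, add_zero, h] at h'
  exact h'.symm

theorem derivation_powFrom {p l : A} (hp : δ.1 p = 0) (hl : δ.1 l = 0) (n : ℕ) :
    δ.1 (powFrom p l n) = 0 := by
  induction n with
  | zero => exact hp
  | succ n ih => rw [powFrom, derivation_mul, hl, ih, zero_mul, mul_zero, add_zero]

/-- Since D = δ(l) commutes with l, δ(l^(n+1)) = (n+1) l^n D. The left inverse `S` prevents l^n D
from being smaller than D, while the powers of l have norm at most one, so (n+1)‖D‖ stays bounded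
and D = 0. -/
theorem derivation_eq_zero_of_commute {p l : A} (hp : δ.1 p = 0) (hpl : p * l = l) (hlp : l * p = l)
    (hp1 : ‖(p : B)‖ ≤ 1) (hl1 : ‖(l : B)‖ ≤ 1) {S : B} (hS1 : ‖S‖ ≤ 1) (hS : S * l = p)
    (hc : δ.1 l * (l : B) = l * δ.1 l) : δ.1 l = 0 := by
  have hPD := mul_derivation_of_eq_zero hp hpl
  have hDP := derivation_mul_of_eq_zero hp hlp
  have hpl' : (p : B) * l = l := congrArg Subtype.val hpl
  set D := δ.1 l with hD
  obtain ⟨C, hC⟩ := δ.2.2.1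
  have h1 : ∀ n : ℕ, δ.1 (powFrom p l (n + 1)) = ((n : ℂ) + 1) • ((l : B) ^ n * D) := by
    intro n
    induction n with
    | zero =>
      rw [powFrom, derivation_mul, powFrom, hp, ← hD, mul_zero, add_zero]
      simpa using hDP
    | succ n ih =>
      rw [powFrom, derivation_mul, ih, coe_powFrom, ← hD, ← mul_assoc,
        ((show Commute D (l : B) from hc).pow_right (n + 1)).eq, mul_assoc, hDP, mul_smul_comm,
        ← mul_assoc, ← pow_succ']
      push_cast
      module
  have h2 : ∀ n : ℕ, (p : B) * ((l : B) ^ n * D) = (l : B) ^ n * D := by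
    intro n
    cases n with
    | zero => simpa using hPD
    | succ n => rw [pow_succ', ← mul_assoc, ← mul_assoc, hpl']
  have h4 : ∀ n : ℕ, ‖D‖ ≤ ‖(l : B) ^ n * D‖ := by
    intro n
    induction n with
    | zero => simp
    | succ n ih =>
      calc ‖D‖ ≤ ‖(l : B) ^ n * D‖ := ih
        _ = ‖S * ((l : B) ^ (n + 1) * D)‖ := by
          rw [pow_succ' (l : B), mul_assoc (l : B), ← mul_assoc S, hS, h2]
        _ ≤ ‖S‖ * ‖(l : B) ^ (n + 1) * D‖ := norm_mul_le _ _
        _ ≤ ‖(l : B) ^ (n + 1) * D‖ := mul_le_of_le_one_left (norm_nonneg _) hS1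
  have h5 : ∀ n : ℕ, ((n : ℝ) + 1) * ‖D‖ ≤ |C| := by
    intro n
    have h6 := hC (powFrom p l (n + 1))
    rw [h1, norm_smul] at h6
    have h7 : ‖(n : ℂ) + 1‖ = (n : ℝ) + 1 := by exact_mod_cast Complex.norm_natCast (n + 1)
    rw [h7] at h6
    calc ((n : ℝ) + 1) * ‖D‖ ≤ ((n : ℝ) + 1) * ‖(l : B) ^ n * D‖ :=
          mul_le_mul_of_nonneg_left (h4 n) (by positivity)
      _ ≤ C * ‖(powFrom p l (n + 1) : B)‖ := h6
      _ ≤ |C| * 1 := mul_le_mul (le_abs_self C) (norm_powFrom_le hp1 hl1 _) (norm_nonneg _)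
          (abs_nonneg C)
      _ = |C| := mul_one _
  by_contra hne
  have hpos : 0 < ‖D‖ := norm_pos_iff.2 hne
  obtain ⟨n, hn⟩ := exists_nat_gt (|C| / ‖D‖)
  rw [div_lt_iff₀ hpos] at hn
  have := h5 n
  linarith

/-- Put x = δ(p). The Leibniz rule for p = p² and triangularity force x = p x q, so the inner
derivation of x takes the value x at p and -x at q. It vanishes at f because f lies in the same
off-diagonal corner. -/
theorem exists_derivation_eq_zero_of_triangular (hAX : A ≤ X) (δ : boundedDerivations A X)
    {p q f : A} (hpp : p * p = p) (hqp : q * p = 0) (hsum : (p : B) + q = 1)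
    (htri : ∀ T ∈ X, (q : B) * T * p = 0) (hfp : f * p = 0) (hqf : q * f = 0) :
    ∃ δ' : boundedDerivations A X, δ'.1 p = 0 ∧ δ'.1 q = 0 ∧ δ - δ' ∈ innerDerivations A X ∧
      δ'.1 f = δ.1 f := by
  have hpp' : (p : B) * p = p := congrArg Subtype.val hpp
  have hqp' : (q : B) * p = 0 := congrArg Subtype.val hqp
  have hqf' : (q : B) * f = 0 := congrArg Subtype.val hqf
  have hfp' : (f : B) * p = 0 := congrArg Subtype.val hfp
  set x := δ.1 p with hx
  have hxX : x ∈ X := δ.2.1 _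
  have hxe : x = x * p + p * x := by
    have h := derivation_mul δ p p
    rwa [hpp] at h
  have hxp : x * p = 0 := by
    have h1 : (p : B) * x * p = 0 := by
      -- Compressing x = x p + p x by p on both sides gives p x p = 2 p x p.
      have h := congrArg (fun b => (p : B) * b * p) hxe
      simp only [mul_add, add_mul] at h
      rw [← mul_assoc (p : B) x p, mul_assoc ((p : B) * x) p p, hpp', ← mul_assoc (p : B) p x,
        hpp'] at h
      simpa using h
    calc x * p = ((p : B) + q) * (x * p) := by rw [hsum, one_mul]
      _ = p * x * p + q * x * p := by rw [add_mul, mul_assoc, mul_assoc]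
      _ = 0 := by rw [h1, htri x hxX, add_zero]
  have hpx : p * x = x := by rw [hxp, zero_add] at hxe; exact hxe.symm
  have hqx : q * x = 0 := by rw [← hpx, ← mul_assoc, hqp', zero_mul]
  have hxq : x * q = x := by
    calc x * q = x * (p + q) := by rw [mul_add, hxp, zero_add]
      _ = x := by rw [hsum, mul_one]
  -- A derivation kills the idempotent 1 = p + q.
  have hxy : x + δ.1 q = 0 := by
    have h := derivation_mul δ (p + q) (p + q)
    have hu : ((p + q : A) : B) = 1 := hsum
    have huu : (p + q) * (p + q) = p + q :=
      Subtype.ext (by rw [NonUnitalSubalgebra.coe_mul, hu, one_mul])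
    rw [huu, hu, one_mul, mul_one, map_add] at h
    simpa using h
  refine ⟨δ - commutatorDerivation x (commutator_mem hAX hxX), ?_, ?_, ?_, ?_⟩
  · change x - ((p : B) * x - x * p) = 0
    rw [hpx, hxp, sub_zero, sub_self]
  · change δ.1 q - ((q : B) * x - x * q) = 0
    rw [hqx, hxq, zero_sub, sub_neg_eq_add, add_comm, hxy]
  · rw [sub_sub_cancel]
    exact commutatorDerivation_mem_innerDerivations hAX hxX
  · change δ.1 f - ((f : B) * x - x * f) = _
    have h1 : (f : B) * x = 0 := by rw [← hpx, ← mul_assoc, hfp', zero_mul]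
    have h2 : x * f = 0 := by rw [← hxq, mul_assoc, hqf', mul_zero]
    rw [h1, h2, sub_zero, sub_zero]

end Derivations

/-! ### Normalizing a derivation by an inner one. -/

namespace TwoLoopGraph

/-- The derivation vanishes on the vertex operators and on both loops. -/
structure IsNormalized (δ : Der) : Prop where
  v₁ : δ.1 (vertexElt Vertex.v₁) = 0
  v₂ : δ.1 (vertexElt Vertex.v₂) = 0
  e₁ : δ.1 (edgeElt e₁) = 0
  e₂ : δ.1 (edgeElt e₂) = 0

/-- Vanishing at the vertices confines the value at each loop to the corner of that vertex, where
elements of 𝔏_G commute with the loop. -/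
theorem isNormalized_of_vertices {δ : Der} (h₁ : δ.1 (vertexElt Vertex.v₁) = 0)
    (h₂ : δ.1 (vertexElt Vertex.v₂) = 0) : IsNormalized δ := by
  obtain ⟨S₁, hS₁, hS₁'⟩ := exists_mul_edgeOp_eq_vertexOp e₁
  obtain ⟨S₂, hS₂, hS₂'⟩ := exists_mul_edgeOp_eq_vertexOp e₂
  have hl₁ : vertexElt Vertex.v₁ * edgeElt e₁ = edgeElt e₁ := Subtype.ext (vertexOp_mul_edgeOp e₁)
  have hr₁ : edgeElt e₁ * vertexElt Vertex.v₁ = edgeElt e₁ := Subtype.ext (edgeOp_mul_vertexOp e₁)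
  have hl₂ : vertexElt Vertex.v₂ * edgeElt e₂ = edgeElt e₂ := Subtype.ext (vertexOp_mul_edgeOp e₂)
  have hr₂ : edgeElt e₂ * vertexElt Vertex.v₂ = edgeElt e₂ := Subtype.ext (edgeOp_mul_vertexOp e₂)
  refine ⟨h₁, h₂, derivation_eq_zero_of_commute h₁ hl₁ hr₁ (norm_vertexOp_le _) (norm_edgeOp_le _)
    hS₁ hS₁' ?_, derivation_eq_zero_of_commute h₂ hl₂ hr₂ (norm_vertexOp_le _) (norm_edgeOp_le _)
    hS₂ hS₂' ?_⟩
  · have h := (triangular_of_mem (δ.2.1 (edgeElt e₁))).2.1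
    have h3 : vertexOp .v₁ * δ.1 (edgeElt e₁) = _ := mul_derivation_of_eq_zero h₁ hl₁
    have h4 : δ.1 (edgeElt e₁) * vertexOp .v₁ = _ := derivation_mul_of_eq_zero h₁ hr₁
    rwa [h3, h4] at h
  · have h := (triangular_of_mem (δ.2.1 (edgeElt e₂))).2.2
    have h3 : vertexOp .v₂ * δ.1 (edgeElt e₂) = _ := mul_derivation_of_eq_zero h₂ hl₂
    have h4 : δ.1 (edgeElt e₂) * vertexOp .v₂ = _ := derivation_mul_of_eq_zero h₂ hr₂
    rwa [h3, h4] at h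

theorem exists_isNormalized (δ : Der) :
    ∃ δ' : Der, IsNormalized δ' ∧
      δ - δ' ∈ innerDerivations (tensorAlg Vertex) (freeSemigroupoidAlg Vertex) ∧
      δ'.1 (edgeElt e) = δ.1 (edgeElt e) := by
  have hpp : vertexElt Vertex.v₁ * vertexElt Vertex.v₁ = vertexElt Vertex.v₁ :=
    Subtype.ext (vertexOp_mul_self _)
  have hqp : vertexElt Vertex.v₂ * vertexElt Vertex.v₁ = 0 :=
    Subtype.ext (vertexOp_mul_vertexOp (by simp))
  have hfp : edgeElt e * vertexElt Vertex.v₁ = 0 :=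
    Subtype.ext (edgeOp_mul_vertexOp_of_ne e (by simp))
  have hqf : vertexElt Vertex.v₂ * edgeElt e = 0 :=
    Subtype.ext (vertexOp_mul_edgeOp_of_ne e (by simp))
  have hsum : ((vertexElt Vertex.v₁ : tensorAlg Vertex) : PathHilbert Vertex →L[ℂ] PathHilbert Vertex)
      + vertexElt Vertex.v₂ = 1 := vertexOp_add_vertexOp
  have htri : ∀ T ∈ freeSemigroupoidAlg Vertex,
      (vertexElt Vertex.v₂ : PathHilbert Vertex →L[ℂ] PathHilbert Vertex) * T *
        vertexElt Vertex.v₁ = 0 := fun T hT => (triangular_of_mem hT).1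
  have key := exists_derivation_eq_zero_of_triangular
    (tensorAlg_le_freeSemigroupoidAlg Vertex) δ hpp hqp hsum htri hfp hqf
  obtain ⟨δ', h⟩ := key
  refine ⟨δ', ?_⟩
  have h5 : IsNormalized δ' := isNormalized_of_vertices h.1 h.2.1
  exact ⟨h5, h.2.2⟩

end TwoLoopGraph

/-! ### The supremum bound for the symbol. -/

theorem orthogonalFamily_mapIsometry {ι κ P : Type*} {f : κ → ι → P}
    (hf : ∀ j, Function.Injective (f j)) (h : ∀ i j, i ≠ j → ∀ a b, f i a ≠ f j b) :
    OrthogonalFamily ℂ (fun _ : κ => EllTwo ι) fun j => EllTwo.mapIsometry (f j) (hf j) := by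
  intro i j hij v w
  have h0 : ∀ p, inner ℂ (EllTwo.mapIsometry (f i) (hf i) v p)
      (EllTwo.mapIsometry (f j) (hf j) w p) = 0 := by
    intro p
    by_cases hp : p ∈ Set.range (f i)
    · obtain ⟨a, rfl⟩ := hp
      rw [EllTwo.mapIsometry_apply_of_notMem (hf j) w fun ⟨b, hb⟩ => h i j hij a b hb.symm,
        inner_zero_right]
    · rw [EllTwo.mapIsometry_apply_of_notMem (hf i) v hp, inner_zero_left]
  change inner ℂ (EllTwo.mapIsometry (f i) (hf i) v) (EllTwo.mapIsometry (f j) (hf j) w) = 0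
  rw [lp.inner_eq_tsum, tsum_congr h0, tsum_zero]

theorem norm_sum_smul_derivation_le {B : Type*} [NormedRing B] [NormedAlgebra ℂ B]
    {A X : NonUnitalSubalgebra ℂ B} {δ : boundedDerivations A X} {C : ℝ}
    (hC : ∀ a : A, ‖δ.1 a‖ ≤ C * ‖(a : B)‖) (a : ℕ → ℂ) (E : ℕ → A) (s : Finset ℕ) :
    ‖∑ m ∈ s, a m • δ.1 (E m)‖ ≤ C * ‖∑ m ∈ s, a m • (E m : B)‖ := by
  have h1 : δ.1 (∑ m ∈ s, a m • E m) = ∑ m ∈ s, a m • δ.1 (E m) := by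
    simp only [map_sum, map_smul]
  have h2 : ((∑ m ∈ s, a m • E m : A) : B) = ∑ m ∈ s, a m • (E m : B) :=
    map_sum (NonUnitalSubalgebraClass.subtype A) (fun m => a m • E m) s
  rw [← h1, ← h2]
  exact hC _

theorem derivation_powFrom_mul {B : Type*} [NormedRing B] [NormedAlgebra ℂ B]
    {A X : NonUnitalSubalgebra ℂ B} {δ : boundedDerivations A X} {p l f : A} (hp : δ.1 p = 0)
    (hl : δ.1 l = 0) (hpf : p * f = f) (n : ℕ) :
    δ.1 (powFrom p l n * f) = (l : B) ^ n * δ.1 f := by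
  rw [derivation_mul, derivation_powFrom hp hl, zero_mul, zero_add, coe_powFrom, mul_assoc,
    mul_derivation_of_eq_zero hp hpf]

theorem coe_powFrom_mul {B : Type*} [NormedRing B] [NormedAlgebra ℂ B]
    {A : NonUnitalSubalgebra ℂ B} {p l f : A} (hpf : p * f = f) (n : ℕ) :
    ((powFrom p l n * f : A) : B) = (l : B) ^ n * f := by
  rw [NonUnitalSubalgebra.coe_mul, coe_powFrom, mul_assoc, ← NonUnitalSubalgebra.coe_mul, hpf]

namespace TwoLoopGraph

open EllTwo FreeSemigroupoid

theorem crossPath_mk_injective (m : ℕ) : Function.Injective fun n => crossPath (m, n) :=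
  crossPath_injective.comp (Prod.mk_right_injective m)

theorem edgeOp_e₁_pow_crossPath (j : ℕ) (k : ℕ × ℕ) :
    (edgeOp e₁ ^ j) (ξ (crossPath k)) = ξ (crossPath (k.1 + j, k.2)) := by
  induction j with
  | zero => rfl
  | succ j ih =>
    rw [pow_succ', mul_apply_eq_comp, ih, edgeOp_e₁_crossPath]
    rfl

theorem edgeOp_e₁_pow_mul_edgeOp_e (m : ℕ) :
    edgeOp e₁ ^ m * edgeOp e =
      transfer (fun n => crossPath (m, n)) loopPath₂ (crossPath_mk_injective m)
        loopPath₂_injective := by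
  refine ext_paths (fun j => ?_) (fun j => ?_) fun k => ?_
  · rw [mul_apply_eq_comp, edgeOp_e_loopPath₁, map_zero,
      transfer_ξ_of_notMem _ _ fun ⟨n, h⟩ => loopPath₁_ne_loopPath₂ j n h.symm]
  · rw [mul_apply_eq_comp, edgeOp_e_loopPath₂, edgeOp_e₁_pow_crossPath,
      transfer_ξ (crossPath_mk_injective m), zero_add]
  · rw [mul_apply_eq_comp, edgeOp_e_crossPath, map_zero,
      transfer_ξ_of_notMem _ _ fun ⟨n, h⟩ => loopPath₂_ne_crossPath n k h]

/-- The operators L_{e₁}^m L_e have mutually orthogonal ranges for different m, so Pythagoras bounds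
the combination by the ℓ² norm of its coefficients, rather than the ℓ¹ norm. -/
theorem norm_sum_smul_edgeOp_sq_le (a : ℕ → ℂ) (s : Finset ℕ) :
    ‖∑ m ∈ s, a m • (edgeOp e₁ ^ m * edgeOp e)‖ ^ 2 ≤ ∑ m ∈ s, ‖a m‖ ^ 2 := by
  have h0 : 0 ≤ ∑ m ∈ s, ‖a m‖ ^ 2 := Finset.sum_nonneg fun _ _ => sq_nonneg _
  rw [← Real.le_sqrt (norm_nonneg _) h0]
  refine ContinuousLinearMap.opNorm_le_bound _ (Real.sqrt_nonneg _) fun x => ?_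
  rw [← abs_of_nonneg (norm_nonneg x), ← Real.sqrt_sq_eq_abs, ← Real.sqrt_mul h0]
  refine Real.le_sqrt_of_sq_le ?_
  have hV := orthogonalFamily_mapIsometry (f := fun m n : ℕ => crossPath (m, n))
    crossPath_mk_injective fun i j hij a b h => hij (congrArg Prod.fst (crossPath_injective h))
  set y := ContinuousLinearMap.adjoint
    (mapIsometry loopPath₂ loopPath₂_injective).toContinuousLinearMap x with hy
  have hyx : ‖y‖ ≤ ‖x‖ := by
    refine (ContinuousLinearMap.le_opNorm _ _).trans (mul_le_of_le_one_left (norm_nonneg _) ?_)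
    rw [LinearIsometryEquiv.norm_map]
    exact LinearIsometry.norm_toContinuousLinearMap_le _
  have hx : (∑ m ∈ s, a m • (edgeOp e₁ ^ m * edgeOp e)) x =
      ∑ m ∈ s, mapIsometry (fun n => crossPath (m, n)) (crossPath_mk_injective m) (a m • y) := by
    rw [sum_apply]
    refine Finset.sum_congr rfl fun m _ => ?_
    rw [edgeOp_e₁_pow_mul_edgeOp_e, map_smul]
    rfl
  rw [hx, hV.norm_sum (fun m => a m • y) s, Finset.sum_mul]
  refine Finset.sum_le_sum fun m _ => ?_
  rw [norm_smul, mul_pow]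
  gcongr

theorem norm_sum_smul_loopPath₂_sq (a : ℕ → ℂ) (s : Finset ℕ) :
    ‖∑ n ∈ s, a n • ξ (loopPath₂ n)‖ ^ 2 = ∑ n ∈ s, ‖a n‖ ^ 2 := by
  have h := ((orthonormal_ξ (FreeSemigroupoid Vertex)).comp loopPath₂
    loopPath₂_injective).orthogonalFamily.norm_sum a s
  simpa using h

/-- Evaluation at a point `(z, w)` of the bidisc of the power series given by the coordinates along
the paths from `v₂` to `v₁`. -/
theorem exists_evaluation {z w : ℂ} (hz : z ∈ Metric.ball (0 : ℂ) 1)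
    (hw : w ∈ Metric.ball (0 : ℂ) 1) :
    ∃ ε : PathHilbert Vertex →L[ℂ] ℂ, ‖ε‖ ^ 2 ≤ (1 - ‖w‖ ^ 2)⁻¹ * (1 - ‖z‖ ^ 2)⁻¹ ∧
      (∀ x, HasSum (fun k : ℕ × ℕ => x (crossPath k) * z ^ k.2 * w ^ k.1) (ε x)) ∧
      (∀ x, ε (edgeOp e₁ x) = w * ε x) ∧ ∀ x, ε (rightE₂ x) = z * ε x := by
  rw [mem_ball_zero_iff] at hz hw
  have hz2 : ‖z‖ ^ 2 < 1 := pow_lt_one₀ (norm_nonneg _) hz two_ne_zero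
  have hw2 : ‖w‖ ^ 2 < 1 := pow_lt_one₀ (norm_nonneg _) hw two_ne_zero
  have hsum : HasSum (fun k : ℕ × ℕ => ‖w ^ k.1 * z ^ k.2‖ ^ 2)
      ((1 - ‖w‖ ^ 2)⁻¹ * (1 - ‖z‖ ^ 2)⁻¹) := by
    have h1 := hasSum_geometric_of_lt_one (sq_nonneg ‖w‖) hw2
    have h2 := hasSum_geometric_of_lt_one (sq_nonneg ‖z‖) hz2
    have h3 := h1.mul h2 (h1.summable.mul_of_nonneg h2.summable
      (fun _ => by positivity) fun _ => by positivity)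
    refine h3.congr_term fun k => ?_
    rw [norm_mul, norm_pow, norm_pow, mul_pow, ← pow_mul, ← pow_mul, ← pow_mul, ← pow_mul,
      mul_comm k.1, mul_comm k.2]
  have hmem : Memℓp (fun k : ℕ × ℕ => (starRingEnd ℂ) (w ^ k.1 * z ^ k.2)) 2 := by
    refine memℓp_gen ?_
    simpa using hsum.summable
  -- The Szegő kernel vector; its coordinates are conjugated so that pairing with it,
  -- conjugate-linear in the first variable, evaluates the power series.
  set κ : EllTwo (ℕ × ℕ) := ⟨_, hmem⟩ with hκ
  have hκa : ∀ k : ℕ × ℕ, κ k = (starRingEnd ℂ) (w ^ k.1 * z ^ k.2) := fun _ => rfl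
  have hκn : ‖κ‖ ^ 2 = (1 - ‖w‖ ^ 2)⁻¹ * (1 - ‖z‖ ^ 2)⁻¹ := by
    have h := lp.norm_rpow_eq_tsum (p := 2) (by simp) κ
    simp only [ENNReal.toReal_ofNat, Real.rpow_two, hκa, RCLike.norm_conj] at h
    rw [h, hsum.tsum_eq]
  have hξ : ∀ k, inner ℂ κ (ξ k) = w ^ k.1 * z ^ k.2 := by
    intro k
    rw [← inner_conj_symm, inner_ξ_left, hκa, RCLike.conj_conj]
  refine ⟨innerSL ℂ κ ∘L toCross, ?_, fun x => ?_, fun x => ?_, fun x => ?_⟩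
  · rw [← hκn]
    have h : ‖innerSL ℂ κ ∘L toCross‖ ≤ ‖κ‖ := by
      refine (ContinuousLinearMap.opNorm_comp_le _ _).trans ?_
      rw [innerSL_apply_norm]
      exact mul_le_of_le_one_right (norm_nonneg _) (norm_transfer_le _ _)
    gcongr
  · refine (lp.hasSum_inner (𝕜 := ℂ) κ (toCross x)).congr_term fun k => ?_
    have h : toCross x k = x (crossPath k) :=
      transfer_apply Function.injective_id crossPath_injective x k
    rw [h, hκa, RCLike.inner_apply, RCLike.conj_conj]
    ring
  · have h : (innerSL ℂ κ ∘L toCross) ∘L edgeOp e₁ = w • (innerSL ℂ κ ∘L toCross) :=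
      ext_paths (fun m => by simp) (fun n => by simp) fun k => by
        simp [hξ, pow_succ]; ring
    exact DFunLike.congr_fun h x
  · have h : (innerSL ℂ κ ∘L toCross) ∘L rightE₂ = z • (innerSL ℂ κ ∘L toCross) :=
      ext_paths (fun m => by simp) (fun n => by simp) fun k => by
        simp [hξ, pow_succ]; ring
    exact DFunLike.congr_fun h x

theorem geometric_conj {z : ℂ} (N : ℕ) :
    ∑ n ∈ Finset.range N, (starRingEnd ℂ) z ^ n * z ^ n =
      ((∑ n ∈ Finset.range N, (‖z‖ ^ 2) ^ n : ℝ) : ℂ) := by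
  push_cast
  refine Finset.sum_congr rfl fun n _ => ?_
  rw [← mul_pow, Complex.conj_mul']

/-- Evaluation ε turns L_{e₁} into w and right multiplication by e₂ into z. With conjugate
coefficients, ε(Q y) = a b g for the partial sums a, b of the geometric series in |w|² and |z|². The
norms of Q, y and ε contribute C√a, √b and at most the square root of the limit of a b; letting N
grow leaves exactly |g| ≤ C. -/
theorem norm_tsum_le_of_mul_rightE₂ {T : PathHilbert Vertex →L[ℂ] PathHilbert Vertex}
    (hcomm : T * rightE₂ = rightE₂ * T) {C : ℝ} (hC0 : 0 ≤ C)
    (hC : ∀ (a : ℕ → ℂ) (s : Finset ℕ), ‖∑ m ∈ s, a m • (edgeOp e₁ ^ m * T)‖ ≤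
      C * ‖∑ m ∈ s, a m • (edgeOp e₁ ^ m * edgeOp e)‖)
    {z w : ℂ} (hz : z ∈ Metric.ball (0 : ℂ) 1) (hw : w ∈ Metric.ball (0 : ℂ) 1) :
    ‖∑' k : ℕ × ℕ, T (ξ (loopPath₂ 0)) (crossPath k) * z ^ k.2 * w ^ k.1‖ ≤ C := by
  obtain ⟨ε, hε, hεs, hε₁, hε₂⟩ := exists_evaluation hz hw
  rw [(hεs (T (ξ (loopPath₂ 0)))).tsum_eq]
  set g := ε (T (ξ (loopPath₂ 0))) with hg
  have hz' : ∀ n, ε (T (ξ (loopPath₂ n))) = z ^ n * g := by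
    intro n
    induction n with
    | zero => rw [pow_zero, one_mul]
    | succ n ih =>
      have h : T (rightE₂ (ξ (loopPath₂ n))) = rightE₂ (T (ξ (loopPath₂ n))) :=
        DFunLike.congr_fun hcomm _
      rw [← rightE₂_loopPath₂, h, hε₂, ih, pow_succ']
      ring
  have hw' : ∀ m x, ε ((edgeOp e₁ ^ m) x) = w ^ m * ε x := by
    intro m
    induction m with
    | zero => intro x; rw [pow_zero, pow_zero, one_mul]; rfl
    | succ m ih =>
      intro x
      rw [pow_succ', mul_apply_eq_comp, hε₁, ih, pow_succ']
      ring
  have key : ∀ N : ℕ, (∑ m ∈ Finset.range N, (‖w‖ ^ 2) ^ m) * (∑ n ∈ Finset.range N, (‖z‖ ^ 2) ^ n)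
      * ‖g‖ ^ 2 ≤ (1 - ‖w‖ ^ 2)⁻¹ * (1 - ‖z‖ ^ 2)⁻¹ * C ^ 2 := by
    intro N
    set a := ∑ m ∈ Finset.range N, (‖w‖ ^ 2) ^ m with ha
    set b := ∑ n ∈ Finset.range N, (‖z‖ ^ 2) ^ n with hb
    have ha0 : 0 ≤ a := Finset.sum_nonneg fun _ _ => by positivity
    have hb0 : 0 ≤ b := Finset.sum_nonneg fun _ _ => by positivity
    set Q := ∑ m ∈ Finset.range N, (starRingEnd ℂ) w ^ m • (edgeOp e₁ ^ m * T) with hQ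
    set y := ∑ n ∈ Finset.range N, (starRingEnd ℂ) z ^ n • ξ (loopPath₂ n) with hy
    have hQn : ‖Q‖ ^ 2 ≤ C ^ 2 * a := by
      have h1 := hC (fun m => (starRingEnd ℂ) w ^ m) (Finset.range N)
      have h2 := norm_sum_smul_edgeOp_sq_le (fun m => (starRingEnd ℂ) w ^ m) (Finset.range N)
      have h3 : ∑ m ∈ Finset.range N, ‖(starRingEnd ℂ) w ^ m‖ ^ 2 = a :=
        Finset.sum_congr rfl fun m _ => by
          rw [norm_pow, RCLike.norm_conj, ← pow_mul, ← pow_mul, mul_comm]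
      rw [h3] at h2
      calc ‖Q‖ ^ 2 ≤ (C * _) ^ 2 := pow_le_pow_left₀ (norm_nonneg _) h1 2
        _ = C ^ 2 * _ := mul_pow _ _ _
        _ ≤ C ^ 2 * a := mul_le_mul_of_nonneg_left h2 (sq_nonneg _)
    have hyn : ‖y‖ ^ 2 = b := by
      rw [hy, norm_sum_smul_loopPath₂_sq (fun n => (starRingEnd ℂ) z ^ n)]
      exact Finset.sum_congr rfl fun m _ => by
        rw [norm_pow, RCLike.norm_conj, ← pow_mul, ← pow_mul, mul_comm]
    have hval : ε (Q y) = (a : ℂ) * (b * g) := by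
      have h1 : ε (T y) = b * g := by
        rw [hy, map_sum, map_sum, hb, ← geometric_conj, Finset.sum_mul]
        refine Finset.sum_congr rfl fun n _ => ?_
        rw [map_smul, map_smul, hz', smul_eq_mul, mul_assoc]
      rw [hQ, sum_apply, map_sum, ha, ← geometric_conj, Finset.sum_mul]
      refine Finset.sum_congr rfl fun m _ => ?_
      rw [smul_apply, map_smul, mul_apply_eq_comp, hw', h1, smul_eq_mul, mul_assoc]
    have hle : ‖ε (Q y)‖ ≤ ‖ε‖ * (‖Q‖ * ‖y‖) :=
      (ε.le_opNorm _).trans (mul_le_mul_of_nonneg_left (Q.le_opNorm y) (norm_nonneg _))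
    have hab : (a * b) * (a * b * ‖g‖ ^ 2) ≤
        (a * b) * ((1 - ‖w‖ ^ 2)⁻¹ * (1 - ‖z‖ ^ 2)⁻¹ * C ^ 2) := by
      have h1 : ‖ε (Q y)‖ = a * (b * ‖g‖) := by
        rw [hval, norm_mul, norm_mul, Complex.norm_of_nonneg ha0, Complex.norm_of_nonneg hb0]
      rw [h1] at hle
      calc (a * b) * (a * b * ‖g‖ ^ 2) = (a * (b * ‖g‖)) ^ 2 := by ring
        _ ≤ (‖ε‖ * (‖Q‖ * ‖y‖)) ^ 2 := pow_le_pow_left₀ (by positivity) hle 2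
        _ = ‖ε‖ ^ 2 * (‖Q‖ ^ 2 * ‖y‖ ^ 2) := by ring
        _ ≤ ((1 - ‖w‖ ^ 2)⁻¹ * (1 - ‖z‖ ^ 2)⁻¹) * ((C ^ 2 * a) * b) := by
          rw [hyn]
          exact mul_le_mul hε (mul_le_mul_of_nonneg_right hQn hb0) (by positivity)
            ((sq_nonneg _).trans hε)
        _ = _ := by ring
    -- The factor a b is cancelled; it is zero when N = 0, where the sums are empty.
    rcases (mul_nonneg ha0 hb0).eq_or_lt with h0 | h0
    · rw [← h0, zero_mul]
      exact mul_nonneg ((sq_nonneg _).trans hε) (sq_nonneg _)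
    · exact le_of_mul_le_mul_left hab h0
  rw [mem_ball_zero_iff] at hz hw
  have hz2 : ‖z‖ ^ 2 < 1 := pow_lt_one₀ (norm_nonneg _) hz two_ne_zero
  have hw2 : ‖w‖ ^ 2 < 1 := pow_lt_one₀ (norm_nonneg _) hw two_ne_zero
  have hlim := (((hasSum_geometric_of_lt_one (sq_nonneg ‖w‖) hw2).tendsto_sum_nat.mul
    (hasSum_geometric_of_lt_one (sq_nonneg ‖z‖) hz2).tendsto_sum_nat).mul_const (‖g‖ ^ 2))
  have hfin := le_of_tendsto' hlim key
  have hpos : 0 < (1 - ‖w‖ ^ 2)⁻¹ * (1 - ‖z‖ ^ 2)⁻¹ :=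
    mul_pos (inv_pos.2 (sub_pos.2 hw2)) (inv_pos.2 (sub_pos.2 hz2))
  exact (pow_le_pow_iff_left₀ (norm_nonneg _) hC0 two_ne_zero).1 (le_of_mul_le_mul_left hfin hpos)

theorem norm_tsum_le_of_isNormalized {δ : Der} (hδ : IsNormalized δ) {C : ℝ} (hC0 : 0 ≤ C)
    (hC : ∀ a : tensorAlg Vertex,
      ‖δ.1 a‖ ≤ C * ‖(a : PathHilbert Vertex →L[ℂ] PathHilbert Vertex)‖)
    {z w : ℂ} (hz : z ∈ Metric.ball (0 : ℂ) 1) (hw : w ∈ Metric.ball (0 : ℂ) 1) :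
    ‖∑' k : ℕ × ℕ, δ.1 (edgeElt e) (ξ (loopPath₂ 0)) (crossPath k) * z ^ k.2 * w ^ k.1‖ ≤ C := by
  have hv : vertexElt Vertex.v₁ * edgeElt e = edgeElt e := Subtype.ext (vertexOp_mul_edgeOp e)
  refine norm_tsum_le_of_mul_rightE₂ (mul_rightE₂ (δ.2.1 (edgeElt e))) hC0 (fun a s => ?_) hz hw
  have h1 := norm_sum_smul_derivation_le hC a
    (fun m => powFrom (vertexElt Vertex.v₁) (edgeElt e₁) m * edgeElt e) s
  have h2 : ∀ m, δ.1 (powFrom (vertexElt Vertex.v₁) (edgeElt e₁) m * edgeElt e) =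
    edgeOp e₁ ^ m * δ.1 (edgeElt e) := derivation_powFrom_mul hδ.v₁ hδ.e₁ hv
  have h3 : ∀ m, ((powFrom (vertexElt Vertex.v₁) (edgeElt e₁) m * edgeElt e : tensorAlg Vertex) :
    PathHilbert Vertex →L[ℂ] PathHilbert Vertex) = edgeOp e₁ ^ m * edgeOp e := coe_powFrom_mul hv
  rw [Finset.sum_congr rfl fun m _ => congrArg (a m • ·) (h2 m),
    Finset.sum_congr rfl fun m _ => congrArg (a m • ·) (h3 m)] at h1
  exact h1

end TwoLoopGraph

/-- Evaluation of derivations at `a`. -/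
noncomputable def derivationEval {B : Type*} [NormedRing B] [NormedAlgebra ℂ B] {A X : NonUnitalSubalgebra ℂ B}
    (a : A) : boundedDerivations A X →ₗ[ℂ] B :=
  LinearMap.applyₗ a ∘ₗ (boundedDerivations A X).subtype

theorem derivation_norm_le {B : Type*} [NormedRing B] [NormedAlgebra ℂ B]
    {A X : NonUnitalSubalgebra ℂ B} (δ : boundedDerivations A X) :
    ∃ C, 0 ≤ C ∧ ∀ a : A, ‖δ.1 a‖ ≤ C * ‖(a : B)‖ := by
  obtain ⟨C, hC⟩ := δ.2.2.1
  exact ⟨|C|, abs_nonneg C, fun a =>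
    (hC a).trans (mul_le_mul_of_nonneg_right (le_abs_self C) (norm_nonneg _))⟩

/-! ### The symbol map on derivations. -/

namespace TwoLoopGraph

open EllTwo FreeSemigroupoid

theorem norm_apply_ξ_le {P Q : Type*} (T : EllTwo P →L[ℂ] EllTwo Q) (p : P) (q : Q) :
    ‖T (ξ p) q‖ ≤ ‖T‖ := by
  refine (lp.norm_apply_le_norm two_ne_zero _ _).trans ((T.le_opNorm _).trans ?_)
  rw [norm_ξ, mul_one]

/-- The power series with the coefficients `⟨T ξ_{v₂}, ξ_{e₁ ^ m e e₂ ^ n}⟩`. -/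
noncomputable def symbol :
    (PathHilbert Vertex →L[ℂ] PathHilbert Vertex) →ₗ[ℂ] (bidisc → ℂ) where
  toFun T p := ∑' k : ℕ × ℕ, T (ξ (loopPath₂ 0)) (crossPath k) * p.1.1 ^ k.2 * p.1.2 ^ k.1
  map_add' S T := by
    ext p
    have hs := summable_coeff_mul_pow (fun k => norm_apply_ξ_le S (loopPath₂ 0) (crossPath k))
      p.2.1 p.2.2
    have ht := summable_coeff_mul_pow (fun k => norm_apply_ξ_le T (loopPath₂ 0) (crossPath k))
      p.2.1 p.2.2
    rw [Pi.add_apply, ← hs.tsum_add ht]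
    refine tsum_congr fun k => ?_
    rw [add_apply, lp.coeFn_add, Pi.add_apply]
    ring
  map_smul' a T := by
    ext p
    rw [RingHom.id_apply, Pi.smul_apply, smul_eq_mul, ← tsum_mul_left]
    refine tsum_congr fun k => ?_
    rw [smul_apply, lp.coeFn_smul, Pi.smul_apply, smul_eq_mul]
    ring

theorem hasSum_symbol (T : PathHilbert Vertex →L[ℂ] PathHilbert Vertex) (p : bidisc) :
    HasSum (fun k : ℕ × ℕ => T (ξ (loopPath₂ 0)) (crossPath k) * p.1.1 ^ k.2 * p.1.2 ^ k.1)
      (symbol T p) :=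
  (summable_coeff_mul_pow (fun k => norm_apply_ξ_le T (loopPath₂ 0) (crossPath k))
      p.2.1 p.2.2).hasSum

-- Holomorphy needs only bounded coefficients. The bound comes from the normalized derivation, which
-- has the same value at `e` and hence the same symbol.
set_option maxHeartbeats 1000000 in
theorem symbol_mem (δ : Der) : symbol (δ.1 (edgeElt e)) ∈ HInfinity bidisc := by
  refine ⟨⟨_, differentiableOn_tsum_pow_pow fun k =>
    norm_apply_ξ_le (δ.1 (edgeElt e)) (loopPath₂ 0) (crossPath k), fun _ => rfl⟩, ?_⟩
  obtain ⟨δ', hδ', -, he⟩ := exists_isNormalized δ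
  obtain ⟨C, hC0, hC⟩ := derivation_norm_le δ'
  refine ⟨C, fun p => ?_⟩
  have h := norm_tsum_le_of_isNormalized hδ' hC0 hC p.2.1 p.2.2
  rw [he] at h
  exact h

/-- The bounded holomorphic function on the bidisc attached to a derivation. -/
noncomputable def derivationSymbol : Der →ₗ[ℂ] HInfinity bidisc :=
  LinearMap.codRestrict (HInfinity bidisc) (symbol ∘ₗ derivationEval (edgeElt e)) symbol_mem

theorem hasSum_derivationSymbol (δ : Der) (p : bidisc) :
    HasSum (fun k : ℕ × ℕ =>
      δ.1 (edgeElt e) (ξ (loopPath₂ 0)) (crossPath k) * p.1.1 ^ k.2 * p.1.2 ^ k.1)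
      ((derivationSymbol δ).1 p) :=
  hasSum_symbol (δ.1 (edgeElt e)) p

/-! ### Every bounded holomorphic function is a symbol -/

/-- Extending M by zero off the paths through `e` gives an operator that commutes with the vertices
and e₂ by its support, and with e₁ because M commutes with shifts. Nothing can precede it by L_e on
the left, since no path through `e` ends at v₂; only the other half of the last commutator survives,
whence the sign. -/
theorem commutator_cross_mem {M : EllTwo (ℕ × ℕ) →L[ℂ] EllTwo (ℕ × ℕ)}
    {c : ℕ × ℕ → ℂ} (hM : IsWeakSeries c M) :
    vertexOp .v₁ * (ofCross ∘L M ∘L toCross) - (ofCross ∘L M ∘L toCross) * vertexOp .v₁ = 0 ∧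
    vertexOp .v₂ * (ofCross ∘L M ∘L toCross) - (ofCross ∘L M ∘L toCross) * vertexOp .v₂ = 0 ∧
    edgeOp e₁ * (ofCross ∘L M ∘L toCross) - (ofCross ∘L M ∘L toCross) * edgeOp e₁ = 0 ∧
    edgeOp e₂ * (ofCross ∘L M ∘L toCross) - (ofCross ∘L M ∘L toCross) * edgeOp e₂ = 0 ∧
    edgeOp e * (ofCross ∘L M ∘L toCross) - (ofCross ∘L M ∘L toCross) * edgeOp e =
      -(ofCross ∘L M ∘L toLoop₂) := by
  have h₁ : vertexOp .v₁ ∘L ofCross = ofCross := ext_ξ fun k => by simp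
  have h₂ : vertexOp .v₂ ∘L ofCross = 0 := ext_ξ fun k => by simp
  have h₃ : edgeOp e₁ ∘L ofCross = ofCross ∘L shiftOp (1, 0) := ext_ξ fun k => by
    simp [shiftOp_ξ, Prod.add_def]
  have h₄ : edgeOp e₂ ∘L ofCross = 0 := ext_ξ fun k => by simp
  have h₅ : edgeOp e ∘L ofCross = 0 := ext_ξ fun k => by simp
  have k₁ : toCross ∘L vertexOp .v₁ = toCross :=
    ext_paths (fun m => by simp) (fun n => by simp) fun k => by simp
  have k₂ : toCross ∘L vertexOp .v₂ = 0 :=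
    ext_paths (fun m => by simp) (fun n => by simp) fun k => by simp
  have k₃ : toCross ∘L edgeOp e₁ = shiftOp (1, 0) ∘L toCross :=
    ext_paths (fun m => by simp) (fun n => by simp) fun k => by
    simp [shiftOp_ξ, Prod.add_def]
  have k₄ : toCross ∘L edgeOp e₂ = 0 :=
    ext_paths (fun m => by simp) (fun n => by simp) fun k => by simp
  have k₅ : toCross ∘L edgeOp e = toLoop₂ :=
    ext_paths (fun m => by simp) (fun n => by simp) fun k => by simp
  have hc := mul_shiftOp_comm_of_isWeakSeries hM (1, 0)
  refine ⟨?_, ?_, ?_, ?_, ?_⟩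
  · change vertexOp .v₁ ∘L ofCross ∘L M ∘L toCross - ofCross ∘L M ∘L toCross ∘L vertexOp .v₁ = 0
    rw [← ContinuousLinearMap.comp_assoc, h₁, k₁, sub_self]
  · change vertexOp .v₂ ∘L ofCross ∘L M ∘L toCross - ofCross ∘L M ∘L toCross ∘L vertexOp .v₂ = 0
    rw [← ContinuousLinearMap.comp_assoc, h₂, k₂]
    simp
  · change edgeOp e₁ ∘L ofCross ∘L M ∘L toCross - ofCross ∘L M ∘L toCross ∘L edgeOp e₁ = 0
    rw [← ContinuousLinearMap.comp_assoc, h₃, k₃, sub_eq_zero]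
    change ofCross ∘L (shiftOp (1, 0) * M) ∘L toCross = ofCross ∘L (M * shiftOp (1, 0)) ∘L toCross
    rw [hc]
  · change edgeOp e₂ ∘L ofCross ∘L M ∘L toCross - ofCross ∘L M ∘L toCross ∘L edgeOp e₂ = 0
    rw [← ContinuousLinearMap.comp_assoc, h₄, k₄]
    simp
  · change edgeOp e ∘L ofCross ∘L M ∘L toCross - ofCross ∘L M ∘L toCross ∘L edgeOp e = _
    rw [← ContinuousLinearMap.comp_assoc, h₅, k₅]
    simp

theorem cross_apply_ξ {M : EllTwo (ℕ × ℕ) →L[ℂ] EllTwo (ℕ × ℕ)} (k : ℕ × ℕ) :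
    (ofCross ∘L M ∘L toLoop₂) (ξ (loopPath₂ 0)) (crossPath k) = M (ξ 0) k := by
  have h : (ofCross ∘L M ∘L toLoop₂) (ξ (loopPath₂ 0)) = ofCross (M (ξ 0)) := by
    rw [ContinuousLinearMap.comp_apply, ContinuousLinearMap.comp_apply, toLoop₂_loopPath₂]
    rfl
  rw [h]
  exact transfer_apply crossPath_injective Function.injective_id _ k

/-- The derivation is implemented by an operator that need not lie in 𝔏_G. Its commutators do, as
may be checked on the generators; the minus sign makes the value at `e` equal to the multiplier
block itself. -/
theorem exists_derivation_of_isWeakSeries {c : ℕ × ℕ → ℂ}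
    {M : EllTwo (ℕ × ℕ) →L[ℂ] EllTwo (ℕ × ℕ)} (hM : IsWeakSeries c M) :
    ∃ δ : Der, IsNormalized δ ∧ δ.1 (edgeElt e) = ofCross ∘L M ∘L toLoop₂ := by
  obtain ⟨h₁, h₂, h₃, h₄, h₅⟩ := commutator_cross_mem hM
  set J := ofCross ∘L M ∘L toCross with hJ
  have hneg : ∀ a : PathHilbert Vertex →L[ℂ] PathHilbert Vertex,
      a * -J - -J * a = -(a * J - J * a) := fun a => by noncomm_ring
  have hT : ∀ a ∈ semigroupoidGenerators Vertex, a * -J - -J * a ∈ freeSemigroupoidAlg Vertex := by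
    intro a ha
    rw [hneg]
    refine mem_of_mem_generators (p := fun a => -(a * J - J * a) ∈ freeSemigroupoidAlg Vertex)
      ?_ ?_ ?_ ?_ ?_ ha
    · rw [h₁, neg_zero]; exact zero_mem _
    · rw [h₂, neg_zero]; exact zero_mem _
    · rw [h₃, neg_zero]; exact zero_mem _
    · rw [h₄, neg_zero]; exact zero_mem _
    · rw [h₅, neg_neg]; exact cross_mem_of_isWeakSeries hM
  have hX : IsClosed (freeSemigroupoidAlg Vertex :
      Set (PathHilbert Vertex →L[ℂ] PathHilbert Vertex)) := isClosed_coe_wotClosure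
  have hT' : ∀ a ∈ tensorAlg Vertex, a * -J - -J * a ∈ freeSemigroupoidAlg Vertex := fun a ha =>
    commutator_mem_of_mem_topologicalClosure hX pathOpAlgebra_le hT ha
  refine ⟨commutatorDerivation (-J) hT', ⟨?_, ?_, ?_, ?_⟩, ?_⟩
  · exact (hneg _).trans ((congrArg Neg.neg h₁).trans neg_zero)
  · exact (hneg _).trans ((congrArg Neg.neg h₂).trans neg_zero)
  · exact (hneg _).trans ((congrArg Neg.neg h₃).trans neg_zero)
  · exact (hneg _).trans ((congrArg Neg.neg h₄).trans neg_zero)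
  · exact (hneg _).trans ((congrArg Neg.neg h₅).trans (neg_neg _))

set_option maxHeartbeats 1000000 in
theorem exists_derivationSymbol_eq (g : HInfinity bidisc) :
    ∃ δ : Der, IsNormalized δ ∧ derivationSymbol δ = g := by
  obtain ⟨g, ⟨G, hG, hg⟩, C, hC⟩ := g
  have hC' : ∀ p ∈ bidisc, ‖G p‖ ≤ C := fun p hp => by rw [hg ⟨p, hp⟩]; exact hC _
  obtain ⟨c, -, hs⟩ := exists_hasSum_pow_pow_of_bounded hG hC'
  obtain ⟨M, hM, hMc⟩ := exists_multiplier (g := fun z w => G (z, w)) hs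
    fun z hz w hw => hC' (z, w) ⟨hz, hw⟩
  obtain ⟨δ, hδ, he⟩ := exists_derivation_of_isWeakSeries hM
  refine ⟨δ, hδ, Subtype.ext (funext fun p => ?_)⟩
  refine (hasSum_derivationSymbol δ p).unique ?_
  have h := hs p.1.1 p.2.1 p.1.2 p.2.2
  rw [show G (p.1.1, p.1.2) = g p from hg p] at h
  refine h.congr_term fun k => ?_
  rw [he, cross_apply_ξ, hMc]

end TwoLoopGraph

/-! ### Passing to quotients. -/

section Quotient

variable {R M N : Type*} [Ring R] [AddCommGroup M] [Module R M] [AddCommGroup N] [Module R N]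

theorem exists_quotient_linearEquiv {Γ : M →ₗ[R] N} (hΓ : Function.Surjective Γ)
    {p : Submodule R M} {q : Submodule R N} (h : ∀ x, Γ x ∈ q ↔ x ∈ p) :
    ∃ Φ : (M ⧸ p) ≃ₗ[R] (N ⧸ q), ∀ x, Φ (p.mkQ x) = Submodule.Quotient.mk (Γ x) := by
  have hle : p ≤ q.comap Γ := fun x hx => (h x).2 hx
  refine ⟨LinearEquiv.ofBijective (p.mapQ q Γ hle) ⟨?_, ?_⟩, fun x => rfl⟩
  · rw [← LinearMap.ker_eq_bot, eq_bot_iff]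
    intro x hx
    obtain ⟨x, rfl⟩ := p.mkQ_surjective x
    rw [LinearMap.mem_ker, Submodule.mkQ_apply, Submodule.mapQ_apply,
      Submodule.Quotient.mk_eq_zero, h] at hx
    rw [Submodule.mem_bot, Submodule.mkQ_apply, Submodule.Quotient.mk_eq_zero]
    exact hx
  · intro y
    obtain ⟨y, rfl⟩ := q.mkQ_surjective y
    obtain ⟨x, rfl⟩ := hΓ y
    exact ⟨p.mkQ x, rfl⟩

end Quotient

/-! ### Split functions in terms of power series -/

section Split

/-- The centre of the disc. -/
def discZero : unitDisc := ⟨0, Metric.mem_ball_self one_pos⟩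

/-- The point `(z, w)` of the bidisc. -/
def bidiscMk (z w : unitDisc) : bidisc := ⟨(z.1, w.1), z.2, w.2⟩

/-- The mixed difference at the origin kills both kinds of summands. When it vanishes, g is the sum
of g(z,0) - g(0,0) and g(0,w). -/
theorem mem_splitFunctions_iff (g : HInfinity bidisc) :
    g ∈ splitFunctions ↔ ∀ z w : unitDisc, g.1 (bidiscMk z w) - g.1 (bidiscMk z discZero) -
      g.1 (bidiscMk discZero w) + g.1 (bidiscMk discZero discZero) = 0 := by
  constructor
  · intro hg z w
    obtain ⟨_, ⟨f, rfl⟩, _, ⟨h, rfl⟩, rfl⟩ := Submodule.mem_sup.1 hg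
    change (f.1 z + h.1 w) - (f.1 z + h.1 discZero) - (f.1 discZero + h.1 w) +
      (f.1 discZero + h.1 discZero) = 0
    ring
  · intro hg
    obtain ⟨g, ⟨G, hG, hGg⟩, C, hC⟩ := g
    have hz : DifferentiableOn ℂ (fun z => G (z, 0)) unitDisc :=
      hG.comp (by fun_prop) fun z hz => ⟨hz, discZero.2⟩
    have hw : DifferentiableOn ℂ (fun w => G (0, w)) unitDisc :=
      hG.comp (by fun_prop) fun w hw => ⟨discZero.2, hw⟩
    refine Submodule.mem_sup.2 ⟨_, ⟨⟨fun z => g (bidiscMk z discZero) - g (bidiscMk discZero discZero),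
      ⟨fun z => G (z, 0) - G (0, 0), hz.sub_const _, fun z => ?_⟩, C + C, fun z => ?_⟩, rfl⟩,
      _, ⟨⟨fun w => g (bidiscMk discZero w), ⟨fun w => G (0, w), hw, fun w => ?_⟩, C, fun w => hC _⟩,
        rfl⟩, Subtype.ext (funext fun p => ?_)⟩
    · exact congrArg₂ (· - ·) (hGg (bidiscMk z discZero)) (hGg (bidiscMk discZero discZero))
    · exact (norm_sub_le _ _).trans (add_le_add (hC _) (hC _))
    · exact hGg (bidiscMk discZero w)
    · have h := hg ⟨p.1.1, p.2.1⟩ ⟨p.1.2, p.2.2⟩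
      have h' : bidiscMk ⟨p.1.1, p.2.1⟩ ⟨p.1.2, p.2.2⟩ = p := rfl
      rw [h'] at h
      change (g (bidiscMk ⟨p.1.1, p.2.1⟩ discZero) - g (bidiscMk discZero discZero)) +
        g (bidiscMk discZero ⟨p.1.2, p.2.2⟩) = g p
      linear_combination -h

variable {g : bidisc → ℂ} {c : ℕ × ℕ → ℂ}
  (hs : ∀ p : bidisc, HasSum (fun k => c k * p.1.1 ^ k.2 * p.1.2 ^ k.1) (g p))
include hs

theorem hasSum_mixed (z w : unitDisc) :
    HasSum (fun k : ℕ × ℕ => (if k.1 = 0 ∨ k.2 = 0 then 0 else c k) * z.1 ^ k.2 * w.1 ^ k.1)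
      (g (bidiscMk z w) - g (bidiscMk z discZero) - g (bidiscMk discZero w) +
        g (bidiscMk discZero discZero)) := by
  refine ((((hs (bidiscMk z w)).sub (hs (bidiscMk z discZero))).sub
    (hs (bidiscMk discZero w))).add (hs (bidiscMk discZero discZero))).congr_term fun k => ?_
  obtain ⟨m, n⟩ := k
  simp only [bidiscMk, discZero]
  by_cases hm : m = 0
  · subst hm; simp
  · by_cases hn : n = 0
    · subst hn; simp [hm]
    · simp [hm, hn]

/-- Only powers w^0 carry nonzero coefficients, so w may be any complex number; the slice thereby
becomes a double series to which the two-variable multiplier theorem applies. -/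
theorem hasSum_left (z : unitDisc) (w : ℂ) :
    HasSum (fun k : ℕ × ℕ => (if k.1 = 0 then c k else 0) * z.1 ^ k.2 * w ^ k.1)
      (g (bidiscMk z discZero)) := by
  refine (hs (bidiscMk z discZero)).congr_term fun k => ?_
  obtain ⟨m, n⟩ := k
  simp only [bidiscMk, discZero]
  by_cases hm : m = 0
  · subst hm; simp
  · simp [hm]

theorem hasSum_right (z : ℂ) (w : unitDisc) :
    HasSum (fun k : ℕ × ℕ => (if k.1 ≠ 0 ∧ k.2 = 0 then c k else 0) * z ^ k.2 * w.1 ^ k.1)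
      (g (bidiscMk discZero w) - g (bidiscMk discZero discZero)) := by
  refine ((hs (bidiscMk discZero w)).sub (hs (bidiscMk discZero discZero))).congr_term fun k => ?_
  obtain ⟨m, n⟩ := k
  simp only [bidiscMk, discZero]
  by_cases hm : m = 0
  · subst hm; simp
  · by_cases hn : n = 0
    · subst hn; simp [hm]
    · simp [hm, hn]

end Split

/-- The mixed difference has as coefficients exactly those with both indices nonzero, so uniqueness
of power series applies. -/
theorem mem_splitFunctions_iff_coeff {g : HInfinity bidisc} {c : ℕ × ℕ → ℂ}
    (hs : ∀ p : bidisc, HasSum (fun k => c k * p.1.1 ^ k.2 * p.1.2 ^ k.1) (g.1 p)) :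
    g ∈ splitFunctions ↔ ∀ k : ℕ × ℕ, k.1 ≠ 0 → k.2 ≠ 0 → c k = 0 := by
  rw [mem_splitFunctions_iff]
  constructor
  · intro h k h₁ h₂
    have h0 := eq_zero_of_hasSum_pow_pow fun z hz w hw => by
      have h3 := hasSum_mixed hs ⟨z, hz⟩ ⟨w, hw⟩
      rw [h] at h3
      exact h3
    simpa [h₁, h₂] using congrFun h0 k
  · intro h z w
    have h0 := hasSum_mixed hs z w
    refine h0.unique (hasSum_zero.congr_term fun k => ?_)
    by_cases hk : k.1 = 0 ∨ k.2 = 0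
    · simp [hk]
    · rw [not_or] at hk
      simp [h k hk.1 hk.2]

/-- The function `(z, w) ↦ z w`. -/
def zwFunction : HInfinity bidisc :=
  ⟨fun p => p.1.1 * p.1.2, ⟨fun p => p.1 * p.2, by fun_prop, fun _ => rfl⟩, 1, fun p => by
    have h₁ := mem_ball_zero_iff.1 p.2.1
    have h₂ := mem_ball_zero_iff.1 p.2.2
    rw [norm_mul]
    exact mul_le_one₀ h₁.le (norm_nonneg _) h₂.le⟩

theorem zwFunction_notMem_splitFunctions : zwFunction ∉ splitFunctions := by
  intro h
  have hb : (1 / 2 : ℂ) ∈ unitDisc := by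
    rw [mem_ball_zero_iff]
    norm_num
  have := (mem_splitFunctions_iff _).1 h ⟨1 / 2, hb⟩ ⟨1 / 2, hb⟩
  simp [zwFunction, bidiscMk, discZero] at this

namespace TwoLoopGraph

open EllTwo FreeSemigroupoid

/-! ### Inner derivations -/

theorem edgeOp_e_apply (x : PathHilbert Vertex) (k : ℕ × ℕ) :
    edgeOp e x (crossPath k) = if k.1 = 0 then x (loopPath₂ k.2) else 0 := by
  have h : edgeOp e = transfer (fun n => crossPath (0, n)) loopPath₂ (crossPath_mk_injective 0)
      loopPath₂_injective := by
    rw [← edgeOp_e₁_pow_mul_edgeOp_e, pow_zero, one_mul]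
  rw [h]
  obtain ⟨m, n⟩ := k
  split_ifs with hm
  · simp only at hm
    subst hm
    exact transfer_apply (crossPath_mk_injective 0) loopPath₂_injective x n
  · refine transfer_apply_of_notMem _ _ x fun ⟨j, hj⟩ => hm ?_
    exact (congrArg Prod.fst (crossPath_injective hj)).symm

/-- The term L_e T ξ_{v₂} is supported on paths ending with `e`, those with m = 0. The term T ξ_e
equals R_e T ξ_{v₁}, with R_e right multiplication by `e`, and is supported on paths starting with
`e`, those with n = 0. -/
theorem apply_crossPath_eq_zero {T : PathHilbert Vertex →L[ℂ] PathHilbert Vertex}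
    (hT : T ∈ freeSemigroupoidAlg Vertex) {k : ℕ × ℕ} (h₁ : k.1 ≠ 0) (h₂ : k.2 ≠ 0) :
    (edgeOp e * T - T * edgeOp e) (ξ (loopPath₂ 0)) (crossPath k) = 0 := by
  have h3 : T (rightE (ξ (loopPath₁ 0))) = rightE (T (ξ (loopPath₁ 0))) :=
    DFunLike.congr_fun (mul_rightE hT) _
  rw [sub_apply, mul_apply_eq_comp, mul_apply_eq_comp, edgeOp_e_loopPath₂, ← rightE_loopPath₁, h3,
    lp.coeFn_sub, Pi.sub_apply, edgeOp_e_apply, if_neg h₁, zero_sub, neg_eq_zero]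
  exact transfer_apply_of_notMem _ _ _ fun ⟨j, hj⟩ =>
    h₂ (congrArg Prod.snd (crossPath_injective hj)).symm

/-- T ξ_{v₂} has only components along paths from v₂ (by `rightV₂`) to v₁ (by `h₁`), that is, along
the given coordinates. Commutation with right multiplication by e₂ carries the vanishing to every
ξ_{e₂^n}, and T = T L_{v₂} disposes of the rest. -/
theorem eq_zero_of_coeff_eq_zero {T : PathHilbert Vertex →L[ℂ] PathHilbert Vertex}
    (hT : T ∈ freeSemigroupoidAlg Vertex) (h₁ : vertexOp .v₁ * T = T) (h₂ : T * vertexOp .v₂ = T)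
    (hc : ∀ k, T (ξ (loopPath₂ 0)) (crossPath k) = 0) : T = 0 := by
  have h0 : T (ξ (loopPath₂ 0)) = 0 := by
    refine lp.ext (funext fun w => ?_)
    rw [lp.coeFn_zero, Pi.zero_apply]
    rcases path_cases w with ⟨m, rfl⟩ | ⟨n, rfl⟩ | ⟨k, rfl⟩
    · have h : T (rightV₂ (ξ (loopPath₂ 0))) = rightV₂ (T (ξ (loopPath₂ 0))) :=
        DFunLike.congr_fun (mul_rightV₂ hT) _
      rw [rightV₂_loopPath₂] at h
      rw [h, rightV₂, add_apply, lp.coeFn_add, Pi.add_apply,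
        transfer_apply_of_notMem _ _ _ fun ⟨n, h⟩ => loopPath₁_ne_loopPath₂ m n h.symm,
        transfer_apply_of_notMem _ _ _ fun ⟨k, h⟩ => loopPath₁_ne_crossPath m k h.symm, add_zero]
    · rw [← h₁, mul_apply_eq_comp]
      refine transfer_apply_of_notMem (ofPathsTo_injective _) (ofPathsTo_injective _) _ fun ⟨p, hp⟩ => ?_
      simpa [ofPathsTo, loopPath₂] using congrArg FreeSemigroupoid.rng hp
    · exact hc k
  refine ext_paths (fun m => ?_) (fun n => ?_) fun k => ?_
  · rw [← h₂, mul_apply_eq_comp, vertexOp_v₂_loopPath₁, map_zero, zero_apply]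
  · rw [zero_apply]
    induction n with
    | zero => exact h0
    | succ n ih =>
      have h : T (rightE₂ (ξ (loopPath₂ n))) = rightE₂ (T (ξ (loopPath₂ n))) :=
        DFunLike.congr_fun (mul_rightE₂ hT) _
      rw [← rightE₂_loopPath₂, h, ih, map_zero]
  · rw [← h₂, mul_apply_eq_comp, vertexOp_v₂_crossPath, map_zero, zero_apply]

theorem IsNormalized.eq_zero {δ : Der} (hδ : IsNormalized δ) (he : δ.1 (edgeElt e) = 0) : δ = 0 :=
  derivation_eq_zero (s := semigroupoidGenerators Vertex) rfl fun _ ha hs =>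
    mem_of_mem_generators (p := fun a => ∀ ha : a ∈ tensorAlg Vertex, δ.1 ⟨a, ha⟩ = 0)
      (fun _ => hδ.v₁) (fun _ => hδ.v₂) (fun _ => hδ.e₁) (fun _ => hδ.e₂) (fun _ => he) hs ha

-- After normalization the value at `e` is determined by these coefficients, and a normalized
-- derivation by its value at `e`; so what remains of δ is the inner part.
set_option maxHeartbeats 1000000 in
theorem mem_innerDerivations_of_coeff_eq_zero {δ : Der}
    (hc : ∀ k, δ.1 (edgeElt e) (ξ (loopPath₂ 0)) (crossPath k) = 0) :
    δ ∈ innerDerivations (tensorAlg Vertex) (freeSemigroupoidAlg Vertex) := by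
  obtain ⟨δ', hδ', hin, he⟩ := exists_isNormalized δ
  have h₁ : vertexOp .v₁ * δ'.1 (edgeElt e) = δ'.1 (edgeElt e) :=
    mul_derivation_of_eq_zero hδ'.v₁ (Subtype.ext (vertexOp_mul_edgeOp e))
  have h₂ : δ'.1 (edgeElt e) * vertexOp .v₂ = δ'.1 (edgeElt e) :=
    derivation_mul_of_eq_zero hδ'.v₂ (Subtype.ext (edgeOp_mul_vertexOp e))
  have h0 : δ'.1 (edgeElt e) = 0 :=
    eq_zero_of_coeff_eq_zero (δ'.2.1 _) h₁ h₂ fun k => by rw [he]; exact hc k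
  rwa [hδ'.eq_zero h0, sub_zero] at hin

/-- The two slices of g through the origin are bounded, so they act as one-variable multipliers
inside 𝔏_G: g(z,0) as a series in L_{e₂}, g(0,w) - g(0,0) as a series in L_{e₁}. T is the first
minus the second, so L_e T supplies the coefficients with m = 0 and -T L_e those with n = 0. -/
theorem exists_commutator_coeff_eq {g : HInfinity bidisc} {c : ℕ × ℕ → ℂ}
    (hs : ∀ p : bidisc, HasSum (fun k => c k * p.1.1 ^ k.2 * p.1.2 ^ k.1) (g.1 p))
    (hc : ∀ k : ℕ × ℕ, k.1 ≠ 0 → k.2 ≠ 0 → c k = 0) :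
    ∃ T ∈ freeSemigroupoidAlg Vertex,
      ∀ k, (edgeOp e * T - T * edgeOp e) (ξ (loopPath₂ 0)) (crossPath k) = c k := by
  obtain ⟨g, ⟨G, hG, hGg⟩, C, hC⟩ := g
  simp only at hs
  have hz0 : ∀ z (hz : z ∈ unitDisc), G (z, 0) = g (bidiscMk ⟨z, hz⟩ discZero) :=
    fun z hz => hGg (bidiscMk ⟨z, hz⟩ discZero)
  have h0w : ∀ w (hw : w ∈ unitDisc), G (0, w) = g (bidiscMk discZero ⟨w, hw⟩) :=
    fun w hw => hGg (bidiscMk discZero ⟨w, hw⟩)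
  have h00 : G (0, 0) = g (bidiscMk discZero discZero) := hGg (bidiscMk discZero discZero)
  obtain ⟨M, hM, hMc⟩ := exists_multiplier (g := fun z _ => G (z, 0)) (C := C)
    (c := fun k => if k.1 = 0 then c k else 0)
    (fun z hz w _ => by
      rw [hz0 z hz]
      exact hasSum_left hs ⟨z, hz⟩ w)
    fun z hz _ _ => by rw [hz0 z hz]; exact hC _
  -- The constant term already belongs to `M`; subtracting G(0,0) keeps it from being counted twice.
  obtain ⟨N, hN, hNc⟩ := exists_multiplier (g := fun _ w => G (0, w) - G (0, 0)) (C := C + C)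
    (c := fun k => if k.1 ≠ 0 ∧ k.2 = 0 then c k else 0)
    (fun z _ w hw => by
      rw [h00, h0w w hw]
      exact hasSum_right hs z ⟨w, hw⟩)
    fun z _ w hw => by
      rw [h00, h0w w hw]
      exact (norm_sub_le _ _).trans (add_le_add (hC _) (hC _))
  refine ⟨ofLoop₂ ∘L M ∘L toLoop₂ - (ofCross ∘L N ∘L toCross + ofLoop₁ ∘L N ∘L toLoop₁),
    sub_mem (loop₂_mem_of_isWeakSeries hM fun k hk => if_neg hk)
      (loop₁_mem_of_isWeakSeries hN fun k hk => if_neg fun h => hk h.2), fun k => ?_⟩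
  have h₁ : (ofLoop₂ ∘L M ∘L toLoop₂ - (ofCross ∘L N ∘L toCross + ofLoop₁ ∘L N ∘L toLoop₁))
      (ξ (loopPath₂ 0)) = ofLoop₂ (M (ξ 0)) := by
    simp; rfl
  have h₂ : (ofLoop₂ ∘L M ∘L toLoop₂ - (ofCross ∘L N ∘L toCross + ofLoop₁ ∘L N ∘L toLoop₁))
      (ξ (crossPath (0, 0))) = -ofCross (N (ξ 0)) := by
    simp; rfl
  have h₃ : ofLoop₂ (M (ξ 0)) (loopPath₂ k.2) = M (ξ 0) (0, k.2) :=
    transfer_apply loopPath₂_injective zeroPair_injective _ _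
  have h₄ : ofCross (N (ξ 0)) (crossPath k) = N (ξ 0) k :=
    transfer_apply crossPath_injective Function.injective_id _ k
  rw [sub_apply, mul_apply_eq_comp, mul_apply_eq_comp, edgeOp_e_loopPath₂, h₁, h₂, sub_neg_eq_add,
    lp.coeFn_add, Pi.add_apply, edgeOp_e_apply, h₃, h₄, hMc, hNc]
  obtain ⟨m, n⟩ := k
  by_cases hm : m = 0
  · subst hm; simp
  · by_cases hn : n = 0
    · subst hn; simp [hm]
    · simp [hm, hn, hc (m, n) hm hn]

-- A split symbol is matched by that of an inner derivation; the difference has zero symbol and is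
-- therefore inner too.
set_option maxHeartbeats 1000000 in
theorem derivationSymbol_mem_splitFunctions_iff (δ : Der) :
    derivationSymbol δ ∈ splitFunctions ↔
      δ ∈ innerDerivations (tensorAlg Vertex) (freeSemigroupoidAlg Vertex) := by
  rw [mem_splitFunctions_iff_coeff (hasSum_derivationSymbol δ)]
  constructor
  · intro hc
    obtain ⟨T, hT, hTc⟩ := exists_commutator_coeff_eq (hasSum_derivationSymbol δ) hc
    have hin : commutatorDerivation T
        (commutator_mem (tensorAlg_le_freeSemigroupoidAlg Vertex) hT) ∈ innerDerivations _ _ :=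
      commutatorDerivation_mem_innerDerivations (tensorAlg_le_freeSemigroupoidAlg Vertex) hT
    have h : δ - commutatorDerivation T
        (commutator_mem (tensorAlg_le_freeSemigroupoidAlg Vertex) hT) ∈ innerDerivations _ _ := by
      refine mem_innerDerivations_of_coeff_eq_zero fun k => ?_
      change (δ.1 (edgeElt e) - (edgeOp e * T - T * edgeOp e)) (ξ (loopPath₂ 0)) (crossPath k) = 0
      rw [sub_apply, lp.coeFn_sub, Pi.sub_apply, hTc, sub_self]
    have h' := add_mem h hin
    rwa [sub_add_cancel] at h'
  · rintro ⟨T, hT, hδ⟩ k h₁ h₂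
    rw [hδ (edgeElt e)]
    exact apply_crossPath_eq_zero hT h₁ h₂

end TwoLoopGraph

/-! ### The isomorphism and nontriviality. -/

set_option maxHeartbeats 1000000 in
theorem mainTheorem12 :
    (∃ Φ : TwoLoopGraph.H1 ≃ₗ[ℂ] (HInfinity bidisc ⧸ splitFunctions),
      ∀ g : HInfinity bidisc, ∃ δ : TwoLoopGraph.Der,
        δ.1 (vertexElt TwoLoopGraph.Vertex.v₁) = 0 ∧
        δ.1 (vertexElt TwoLoopGraph.Vertex.v₂) = 0 ∧
        δ.1 (edgeElt TwoLoopGraph.e₁) = 0 ∧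
        δ.1 (edgeElt TwoLoopGraph.e₂) = 0 ∧
        (∀ p : bidisc, HasSum
          (fun k : ℕ × ℕ =>
            (δ.1 (edgeElt TwoLoopGraph.e) (EllTwo.ξ TwoLoopGraph.pathV₂)
              (TwoLoopGraph.pathMN k.1 k.2) : ℂ) * p.1.1 ^ k.2 * p.1.2 ^ k.1)
          (g.1 p)) ∧
        Φ (FirstCohomology.mk _ _ δ) = Submodule.Quotient.mk g) ∧
    Nontrivial TwoLoopGraph.H1 := by
  have hsurj : Function.Surjective TwoLoopGraph.derivationSymbol := fun g =>
    (TwoLoopGraph.exists_derivationSymbol_eq g).imp fun _ h => h.2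
  obtain ⟨Φ, hΦ⟩ := exists_quotient_linearEquiv hsurj
    TwoLoopGraph.derivationSymbol_mem_splitFunctions_iff
  refine ⟨⟨Φ, fun g => ?_⟩, ?_⟩
  · obtain ⟨δ, hδ, rfl⟩ := TwoLoopGraph.exists_derivationSymbol_eq g
    exact ⟨δ, hδ.v₁, hδ.v₂, hδ.e₁, hδ.e₂, TwoLoopGraph.hasSum_derivationSymbol δ, hΦ δ⟩
  · have h : Nontrivial (HInfinity bidisc ⧸ splitFunctions) :=
      ⟨⟨Submodule.Quotient.mk zwFunction, 0, fun h =>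
        zwFunction_notMem_splitFunctions ((Submodule.Quotient.mk_eq_zero _).1 h)⟩⟩
    exact Φ.symm.injective.nontrivial
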